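/- Let $\Omega\subset\mathbb R^3$ be an open set with Lipschitz boundary $S=\partial\Omega$ (locally $S$ is, in suitable Cartesian coordinates, the graph of a Lipschitz function with $\Omega$ exactly the side below it; corners and edges are allowed). Let $dS$ be the surface measure (two-dimensional Hausdorff measure) and $n(x)$ the unit normal pointing out of $\Omega$, which exists at almost every point of $S$. Let $x_0\in S$ be a point at which the outward unit normal $n_0=n(x_0)$ exists, that is, $S$ has a tangent plane at $x_0$ and $\Omega$ lies on the side opposite to $n_0$. Put $G(x,x_0)=1/|x-x_0|$, $\partial G/\partial n=\nabla_xG\cdot n(x)$. A *potential* in $\Omega$ is a function that is harmonic in $\Omega$ and $C^1$ on $\overline\Omega$; for a potential $\phi$ put $\partial\phi/\partial n=\nabla\phi\cdot n$ on $S$ and $(\partial\phi/\partial n)_0=\nabla\phi(x_0)\cdot n_0$. A potential $f$ is *admissible* if $f(x_0)=0$ and $\nabla f(x_0)\cdot n_0=1$. For a potential $\phi$ and an admissible $f$ consider the integrands $$A=\Big[\phi(x)-\phi(x_0)-\Big(\frac{\partial\phi}{\partial n}\Big)_0f(x)\Big]\frac{\partial G}{\partial n},\qquad B=\Big[\frac{\partial\phi}{\partial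 n}-\Big(\frac{\partial\phi}{\partial n}\Big)_0\nabla f(x)\cdot n\Big]G(x,x_0).$$ 1. (Internal domains.) If $\Omega$ is bounded, then for every potential $\phi$ and every admissible $f$ the functions $A$ and $B$ are integrable on $S$ and $$\int_S A\,dS=\int_S B\,dS ;$$ no solid angle term appears. 2. (External domains.) If $\mathbb R^3\setminus\Omega$ is bounded, $\phi$ is a potential with $\phi=O(|x|^{-1})$, $\nabla\phi=O(|x|^{-2})$ as $|x|\to\infty$, and $f$ is admissible with $f-c=O(|x|^{-1})$, $\nabla f=O(|x|^{-2})$ for a constant $c$, then $A$ and $B$ are integrable on $S$; as $R\to\infty$ the integrals of $A$ and $B$ over the sphere $|x-x_0|=R$ (with its outward normal) tend to $4\pi[\phi(x_0)+(\partial\phi/\partial n)_0\,c]$ and to $0$; and the same equation holds once this contribution of the sphere at infinity is included: $$\int_S A\,dS+4\pi\Big[\phi(x_0)+\Big(\frac{\partial\phi}{\partial n}\Big)_0c\Big]=\int_S B\,dS .$$ 3. (Non-singularity.) If $S$ is bounded and is a $C^2$ surface near $x_0$, and the potential $\phi$ and the admissible $f$ are $C^2$ up to the boundary near $x_0$, then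 $A$ and $B$ are bounded on $S\setminus\{x_0\}$. 4. (Choices of $f$.) The function $f(x)=n_0\cdot(x-x_0)$ is admissible. If $x_D\notin\overline\Omega$ and $n_0\cdot(x_0-x_D)\neq0$, then $$f(x)=c\Big(1-\frac{|x_0-x_D|}{|x-x_D|}\Big),\qquad c=\frac{|x_0-x_D|^2}{n_0\cdot(x_0-x_D)},$$ is admissible, and if $\mathbb R^3\setminus\Omega$ is bounded it satisfies the conditions at infinity in part 2 with this constant $c$. -/

import Mathlib

open MeasureTheory Filter Topology Set Bornology InnerProductSpace
open scoped NNReal RealInnerProductSpace Gradient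

namespace NSBIM

noncomputable section

/-- Three-dimensional Euclidean space. -/
abbrev E3 : Type := EuclideanSpace ℝ (Fin 3)

/-- The Euclidean plane. -/
abbrev E2 : Type := EuclideanSpace ℝ (Fin 2)

/-- Near `p`, and in suitable Cartesian coordinates `(x', t)`, the set `Ω` is the region
`t < g x'` strictly below the graph of a function `g` with property `P`. -/
def IsSubgraphNear (P : (E2 → ℝ) → Prop) (Ω : Set E3) (p : E3) : Prop :=
  ∃ (e : E3 ≃ᵃⁱ[ℝ] WithLp 2 (E2 × ℝ)) (g : E2 → ℝ) (U : Set E3),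
    P g ∧ IsOpen U ∧ p ∈ U ∧ ∀ x ∈ U, (x ∈ Ω ↔ (e x).snd < g (e x).fst)

/-- The boundary of `Ω` is locally the graph of a Lipschitz function, with `Ω` on one side of it
(edges and corners are allowed). -/
def HasLipschitzBoundary (Ω : Set E3) : Prop :=
  ∀ p ∈ frontier Ω, IsSubgraphNear (fun g => ∃ K : ℝ≥0, LipschitzWith K g) Ω p

/-- The boundary of `Ω` is a `C²` surface near `p`, with `Ω` on one side of it. -/
def HasC2BoundaryNear (Ω : Set E3) (p : E3) : Prop :=
  IsSubgraphNear (fun g => ContDiff ℝ 2 g) Ω p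

/-- `n` is an outward unit normal of `Ω` at `x`: up to cones of arbitrarily small opening around
the plane through `x` orthogonal to `n`, near `x` the set `Ω` is the half-space
`⟪n, y - x⟫ < 0`. -/
def IsOutwardUnitNormal (Ω : Set E3) (x n : E3) : Prop :=
  ‖n‖ = 1 ∧ ∀ ε > 0, ∀ᶠ y in 𝓝 x,
    (⟪n, y - x⟫ < -(ε * ‖y - x‖) → y ∈ Ω) ∧ (ε * ‖y - x‖ < ⟪n, y - x⟫ → y ∉ Ω)

open Classical in
/-- The outward unit normal field of `Ω` (with value `0` where there is no normal). -/
def outwardNormal (Ω : Set E3) (x : E3) : E3 :=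
  if h : ∃ n, IsOutwardUnitNormal Ω x n then h.choose else 0

/-- There is at most one outward unit normal at each point. -/
theorem IsOutwardUnitNormal.unique {Ω : Set E3} {x m n : E3}
    (hm : IsOutwardUnitNormal Ω x m) (hn : IsOutwardUnitNormal Ω x n) : m = n := by
  by_contra hne
  have hlt : ⟪m, n⟫ < 1 := by
    refine lt_of_le_of_ne ?_ fun h => hne ((inner_eq_one_iff_of_norm_eq_one hm.1 hn.1).1 h)
    simpa [hm.1, hn.1] using real_inner_le_norm m n
  set v : E3 := n - m with hv
  have hv0 : 0 < ‖v‖ := norm_pos_iff.2 (sub_ne_zero.2 (Ne.symm hne))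
  have hmv : ⟪m, v⟫ = -(1 - ⟪m, n⟫) := by
    rw [hv, inner_sub_right, real_inner_self_eq_norm_sq, hm.1]; ring
  have hnv : ⟪n, v⟫ = 1 - ⟪m, n⟫ := by
    rw [hv, inner_sub_right, real_inner_self_eq_norm_sq, hn.1, real_inner_comm]; ring
  set a : ℝ := 1 - ⟪m, n⟫ with ha
  have ha0 : 0 < a := by linarith
  set ε : ℝ := a / (2 * ‖v‖) with hε
  have hε0 : 0 < ε := by positivity
  have hεv : ε * ‖v‖ = a / 2 := by rw [hε]; field_simp
  have hlim : Tendsto (fun t : ℝ => x + t • v) (𝓝[>] 0) (𝓝 x) := by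
    have h : Continuous fun t : ℝ => x + t • v := by fun_prop
    have h2 := h.tendsto 0
    simp only [zero_smul, add_zero] at h2
    exact h2.mono_left nhdsWithin_le_nhds
  obtain ⟨t, ⟨h1, h2⟩, ht⟩ :=
    (((hlim.eventually (hm.2 ε hε0)).and (hlim.eventually (hn.2 ε hε0))).and
      self_mem_nhdsWithin).exists
  have ht0 : 0 < t := ht
  have hnorm : ε * ‖t • v‖ = t * (a / 2) := by
    rw [norm_smul, Real.norm_of_nonneg ht0.le, ← hεv]; ring
  simp only [add_sub_cancel_left, hnorm, inner_smul_right, hmv, hnv] at h1 h2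
  exact h2.2 (by nlinarith) (h1.1 (by nlinarith))

theorem outwardNormal_eq {Ω : Set E3} {x n : E3} (h : IsOutwardUnitNormal Ω x n) :
    outwardNormal Ω x = n := by
  have hex : ∃ n, IsOutwardUnitNormal Ω x n := ⟨n, h⟩
  rw [outwardNormal, dif_pos hex]
  exact hex.choose_spec.unique h

/-- `u` is a potential in `Ω`: harmonic in `Ω` and continuously differentiable up to the
boundary. -/
def IsPotential (Ω : Set E3) (u : E3 → ℝ) : Prop :=
  HarmonicOnNhd u Ω ∧ ContDiffOn ℝ 1 u (closure Ω)

/-- The derivative `∇u(x) · ν` of a function `u` on the closure of `Ω`. -/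
def normalDeriv (Ω : Set E3) (u : E3 → ℝ) (x ν : E3) : ℝ :=
  ⟪gradientWithin u (closure Ω) x, ν⟫

/-- The free-space Green's function `G(x, x₀) = 1 / |x - x₀|`. -/
def green (x₀ x : E3) : ℝ := 1 / ‖x - x₀‖

/-- The conditions on the auxiliary function `f`. -/
def IsAdmissible (Ω : Set E3) (x₀ n₀ : E3) (f : E3 → ℝ) : Prop :=
  IsPotential Ω f ∧ f x₀ = 0 ∧ normalDeriv Ω f x₀ n₀ = 1

/-- `[φ(x) - φ(x₀) - (∂φ/∂n)₀ f(x)] ∂G(x, x₀)/∂ν`. -/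
def doubleLayerIntegrand (Ω : Set E3) (x₀ n₀ : E3) (φ f : E3 → ℝ) (ν : E3 → E3) (x : E3) : ℝ :=
  (φ x - φ x₀ - normalDeriv Ω φ x₀ n₀ * f x) * ⟪∇ (green x₀) x, ν x⟫

/-- `[∂φ/∂ν - (∂φ/∂n)₀ ∇f(x) · ν] G(x, x₀)`. -/
def singleLayerIntegrand (Ω : Set E3) (x₀ n₀ : E3) (φ f : E3 → ℝ) (ν : E3 → E3) (x : E3) : ℝ :=
  (normalDeriv Ω φ x (ν x) - normalDeriv Ω φ x₀ n₀ * normalDeriv Ω f x (ν x)) * green x₀ x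

/-- `u = O(1/|x|)` and `∇u = O(1/|x|²)` as `|x| → ∞`. -/
def DecaysAtInfinity (Ω : Set E3) (u : E3 → ℝ) : Prop :=
  u =O[cobounded E3] (fun x => 1 / ‖x‖) ∧
    gradientWithin u (closure Ω) =O[cobounded E3] (fun x => 1 / ‖x‖ ^ 2)

/-- The linear choice `f(x) = n₀ · (x - x₀)`. -/
def linearChoice (x₀ n₀ x : E3) : ℝ := ⟪n₀, x - x₀⟫

/-- The constant `|x₀ - x_D|² / (n₀ · (x₀ - x_D))`. -/
def inverseCoeff (x₀ n₀ xD : E3) : ℝ := ‖x₀ - xD‖ ^ 2 / ⟪n₀, x₀ - xD⟫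

/-- The inverse-distance choice
`f(x) = |x₀ - x_D|² / (n₀ · (x₀ - x_D)) * (1 - |x₀ - x_D| / |x - x_D|)`. -/
def inverseChoice (x₀ n₀ xD x : E3) : ℝ :=
  inverseCoeff x₀ n₀ xD * (1 - ‖x₀ - xD‖ / ‖x - xD‖)

end

end NSBIM

open NSBIM

/-! Put u = φ − φ(x₀) − (∂φ/∂n)₀ f (`reducedPotential`). This is a potential with u(x₀) = 0, and A =
u ∂G/∂n, B = (∂u/∂n) G, so the integral equation is Green's second identity for u and G with the
pole on the boundary. Because u is differentiable up to the boundary and vanishes at x₀, |u| ≤ C|x −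
x₀|. Hence A, B and the field u∇G − G∇u are all O(1/|x − x₀|), which is integrable on a surface. The
field is divergence-free in Ω. Multiply it by a smooth cutoff that removes the ball of radius ε
about x₀: the cutoff has gradient O(1/ε), supported in a shell of volume O(ε³), so the volume term
is O(ε) and the pole leaves no solid angle behind (`tendsto_integral_gradient_ballCutoff`,
`integral_green_layers`).

The analytic input is the divergence theorem on bounded Lipschitz domains with Hausdorff surface
measure (`HasLipschitzBoundary.gaussGreen`). It rests on two facts. The area formula for Lipschitz
graphs (`comap_graphMap`) follows from Rademacher's theorem: the plane is cut into countably many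
pieces on which the graph is nearly isometric to a plane of fixed slope. In a graph chart, a field V
is multiplied by a smooth step in depth/δ; the product is Lipschitz with compact support, so its
divergence integrates to zero, and as δ → 0 the derivative of the step concentrates on the graph and
yields the flux of V. Bump functions pass from charts to the whole domain.

For external domains the bounded identity is applied to Ω ∩ B(x₀, R), whose boundary is the disjoint
union of S and a sphere. On the sphere ∂G/∂n = −1/R² and u → −(φ(x₀) + (∂φ/∂n)₀ c), while the area
is 4πR²; this gives the term at infinity. The single-layer integrand is o(1/R²) there and
disappears.

For non-singularity on a C² surface, (x − x₀)·n(x) = O(|x − x₀|²), which with u = O(|x − x₀|)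
compensates the |x − x₀|⁻³ in ∂G/∂n. The condition ∂f/∂n = 1 at x₀ makes ∂u/∂n vanish there, so
∂u/∂n = O(|x − x₀|) and its product with G is bounded. -/

namespace NSBIM

noncomputable section

/-! ### Area formula for Lipschitz graphs -/

/-- The surface element `√(1 + |a|²)` of a graph with slope `a`. -/
def areaFactor (a : E2) : ℝ := √(1 + ‖a‖ ^ 2)

theorem areaFactor_sq (a : E2) : areaFactor a ^ 2 = 1 + ‖a‖ ^ 2 :=
  Real.sq_sqrt (by positivity)

theorem one_le_areaFactor (a : E2) : 1 ≤ areaFactor a :=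
  Real.one_le_sqrt.2 (by nlinarith [sq_nonneg ‖a‖])

theorem areaFactor_pos (a : E2) : 0 < areaFactor a := lt_of_lt_of_le one_pos (one_le_areaFactor a)

theorem continuous_areaFactor : Continuous areaFactor := by
  unfold areaFactor; fun_prop

/-- √(1 + |·|²) is 1-Lipschitz and at least 1, so an additive error ε in the slope costs at most a
factor 1 + ε. -/
theorem areaFactor_le (a b : E2) {ε : ℝ} (h : ‖a - b‖ ≤ ε) :
    areaFactor a ≤ (1 + ε) * areaFactor b := by
  have hε : 0 ≤ ε := (norm_nonneg _).trans h
  have h1 : ‖a‖ ≤ ‖b‖ + ε := by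
    have := norm_add_le b (a - b)
    rw [add_sub_cancel] at this; linarith
  have hb := one_le_areaFactor b
  have hb2 := areaFactor_sq b
  have hbn : ‖b‖ ≤ areaFactor b := by
    apply Real.le_sqrt_of_sq_le; linarith
  refine Real.sqrt_le_iff.2 ⟨by positivity, ?_⟩
  have : ‖a‖ ^ 2 ≤ (‖b‖ + ε) ^ 2 := by gcongr
  nlinarith [mul_nonneg hε (sub_nonneg.2 hbn), mul_nonneg hε (sub_nonneg.2 hb), mul_nonneg hε hε,
    mul_nonneg (mul_nonneg hε hε) (sub_nonneg.2 hb), norm_nonneg b]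

/-- A linear map of the plane which is isometric to the parametrisation `v ↦ (v, ⟪a, v⟫)` of the
plane of slope `a`. -/
def slopeMap (a : E2) : E2 →ₗ[ℝ] E2 :=
  LinearMap.transvection (innerₛₗ ℝ a) ((1 / (1 + areaFactor a)) • a)

theorem slopeMap_apply (a v : E2) :
    slopeMap a v = v + ⟪a, v⟫ • (1 / (1 + areaFactor a)) • a := by
  simp [slopeMap, LinearMap.transvection.apply]

/-- With t = 1 / (1 + J) and |a|² = (J − 1)(J + 1), where J is the area factor, the coefficient 2t +
t²|a|² of ⟪a, v⟫² is exactly 1; this is what dictates the scalar in `slopeMap`. -/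
theorem norm_slopeMap_sq (a v : E2) : ‖slopeMap a v‖ ^ 2 = ‖v‖ ^ 2 + ⟪a, v⟫ ^ 2 := by
  rw [slopeMap_apply, norm_add_sq_real, smul_smul, real_inner_smul_right, norm_smul, mul_pow,
    Real.norm_eq_abs, sq_abs, real_inner_comm]
  have h := areaFactor_sq a
  have hp : (0 : ℝ) < 1 + areaFactor a := by linarith [areaFactor_pos a]
  have : ‖a‖ ^ 2 = (areaFactor a - 1) * (1 + areaFactor a) := by linarith
  rw [this]
  field_simp
  ring

theorem det_slopeMap (a : E2) : LinearMap.det (slopeMap a) = areaFactor a := by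
  rw [slopeMap, LinearMap.transvection.det]
  have h := areaFactor_sq a
  have hp : (0 : ℝ) < 1 + areaFactor a := by linarith [areaFactor_pos a]
  simp only [innerₛₗ_apply_apply, real_inner_smul_right, real_inner_self_eq_norm_sq]
  field_simp
  linarith

/-- Comparing the two-dimensional measures of the images of a set under two maps. -/
theorem euclideanHausdorffMeasure_image_le_of_dist_le {X Y Z : Type*} [Nonempty X]
    [MetricSpace Y] [MeasurableSpace Y] [BorelSpace Y]
    [MetricSpace Z] [MeasurableSpace Z] [BorelSpace Z] {f : X → Y} {h : X → Z} {A : Set X}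
    {c : ℝ≥0} (hfh : ∀ x ∈ A, ∀ y ∈ A, dist (f x) (f y) ≤ c * dist (h x) (h y)) :
    μHE[2] (f '' A) ≤ (c : ENNReal) ^ 2 * μHE[2] (h '' A) := by
  -- The hypothesis forces `f` to agree wherever `h` does, so on `A` the map `f` factors through `h`
  -- even if `h` is not injective. The factor is `c`-Lipschitz, hence multiplies two-dimensional
  -- measure by at most `c ^ 2`.
  have hinv : ∀ x ∈ A, f (Function.invFunOn h A (h x)) = f x := by
    intro x hx
    have h1 : Function.invFunOn h A (h x) ∈ A := Function.invFunOn_mem ⟨x, hx, rfl⟩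
    have h2 : h (Function.invFunOn h A (h x)) = h x := Function.invFunOn_eq ⟨x, hx, rfl⟩
    have := hfh _ h1 _ hx
    rw [h2, dist_self, mul_zero] at this
    exact dist_le_zero.1 this
  have himg : (f ∘ Function.invFunOn h A) '' (h '' A) = f '' A := by
    rw [image_image]
    exact image_congr fun x hx => hinv x hx
  have hlip : LipschitzOnWith c (f ∘ Function.invFunOn h A) (h '' A) := by
    refine LipschitzOnWith.of_dist_le_mul ?_
    rintro _ ⟨x, hx, rfl⟩ _ ⟨y, hy, rfl⟩
    simp only [Function.comp_apply, hinv x hx, hinv y hy]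
    exact hfh x hx y hy
  have := hlip.hausdorffMeasure_image_le (d := (2 : ℕ)) (by norm_num)
  rw [himg] at this
  simp only [Measure.euclideanHausdorffMeasure_def, Measure.smul_apply]
  calc _ ≤ _ := smul_le_smul_of_nonneg_left this zero_le
    _ = _ := by
      rw [mul_smul_comm]
      norm_cast

/-- The parametrisation of the graph of `g` in the coordinates `e`. -/
def graphMap (e : E3 ≃ᵃⁱ[ℝ] WithLp 2 (E2 × ℝ)) (g : E2 → ℝ) (y : E2) : E3 :=
  e.symm (WithLp.toLp 2 (y, g y))

variable {e : E3 ≃ᵃⁱ[ℝ] WithLp 2 (E2 × ℝ)} {g : E2 → ℝ}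

@[simp] theorem apply_graphMap (y : E2) : e (graphMap e g y) = WithLp.toLp 2 (y, g y) := by
  simp [graphMap]

theorem dist_graphMap_sq (y z : E2) :
    dist (graphMap e g y) (graphMap e g z) ^ 2 = ‖y - z‖ ^ 2 + (g y - g z) ^ 2 := by
  rw [graphMap, graphMap, e.symm.dist_map, dist_eq_norm, WithLp.prod_norm_sq_eq_of_L2]
  simp

/-- Both quantities are norms of vectors in E2 × ℝ with the same horizontal part y − z; only the
vertical parts, ⟪a, y − z⟫ and g y − g z, differ. -/
theorem abs_norm_sub_dist_graphMap_le {a y z : E2} {ε : ℝ}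
    (h : |g y - g z - ⟪a, y - z⟫| ≤ ε * ‖y - z‖) :
    |‖slopeMap a (y - z)‖ - dist (graphMap e g y) (graphMap e g z)| ≤ ε * ‖y - z‖ := by
  have h1 : ‖slopeMap a (y - z)‖ = ‖WithLp.toLp 2 (y - z, ⟪a, y - z⟫)‖ := by
    rw [← sq_eq_sq₀ (norm_nonneg _) (norm_nonneg _), norm_slopeMap_sq,
      WithLp.prod_norm_sq_eq_of_L2]
    simp
  have h2 : dist (graphMap e g y) (graphMap e g z) = ‖WithLp.toLp 2 (y - z, g y - g z)‖ := by
    rw [← sq_eq_sq₀ dist_nonneg (norm_nonneg _), dist_graphMap_sq, WithLp.prod_norm_sq_eq_of_L2]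
    simp
  rw [h1, h2]
  refine (abs_norm_sub_norm_le _ _).trans (le_trans (le_of_eq ?_) h)
  rw [← sq_eq_sq₀ (norm_nonneg _) (abs_nonneg _), WithLp.prod_norm_sq_eq_of_L2]
  change ‖(y - z) - (y - z)‖ ^ 2 + ‖⟪a, y - z⟫ - (g y - g z)‖ ^ 2 = _
  rw [sub_self, norm_zero, sq_abs, Real.norm_eq_abs, sq_abs]
  ring

theorem isClosedEmbedding_graphMap (hg : Continuous g) : IsClosedEmbedding (graphMap e g) := by
  have h1 : IsClosedEmbedding (fun y : E2 => (y, g y)) := by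
    refine Topology.IsClosedEmbedding.of_continuous_injective_isClosedMap (by fun_prop)
      (fun a b h => (Prod.ext_iff.1 h).1) fun s hs => ?_
    have : (fun y : E2 => (y, g y)) '' s = {p : E2 × ℝ | p.1 ∈ s ∧ p.2 = g p.1} := by
      ext ⟨a, b⟩
      simp only [mem_image, Prod.mk.injEq, mem_ofPred_eq]
      constructor
      · rintro ⟨x, hx, rfl, rfl⟩; exact ⟨hx, rfl⟩
      · rintro ⟨ha, hb⟩; exact ⟨a, ha, rfl, hb.symm⟩
    rw [this]
    exact (hs.preimage continuous_fst).inter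
      (isClosed_eq continuous_snd (hg.comp continuous_fst))
  exact e.symm.toHomeomorph.isClosedEmbedding.comp
    ((WithLp.homeomorphProd 2 E2 ℝ).symm.isClosedEmbedding.comp h1)

theorem dist_graphMap_le {K : ℝ≥0} (hg : LipschitzWith K g) (y z : E2) :
    dist (graphMap e g y) (graphMap e g z) ≤ (1 + K) * dist y z := by
  refine abs_le_of_sq_le_sq' ?_ (by positivity) |>.2
  rw [dist_graphMap_sq, dist_eq_norm]
  have := hg.dist_le_mul y z
  rw [Real.dist_eq, dist_eq_norm] at this
  have h2 : (g y - g z) ^ 2 ≤ (K * ‖y - z‖) ^ 2 := by rw [← sq_abs (g y - g z)]; gcongr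
  nlinarith [mul_nonneg K.2 (sq_nonneg ‖y - z‖)]

theorem dist_le_dist_graphMap (y z : E2) :
    dist y z ≤ dist (graphMap e g y) (graphMap e g z) := by
  refine abs_le_of_sq_le_sq' ?_ dist_nonneg |>.2
  rw [dist_graphMap_sq, dist_eq_norm]
  nlinarith [sq_nonneg (g y - g z)]

/-- The area of a piece of a graph along which the slope is nearly constant. -/
theorem euclideanHausdorffMeasure_graphMap_image_bounds {a : E2} {A : Set E2} {ε : ℝ≥0}
    (h : ∀ y ∈ A, ∀ z ∈ A, |g y - g z - ⟪a, y - z⟫| ≤ ε * ‖y - z‖) :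
    μHE[2] (graphMap e g '' A) ≤ (1 + ε : ENNReal) ^ 2 * (ENNReal.ofReal (areaFactor a) * volume A) ∧
      ENNReal.ofReal (areaFactor a) * volume A ≤ (1 + ε : ENNReal) ^ 2 * μHE[2] (graphMap e g '' A) := by
  -- The linear model: in the plane the normalised Hausdorff measure is Lebesgue measure, which
  -- `slopeMap a` scales by its determinant.
  have hM : μHE[2] (slopeMap a '' A) = ENNReal.ofReal (areaFactor a) * volume A := by
    rw [EuclideanSpace.euclideanHausdorffMeasure_eq_volume, Measure.addHaar_image_linearMap,
      det_slopeMap, abs_of_pos (areaFactor_pos a)]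
  have hle : ∀ v : E2, ‖v‖ ≤ ‖slopeMap a v‖ := fun v => by
    refine abs_le_of_sq_le_sq' ?_ (norm_nonneg _) |>.2
    rw [norm_slopeMap_sq]; nlinarith [sq_nonneg ⟪a, v⟫]
  rw [← hM]
  have hc : ((1 + ε : ℝ≥0) : ENNReal) = 1 + ε := by push_cast; rfl
  rw [← hc]
  -- Both ‖slopeMap a (y − z)‖ and the distance on the graph dominate ‖y − z‖, so the additive error
  -- ε‖y − z‖ becomes a factor 1 + ε in either direction.
  refine ⟨euclideanHausdorffMeasure_image_le_of_dist_le fun y hy z hz => ?_,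
    euclideanHausdorffMeasure_image_le_of_dist_le fun y hy z hz => ?_⟩
  · have h1 := abs_le.1 (abs_norm_sub_dist_graphMap_le (e := e) (h y hy z hz))
    have h2 := mul_le_mul_of_nonneg_left (hle (y - z)) ε.2
    rw [dist_eq_norm (slopeMap a y), ← map_sub]
    push_cast
    simp only [NNReal.val_eq_coe] at h2
    linarith
  · have h1 := abs_le.1 (abs_norm_sub_dist_graphMap_le (e := e) (h y hy z hz))
    have h2 := mul_le_mul_of_nonneg_left (dist_le_dist_graphMap (e := e) (g := g) y z) ε.2
    rw [dist_eq_norm (slopeMap a y), ← map_sub]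
    push_cast
    simp only [NNReal.val_eq_coe, dist_eq_norm y] at h2
    linarith

/-- Making the cover disjoint reduces the comparison to countable additivity. It turns estimates on
pieces of nearly constant slope into estimates of measures. -/
theorem measure_le_of_iUnion_eq_univ {α ι : Type*} [MeasurableSpace α] [Countable ι]
    {μ ν : Measure α} {s : ι → Set α} (hs : ∀ i, MeasurableSet (s i)) (hU : ⋃ i, s i = univ)
    (h : ∀ i A, MeasurableSet A → A ⊆ s i → μ A ≤ ν A) : μ ≤ ν := by
  rcases isEmpty_or_nonempty ι with hι | hι
  · have : (univ : Set α) = ∅ := by rw [← hU]; simp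
    refine Measure.le_iff.2 fun A _ => ?_
    rw [subset_empty_iff.1 ((subset_univ A).trans this.subset)]; simp
  obtain ⟨f, hf⟩ := exists_surjective_nat ι
  refine Measure.le_iff.2 fun A hA => ?_
  have hmeas : ∀ n, MeasurableSet (disjointed (s ∘ f) n) :=
    MeasurableSet.disjointed fun n => hs (f n)
  have hAeq : A = ⋃ n, A ∩ disjointed (s ∘ f) n := by
    rw [← inter_iUnion, iUnion_disjointed]
    simp only [Function.comp_apply]
    rw [hf.iUnion_comp s, hU, inter_univ]
  have hd : Pairwise (Function.onFun Disjoint fun n => A ∩ disjointed (s ∘ f) n) := fun i j hij =>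
    (disjoint_disjointed (s ∘ f) hij).mono inter_subset_right inter_subset_right
  rw [hAeq, measure_iUnion hd fun n => hA.inter (hmeas n),
    measure_iUnion hd fun n => hA.inter (hmeas n)]
  exact ENNReal.tsum_le_tsum fun n => h (f n) _ (hA.inter (hmeas n))
    (inter_subset_right.trans (disjointed_subset (s ∘ f) n))

theorem measurable_gradient (g : E2 → ℝ) : Measurable (gradient g) :=
  (toDual ℝ E2).symm.continuous.measurable.comp (measurable_fderiv ℝ g)

/-- A Lipschitz function on the plane is, up to a null set, locally close to affine functions on
the pieces of a countable measurable partition. -/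
theorem exists_cover_slope {K : ℝ≥0} (hg : LipschitzWith K g) {ε : ℝ} (hε : 0 < ε) :
    ∃ (s : Option (ℕ × ℕ) → Set E2) (a : ℕ × ℕ → E2), (∀ i, MeasurableSet (s i)) ∧
      ⋃ i, s i = univ ∧ volume (s none) = 0 ∧
      ∀ i, (∀ y ∈ s (some i), ∀ z ∈ s (some i), |g y - g z - ⟪a i, y - z⟫| ≤ ε * ‖y - z‖) ∧
        ∀ y ∈ s (some i), ‖∇ g y - a i‖ ≤ ε := by
  obtain ⟨d, hd⟩ := TopologicalSpace.exists_dense_seq E2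
  set D : Set E2 := {y | DifferentiableAt ℝ g y}
  have hD : MeasurableSet D := measurableSet_of_differentiableAt ℝ g
  -- Gradients at any two points of `S m` differ by less than ε, since both are within ε/2 of `d m`.
  -- Each `S m` is then split further so that `g` is approximately linear on every piece, with the
  -- gradient at some point of `S m` as slope. The index `none` collects the points of
  -- non-differentiability, null by Rademacher's theorem.
  set S : ℕ → Set E2 := fun m => D ∩ {y | ‖∇ g y - d m‖ < ε / 2}
  have hS : ∀ m, MeasurableSet (S m) := fun m =>
    hD.inter (measurableSet_lt ((measurable_gradient g).sub_const _).norm measurable_const)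
  have key : ∀ m, ∃ (t : ℕ → Set E2) (A : ℕ → E2 →L[ℝ] ℝ), Pairwise (Function.onFun Disjoint t) ∧
      (∀ n, MeasurableSet (t n)) ∧ (S m ⊆ ⋃ n, t n) ∧
      (∀ n, ApproximatesLinearOn g (A n) (S m ∩ t n) ⟨ε, hε.le⟩) ∧
      ((S m).Nonempty → ∀ n, ∃ y ∈ S m, A n = fderiv ℝ g y) := fun m =>
    exists_partition_approximatesLinearOn_of_hasFDerivWithinAt g (S m) (fderiv ℝ g)
      (fun x hx => (DifferentiableAt.hasFDerivAt hx.1).hasFDerivWithinAt) (fun _ => ⟨ε, hε.le⟩)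
      (fun _ => (NNReal.coe_ne_zero.1 hε.ne' : (⟨ε, hε.le⟩ : ℝ≥0) ≠ 0))
  choose t A _ ht hSt happ hA using key
  refine ⟨fun i => i.elim Dᶜ fun p => S p.1 ∩ t p.1 p.2,
    fun p => (toDual ℝ E2).symm (A p.1 p.2), ?_, ?_, ?_, ?_⟩
  · rintro (_ | p)
    · exact hD.compl
    · exact (hS _).inter (ht _ _)
  · refine eq_univ_of_forall fun y => mem_iUnion.2 ?_
    by_cases hy : y ∈ D
    · obtain ⟨m, hm⟩ := hd.exists_dist_lt (∇ g y) (half_pos hε)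
      have hyS : y ∈ S m := ⟨hy, by simpa [dist_eq_norm] using hm⟩
      obtain ⟨n, hn⟩ := mem_iUnion.1 (hSt m hyS)
      exact ⟨some (m, n), hyS, hn⟩
    · exact ⟨none, hy⟩
  · exact hg.ae_differentiableAt
  · rintro ⟨m, n⟩
    refine ⟨fun y hy z hz => ?_, fun y hy => ?_⟩
    · have := happ m n y hy z hz
      rw [← toDual_apply_apply (𝕜 := ℝ), LinearIsometryEquiv.apply_symm_apply]
      exact this
    · obtain ⟨z, hz, hAz⟩ := hA m ⟨y, hy.1⟩ n
      have h1 : ‖∇ g y - d m‖ < ε / 2 := hy.1.2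
      have h2 : ‖∇ g z - d m‖ < ε / 2 := hz.2
      have h3 : (toDual ℝ E2).symm (A m n) = ∇ g z := by rw [hAz]; rfl
      change ‖∇ g y - (toDual ℝ E2).symm (A m n)‖ ≤ ε
      rw [h3, ← sub_sub_sub_cancel_right _ _ (d m)]
      exact (norm_sub_le _ _).trans (by linarith)

/-- The measure on the parameter plane corresponding to the area of the graph. -/
def graphMeasure (g : E2 → ℝ) : Measure E2 :=
  volume.withDensity fun y => ENNReal.ofReal (areaFactor (∇ g y))

theorem measurable_areaFactor_gradient (g : E2 → ℝ) :
    Measurable fun y => areaFactor (∇ g y) :=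
  continuous_areaFactor.measurable.comp (measurable_gradient g)

theorem withDensity_bounds {A : Set E2} (hA : MeasurableSet A) {a : E2} {ε : ℝ≥0}
    (h : ∀ y ∈ A, ‖∇ g y - a‖ ≤ ε) :
    graphMeasure g A ≤ (1 + ε) * (ENNReal.ofReal (areaFactor a) * volume A) ∧
      ENNReal.ofReal (areaFactor a) * volume A ≤ (1 + ε) * graphMeasure g A := by
  have hc : (1 + ε : ENNReal) = ENNReal.ofReal (1 + ε) := by
    rw [ENNReal.ofReal_add zero_le_one ε.coe_nonneg]; simp
  rw [graphMeasure, withDensity_apply _ hA, hc]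
  constructor
  · rw [← mul_assoc, ← ENNReal.ofReal_mul (by positivity), ← setLIntegral_const]
    exact setLIntegral_mono' hA fun y hy => ENNReal.ofReal_le_ofReal (areaFactor_le _ _ (h y hy))
  · rw [← setLIntegral_const, ← lintegral_const_mul' _ _ ENNReal.ofReal_ne_top]
    refine setLIntegral_mono' hA fun y hy => ?_
    rw [← ENNReal.ofReal_mul (by positivity)]
    refine ENNReal.ofReal_le_ofReal (areaFactor_le _ _ ?_)
    rw [norm_sub_rev]; exact h y hy

/-- A Lipschitz parametrisation maps null sets to null sets, so the exceptional set of Rademacher's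
theorem is invisible on the surface. -/
theorem euclideanHausdorffMeasure_graphMap_image_null {K : ℝ≥0} (hg : LipschitzWith K g)
    {A : Set E2} (hA : volume A = 0) : μHE[2] (graphMap e g '' A) = 0 := by
  have h := euclideanHausdorffMeasure_image_le_of_dist_le (f := graphMap e g) (h := id) (A := A)
    (c := 1 + K) fun x _ y _ => by
      push_cast
      exact dist_graphMap_le hg x y
  rw [image_id, EuclideanSpace.euclideanHausdorffMeasure_eq_volume, hA, mul_zero] at h
  exact le_antisymm h zero_le

theorem measurableEmbedding_graphMap (hg : Continuous g) : MeasurableEmbedding (graphMap e g) :=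
  (isClosedEmbedding_graphMap hg).measurableEmbedding

/-- The area formula for the graph of a Lipschitz function. -/
theorem comap_graphMap {K : ℝ≥0} (hg : LipschitzWith K g) :
    Measure.comap (graphMap e g) μHE[2] = graphMeasure g := by
  have hemb := measurableEmbedding_graphMap (e := e) hg.continuous
  have hnull : ∀ A : Set E2, volume A = 0 → graphMeasure g A = 0 := fun A hA =>
    withDensity_absolutelyContinuous _ _ hA
  -- On each piece, replacing the graph by a plane costs (1 + ε)² and replacing the density by its
  -- value at the fixed slope costs 1 + ε. Letting ε → 0 gives equality.
  have bounds : ∀ ε : ℝ≥0, 0 < ε →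
      Measure.comap (graphMap e g) μHE[2] ≤ ((1 + ε : ENNReal) ^ 3) • graphMeasure g ∧
      graphMeasure g ≤ ((1 + ε : ENNReal) ^ 3) • Measure.comap (graphMap e g) μHE[2] := by
    intro ε hε
    obtain ⟨s, a, hs, hU, hs0, hsa⟩ := exists_cover_slope hg (NNReal.coe_pos.2 hε)
    constructor
    · refine measure_le_of_iUnion_eq_univ hs hU ?_
      rintro (_ | i) A hA hAs
      · rw [hemb.comap_apply, euclideanHausdorffMeasure_graphMap_image_null hg
          (measure_mono_null hAs hs0)]
        exact zero_le
      · have h1 := (euclideanHausdorffMeasure_graphMap_image_bounds (e := e) (A := A)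
          fun y hy z hz => (hsa i).1 y (hAs hy) z (hAs hz)).1
        have h2 := (withDensity_bounds hA fun y hy => (hsa i).2 y (hAs hy)).2
        rw [hemb.comap_apply, Measure.smul_apply, smul_eq_mul, pow_succ, mul_assoc]
        exact h1.trans (by gcongr)
    · refine measure_le_of_iUnion_eq_univ hs hU ?_
      rintro (_ | i) A hA hAs
      · rw [hnull A (measure_mono_null hAs hs0)]
        exact zero_le
      · have h1 := (euclideanHausdorffMeasure_graphMap_image_bounds (e := e) (A := A)
          fun y hy z hz => (hsa i).1 y (hAs hy) z (hAs hz)).2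
        have h2 := (withDensity_bounds hA fun y hy => (hsa i).2 y (hAs hy)).1
        rw [Measure.smul_apply, hemb.comap_apply, smul_eq_mul, pow_succ', mul_assoc]
        exact h2.trans (by gcongr)
  have hlim : ∀ x : ENNReal, Tendsto (fun ε : ℝ≥0 => (1 + ε : ENNReal) ^ 3 * x) (𝓝[>] 0) (𝓝 x) := by
    intro x
    have h1 : Tendsto (fun ε : ℝ≥0 => (1 + ε : ENNReal) ^ 3) (𝓝[>] 0) (𝓝 1) := by
      have h2 : Continuous fun ε : ℝ≥0 => ((((1 + ε) ^ 3 : ℝ≥0)) : ENNReal) :=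
        ENNReal.continuous_coe.comp (by fun_prop)
      have := (h2.tendsto 0).mono_left (nhdsWithin_le_nhds (s := Ioi 0))
      simpa using this
    simpa using ENNReal.Tendsto.mul_const h1 (Or.inl one_ne_zero)
  have hpos : ∀ᶠ ε : ℝ≥0 in 𝓝[>] 0, 0 < ε := self_mem_nhdsWithin
  ext A -
  refine le_antisymm ?_ ?_
  · exact ge_of_tendsto (hlim _) (hpos.mono fun ε hε => by
      simpa using (bounds ε hε).1 A)
  · exact ge_of_tendsto (hlim _) (hpos.mono fun ε hε => by
      simpa using (bounds ε hε).2 A)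

theorem restrict_range_graphMap {K : ℝ≥0} (hg : LipschitzWith K g) :
    (μHE[2] : Measure E3).restrict (range (graphMap e g)) =
      (graphMeasure g).map (graphMap e g) := by
  rw [← comap_graphMap (e := e) hg,
    (measurableEmbedding_graphMap hg.continuous).map_comap]

theorem integral_range_graphMap {K : ℝ≥0} (hg : LipschitzWith K g) (w : E3 → ℝ) :
    ∫ x in range (graphMap e g), w x ∂μHE[2] =
      ∫ y, areaFactor (∇ g y) * w (graphMap e g y) := by
  rw [restrict_range_graphMap hg, (measurableEmbedding_graphMap hg.continuous).integral_map,
    graphMeasure, integral_withDensity_eq_integral_toReal_smul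
      (measurable_areaFactor_gradient g).ennreal_ofReal (ae_of_all _ fun _ => by simp)]
  simp [ENNReal.toReal_ofReal (areaFactor_pos _).le]

end

end NSBIM

namespace NSBIM

noncomputable section

variable {Ω U : Set E3} {e : E3 ≃ᵃⁱ[ℝ] WithLp 2 (E2 × ℝ)} {g : E2 → ℝ} {K : ℝ≥0} {x : E3}

/-! ### Graph charts of a boundary -/

/-- The height of the graph of `g` above `x`. -/
def level (e : E3 ≃ᵃⁱ[ℝ] WithLp 2 (E2 × ℝ)) (g : E2 → ℝ) (x : E3) : ℝ := g (e x).fst - (e x).snd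

/-- The vertical unit vector of the coordinates `e`. -/
def upVector (e : E3 ≃ᵃⁱ[ℝ] WithLp 2 (E2 × ℝ)) : E3 :=
  e.linearIsometryEquiv.symm (WithLp.toLp 2 (0, 1))

/-- The normal `(-∇ g, 1)` of the graph of `g`, not normalised. -/
def graphNormal (e : E3 ≃ᵃⁱ[ℝ] WithLp 2 (E2 × ℝ)) (g : E2 → ℝ) (y : E2) : E3 :=
  e.linearIsometryEquiv.symm (WithLp.toLp 2 (-∇ g y, 1))

/-- The unit normal of the graph of `g` that points upwards. -/
def graphUnitNormal (e : E3 ≃ᵃⁱ[ℝ] WithLp 2 (E2 × ℝ)) (g : E2 → ℝ) (y : E2) : E3 :=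
  (areaFactor (∇ g y))⁻¹ • graphNormal e g y

theorem norm_graphNormal (y : E2) : ‖graphNormal e g y‖ = areaFactor (∇ g y) := by
  rw [graphNormal, LinearIsometryEquiv.norm_map, WithLp.prod_norm_eq_of_L2, areaFactor]
  simp [add_comm]

theorem norm_graphUnitNormal (y : E2) : ‖graphUnitNormal e g y‖ = 1 := by
  rw [graphUnitNormal, norm_smul, norm_graphNormal, norm_inv,
    Real.norm_of_nonneg (areaFactor_pos _).le, inv_mul_cancel₀ (areaFactor_pos _).ne']

theorem areaFactor_smul_graphUnitNormal (y : E2) :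
    areaFactor (∇ g y) • graphUnitNormal e g y = graphNormal e g y := by
  rw [graphUnitNormal, smul_inv_smul₀ (areaFactor_pos _).ne']

theorem inner_graphNormal (y : E2) (v : E3) : ⟪graphNormal e g y, v⟫ =
    (e.linearIsometryEquiv v).snd - ⟪∇ g y, (e.linearIsometryEquiv v).fst⟫ := by
  rw [graphNormal, LinearIsometryEquiv.inner_map_eq_flip, LinearIsometryEquiv.symm_symm,
    WithLp.prod_inner_apply]
  simp only [inner_neg_left]
  change -⟪_, (e.linearIsometryEquiv v).fst⟫ + ⟪(1 : ℝ), (e.linearIsometryEquiv v).snd⟫ = _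
  rw [show ⟪(1 : ℝ), (e.linearIsometryEquiv v).snd⟫ = (e.linearIsometryEquiv v).snd by simp]
  ring

theorem measurable_graphNormal : Measurable (graphNormal e g) := by
  have h : Measurable fun y : E2 => (-∇ g y, (1 : ℝ)) :=
    (measurable_gradient g).neg.prodMk measurable_const
  exact e.linearIsometryEquiv.symm.continuous.measurable.comp
    ((WithLp.homeomorphProd 2 E2 ℝ).symm.continuous.measurable.comp h)

theorem measurable_graphUnitNormal : Measurable (graphUnitNormal e g) :=
  (measurable_areaFactor_gradient g).inv.smul measurable_graphNormal

theorem continuous_fst_chart : Continuous fun x : E3 => (e x).fst :=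
  (WithLp.prod_continuous_ofLp 2 E2 ℝ).fst.comp e.continuous

theorem continuous_snd_chart : Continuous fun x : E3 => (e x).snd :=
  (WithLp.prod_continuous_ofLp 2 E2 ℝ).snd.comp e.continuous

theorem continuous_level (hg : Continuous g) : Continuous (level e g) :=
  (hg.comp continuous_fst_chart).sub continuous_snd_chart

theorem apply_add_smul_upVector (x : E3) (r : ℝ) :
    (e (x + r • upVector e)).fst = (e x).fst ∧ (e (x + r • upVector e)).snd = (e x).snd + r := by
  have h : e (x + r • upVector e) = e x + r • WithLp.toLp 2 ((0 : E2), (1 : ℝ)) := by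
    rw [add_comm x, ← vadd_eq_add, e.map_vadd, map_smul, upVector,
      LinearIsometryEquiv.apply_symm_apply, vadd_eq_add, add_comm]
  rw [h]
  constructor <;> simp

theorem level_add_smul_upVector (x : E3) (r : ℝ) :
    level e g (x + r • upVector e) = level e g x - r := by
  simp only [level, apply_add_smul_upVector]; ring

theorem level_graphMap (y : E2) : level e g (graphMap e g y) = 0 := by
  simp [level]

theorem graphMap_of_level_eq_zero (h : level e g x = 0) : graphMap e g (e x).fst = x := by
  apply e.injective
  rw [apply_graphMap, sub_eq_zero.1 h]
  rfl

theorem mem_range_graphMap : x ∈ range (graphMap e g) ↔ level e g x = 0 :=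
  ⟨by rintro ⟨y, rfl⟩; exact level_graphMap y, fun h => ⟨_, graphMap_of_level_eq_zero h⟩⟩

theorem lipschitzWith_fst_chart : LipschitzWith 1 fun x : E3 => (e x).fst := by
  refine LipschitzWith.of_dist_le_mul fun x y => ?_
  rw [NNReal.coe_one, one_mul, ← e.dist_map, WithLp.prod_dist_eq_of_L2]
  exact Real.le_sqrt_of_sq_le (by nlinarith [sq_nonneg (dist (e x).snd (e y).snd)])

theorem lipschitzWith_snd_chart : LipschitzWith 1 fun x : E3 => (e x).snd := by
  refine LipschitzWith.of_dist_le_mul fun x y => ?_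
  rw [NNReal.coe_one, one_mul, ← e.dist_map, WithLp.prod_dist_eq_of_L2]
  exact Real.le_sqrt_of_sq_le (by nlinarith [sq_nonneg (dist (e x).fst (e y).fst)])

theorem lipschitzWith_level (hg : LipschitzWith K g) : LipschitzWith (K + 1) (level e g) := by
  refine LipschitzWith.of_dist_le_mul fun x y => ?_
  have h1 := hg.dist_le_mul (e x).fst (e y).fst
  have h2 := (lipschitzWith_fst_chart (e := e)).dist_le_mul x y
  have h3 := (lipschitzWith_snd_chart (e := e)).dist_le_mul x y
  rw [NNReal.coe_one, one_mul] at h2 h3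
  have h4 := mul_le_mul_of_nonneg_left h2 K.coe_nonneg
  have h5 := dist_sub_sub_le (g (e x).fst) (e x).snd (g (e y).fst) (e y).snd
  push_cast
  simp only [level]
  linarith

/-- `level` is the depth below the graph, positive inside the domain, so its gradient points
opposite to the upward normal. -/
theorem hasGradientAt_level (hg : DifferentiableAt ℝ g (e x).fst) :
    HasGradientAt (level e g) (-graphNormal e g (e x).fst) x := by
  have he : HasFDerivAt (fun z => e z)
      (e.linearIsometryEquiv.toContinuousLinearEquiv : E3 →L[ℝ] WithLp 2 (E2 × ℝ)) x := by
    have h := ((e.linearIsometryEquiv.toContinuousLinearEquiv :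
      E3 →L[ℝ] WithLp 2 (E2 × ℝ)).hasFDerivAt (x := x)).add_const (e 0)
    refine h.congr_of_eventuallyEq (Eventually.of_forall fun z => ?_)
    have := e.map_vadd 0 z
    simpa using this
  have h1 := (WithLp.fstL 2 ℝ E2 ℝ).hasFDerivAt.comp x he
  have h2 := (WithLp.sndL 2 ℝ E2 ℝ).hasFDerivAt.comp x he
  have h3 := (hg.hasFDerivAt.comp x h1).sub h2
  rw [hasGradientAt_iff_hasFDerivAt]
  refine h3.congr_fderiv ?_
  ext v
  simp only [toDual_apply_apply, inner_neg_left, inner_graphNormal]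
  simp only [sub_apply, ContinuousLinearMap.comp_apply]
  rw [inner_gradient_left]
  simp

/-- In the open set `U`, the set `Ω` is the region below the graph of `g` in the coordinates
`e`. -/
structure IsGraphChart (Ω : Set E3) (e : E3 ≃ᵃⁱ[ℝ] WithLp 2 (E2 × ℝ)) (g : E2 → ℝ)
    (U : Set E3) : Prop where
  isOpen : IsOpen U
  mem_iff : ∀ x ∈ U, (x ∈ Ω ↔ 0 < level e g x)

theorem IsSubgraphNear.exists_chart {P : (E2 → ℝ) → Prop} {p : E3} (h : IsSubgraphNear P Ω p) :
    ∃ e g U, P g ∧ p ∈ U ∧ IsGraphChart Ω e g U := by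
  obtain ⟨e, g, U, hg, hU, hp, h⟩ := h
  exact ⟨e, g, U, hg, hp, hU, fun x hx => by rw [h x hx, level, sub_pos]⟩

theorem IsGraphChart.mem_closure_iff (hch : IsGraphChart Ω e g U) (hg : Continuous g)
    (hx : x ∈ U) : x ∈ closure Ω ↔ 0 ≤ level e g x := by
  constructor
  · intro h
    by_contra! hlt
    have hn : U ∩ {z | level e g z < 0} ∈ 𝓝 x :=
      (hch.isOpen.inter (isOpen_lt (continuous_level hg) continuous_const)).mem_nhds ⟨hx, hlt⟩
    obtain ⟨z, hz, hzΩ⟩ := mem_closure_iff_nhds.1 h _ hn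
    have h1 := (hch.mem_iff z hz.1).1 hzΩ
    have h2 : level e g z < 0 := hz.2
    linarith
  · intro h
    -- Moving straight down increases the level, so points on the graph are limits of points of `Ω`.
    have hlim : Tendsto (fun r : ℝ => x + (-r) • upVector e) (𝓝[>] 0) (𝓝 x) := by
      have : Continuous fun r : ℝ => x + (-r) • upVector e := by fun_prop
      simpa using (this.tendsto 0).mono_left (nhdsWithin_le_nhds (s := Ioi (0 : ℝ)))
    refine mem_closure_of_tendsto hlim ?_
    filter_upwards [hlim.eventually (hch.isOpen.mem_nhds hx), self_mem_nhdsWithin] with r hr hr0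
    rw [hch.mem_iff _ hr, level_add_smul_upVector]
    have : (0 : ℝ) < r := hr0
    linarith

theorem IsGraphChart.mem_frontier_iff (hch : IsGraphChart Ω e g U) (hΩ : IsOpen Ω)
    (hg : Continuous g) (hx : x ∈ U) : x ∈ frontier Ω ↔ level e g x = 0 := by
  rw [hΩ.frontier_eq, Set.mem_sdiff, hch.mem_closure_iff hg hx, hch.mem_iff x hx, not_lt]
  exact ⟨fun h => le_antisymm h.2 h.1, fun h => ⟨h.ge, h.le⟩⟩

theorem IsGraphChart.frontier_inter (hch : IsGraphChart Ω e g U) (hΩ : IsOpen Ω)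
    (hg : Continuous g) : frontier Ω ∩ U = range (graphMap e g) ∩ U := by
  ext x
  simp only [mem_inter_iff, mem_range_graphMap]
  exact ⟨fun h => ⟨(hch.mem_frontier_iff hΩ hg h.2).1 h.1, h.2⟩,
    fun h => ⟨(hch.mem_frontier_iff hΩ hg h.2).2 h.1, h.2⟩⟩

/-- The first-order expansion of the level at x is −J⟪n, z − x⟫ with error at most ε‖z − x‖. Since J
≥ 1, this error cannot change the sign of the level outside the cone of opening ε, so the same ε
serves. -/
theorem IsGraphChart.isOutwardUnitNormal (hch : IsGraphChart Ω e g U) (hx : x ∈ U)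
    (h0 : level e g x = 0) (hg : DifferentiableAt ℝ g (e x).fst) :
    IsOutwardUnitNormal Ω x (graphUnitNormal e g (e x).fst) := by
  refine ⟨norm_graphUnitNormal _, fun ε hε => ?_⟩
  have hl := (hasGradientAt_iff_isLittleO.1 (hasGradientAt_level hg)).bound hε
  filter_upwards [hl, hch.isOpen.mem_nhds hx] with z hz hzU
  rw [hch.mem_iff z hzU]
  rw [h0, sub_zero, inner_neg_left, sub_neg_eq_add, Real.norm_eq_abs,
    ← areaFactor_smul_graphUnitNormal, real_inner_smul_left] at hz
  have hz' := abs_le.1 hz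
  have hJ := one_le_areaFactor (∇ g (e x).fst)
  have hnn : 0 ≤ ε * ‖z - x‖ := by positivity
  constructor
  · intro h
    nlinarith
  · intro h
    nlinarith

theorem IsGraphChart.outwardNormal_eq (hch : IsGraphChart Ω e g U) (hx : x ∈ U)
    (h0 : level e g x = 0) (hg : DifferentiableAt ℝ g (e x).fst) :
    outwardNormal Ω x = graphUnitNormal e g (e x).fst :=
  NSBIM.outwardNormal_eq (hch.isOutwardUnitNormal hx h0 hg)

theorem norm_outwardNormal_le (Ω : Set E3) (x : E3) : ‖outwardNormal Ω x‖ ≤ 1 := by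
  by_cases h : ∃ n, IsOutwardUnitNormal Ω x n
  · obtain ⟨n, hn⟩ := h
    rw [NSBIM.outwardNormal_eq hn, hn.1]
  · rw [outwardNormal, dif_neg h, norm_zero]
    exact zero_le_one

/-- The outward normal depends on the set only near the point. -/
theorem outwardNormal_congr {Ω' : Set E3} (h : Ω =ᶠ[𝓝 x] Ω') :
    outwardNormal Ω x = outwardNormal Ω' x := by
  have key : IsOutwardUnitNormal Ω x = IsOutwardUnitNormal Ω' x := by
    funext n
    refine propext (and_congr_right fun _ => forall₂_congr fun ε _ => eventually_congr ?_)
    filter_upwards [h.mem_iff] with y hy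
    rw [hy]
  unfold outwardNormal
  rw [key]

/-! ### The closure of a Lipschitz domain -/

/-- Below a K-Lipschitz graph there is room for a convex cone with vertex x and slope K. Cut by a
small ball it is open, lies in Ω and has x in its closure, and convex sets with interior have unique
derivatives at points of their closure. -/
theorem IsGraphChart.uniqueDiffWithinAt (hch : IsGraphChart Ω e g U) (hg : LipschitzWith K g)
    (hx : x ∈ U) (h0 : level e g x = 0) : UniqueDiffWithinAt ℝ (closure Ω) x := by
  obtain ⟨r, hr, hrU⟩ := Metric.isOpen_iff.1 hch.isOpen x hx
  set q : E3 → ℝ := fun z => (e z).snd - (e x).snd + K * ‖(e z).fst - (e x).fst‖ with hq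
  have hqc : Continuous q :=
    (continuous_snd_chart.sub continuous_const).add
      (continuous_const.mul (continuous_fst_chart.sub continuous_const).norm)
  set C : Set E3 := Metric.ball x r ∩ {z | q z < 0}
  have hCopen : IsOpen C := Metric.isOpen_ball.inter (isOpen_lt hqc continuous_const)
  have hqconv : ConvexOn ℝ univ q := by
    have h1 : ConvexOn ℝ univ fun w : WithLp 2 (E2 × ℝ) =>
        w.snd - (e x).snd + K * ‖w.fst - (e x).fst‖ := by
      refine ConvexOn.add (f := fun w : WithLp 2 (E2 × ℝ) => w.snd - (e x).snd)
        (g := fun w : WithLp 2 (E2 × ℝ) => K * ‖w.fst - (e x).fst‖) ⟨convex_univ, ?_⟩ ⟨convex_univ, ?_⟩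
      · intro a _ b _ s t _ _ hst
        refine le_of_eq ?_
        simp only [WithLp.add_snd, WithLp.smul_snd, smul_eq_mul]
        linear_combination (-(e x).snd) * hst.symm
      · intro a _ b _ s t hs ht hst
        have : (s • a + t • b).fst - (e x).fst
            = s • (a.fst - (e x).fst) + t • (b.fst - (e x).fst) := by
          simp only [WithLp.add_fst, WithLp.smul_fst, smul_sub]
          nth_rw 1 [← one_smul ℝ (e x).fst, ← hst, add_smul]
          abel
        simp only [this, smul_eq_mul]
        calc _ ≤ (K : ℝ) * (s * ‖a.fst - (e x).fst‖ + t * ‖b.fst - (e x).fst‖) := by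
              gcongr
              refine (norm_add_le _ _).trans ?_
              rw [norm_smul, norm_smul, Real.norm_of_nonneg hs, Real.norm_of_nonneg ht]
          _ = _ := by ring
    exact h1.comp_affineMap e.toAffineEquiv.toAffineMap
  have hCconv : Convex ℝ C := (convex_ball x r).inter (by
    have := hqconv.convex_lt 0
    simpa using this)
  have hCΩ : C ⊆ Ω := by
    rintro z ⟨hz, hqz⟩
    rw [hch.mem_iff z (hrU hz)]
    have h1 := hg.dist_le_mul (e z).fst (e x).fst
    rw [Real.dist_eq, dist_eq_norm] at h1
    have h2 := abs_le.1 h1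
    have h3 : q z < 0 := hqz
    have h4 : g (e x).fst - (e x).snd = 0 := h0
    simp only [level]
    simp only [hq] at h3
    linarith
  have hCx : x ∈ closure C := by
    have hlim : Tendsto (fun s : ℝ => x + (-s) • upVector e) (𝓝[>] 0) (𝓝 x) := by
      have : Continuous fun s : ℝ => x + (-s) • upVector e := by fun_prop
      simpa using (this.tendsto 0).mono_left (nhdsWithin_le_nhds (s := Ioi (0 : ℝ)))
    refine mem_closure_of_tendsto hlim ?_
    filter_upwards [hlim.eventually (Metric.ball_mem_nhds x hr), self_mem_nhdsWithin] with s hs hs0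
    have hs0' : (0 : ℝ) < s := hs0
    refine ⟨hs, ?_⟩
    simp only [hq, mem_ofPred_eq, apply_add_smul_upVector]
    simpa using hs0'
  have hCne : (interior C).Nonempty := by
    rw [hCopen.interior_eq]
    exact closure_nonempty_iff.1 ⟨x, hCx⟩
  exact (uniqueDiffWithinAt_convex hCconv hCne hCx).mono (hCΩ.trans subset_closure)

theorem HasLipschitzBoundary.exists_chart (hS : HasLipschitzBoundary Ω) {p : E3}
    (hp : p ∈ frontier Ω) : ∃ e g U K, LipschitzWith K g ∧ p ∈ U ∧ IsGraphChart Ω e g U := by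
  obtain ⟨e, g, U, ⟨K, hK⟩, hU, h⟩ := (hS p hp).exists_chart
  exact ⟨e, g, U, K, hK, hU, h⟩

/-- This makes `gradientWithin` on the closure meaningful at boundary points: it is continuous for
functions that are C¹ up to the boundary, and it obeys the usual rules. -/
theorem HasLipschitzBoundary.uniqueDiffOn (hS : HasLipschitzBoundary Ω) (hΩ : IsOpen Ω) :
    UniqueDiffOn ℝ (closure Ω) := by
  intro x hx
  by_cases hxΩ : x ∈ Ω
  · exact (hΩ.uniqueDiffWithinAt hxΩ).mono subset_closure
  · have hxf : x ∈ frontier Ω := by rw [hΩ.frontier_eq]; exact ⟨hx, hxΩ⟩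
    obtain ⟨e, g, U, K, hg, hU, hch⟩ := hS.exists_chart hxf
    exact hch.uniqueDiffWithinAt hg hU ((hch.mem_frontier_iff hΩ hg.continuous hU).1 hxf)

/-! ### Surface measure on the boundary -/

theorem graphMeasure_le (hg : LipschitzWith K g) : graphMeasure g ≤ (1 + K : ENNReal) • volume := by
  refine Measure.le_iff.2 fun A hA => ?_
  rw [graphMeasure, withDensity_apply _ hA, Measure.smul_apply, smul_eq_mul, ← setLIntegral_const]
  refine setLIntegral_mono' hA fun y _ => ?_
  have h1 : ‖∇ g y‖ ≤ K := by
    rw [gradient, LinearIsometryEquiv.norm_map]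
    exact norm_fderiv_le_of_lipschitz ℝ hg
  have h2 : areaFactor (∇ g y) ≤ 1 + K := by
    have := areaFactor_le (∇ g y) 0 (ε := K) (by simpa using h1)
    simpa [areaFactor] using this
  refine (ENNReal.ofReal_le_ofReal h2).trans ?_
  rw [ENNReal.ofReal_add zero_le_one K.coe_nonneg]
  simp

/-- In polar coordinates of the plane the Jacobian t cancels the singularity 1/t. -/
theorem integrableOn_inv_norm_sub_ball (y₀ : E2) (r : ℝ) :
    IntegrableOn (fun y => 1 / ‖y - y₀‖) (Metric.ball y₀ r) volume := by
  have h0 : IntegrableOn (fun y : E2 => 1 / ‖y‖) (Metric.ball 0 r) volume := by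
    refine (integrableOn_fun_norm_addHaar (f := fun t : ℝ => 1 / t) volume).2 ?_
    have h1 : IntegrableOn (fun _ : ℝ => (1 : ℝ)) (Ioo 0 r) volume := by
      simp [integrableOn_const_iff]
    refine h1.congr_fun (fun t ht => ?_) measurableSet_Ioo
    have : t ≠ 0 := ht.1.ne'
    simp [this]
  have hmp := (measurePreserving_sub_right (volume : Measure E2) y₀)
  have h2 := (hmp.integrableOn_comp_preimage
    (Homeomorph.subRight y₀).measurableEmbedding (f := fun y : E2 => 1 / ‖y‖)
    (s := Metric.ball 0 r)).2 h0
  have hb : Metric.ball y₀ r = (fun y => y - y₀) ⁻¹' Metric.ball 0 r := by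
    ext y
    simp [dist_eq_norm]
  rw [hb]
  exact h2

theorem IsGraphChart.integrableOn_image (hg : LipschitzWith K g) {f : E3 → ℝ} {A : Set E2}
    (hf : IntegrableOn (fun y => f (graphMap e g y)) A volume) :
    IntegrableOn f (graphMap e g '' A) μHE[2] := by
  have hemb := measurableEmbedding_graphMap (e := e) hg.continuous
  have h1 : IntegrableOn f (graphMap e g '' A)
      ((μHE[2] : Measure E3).restrict (range (graphMap e g))) := by
    rw [restrict_range_graphMap hg, hemb.integrableOn_map_iff,
      preimage_image_eq _ hemb.injective, IntegrableOn]
    have h2 : (graphMeasure g).restrict A ≤ (1 + K : ENNReal) • (volume : Measure E2).restrict A := by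
      rw [← Measure.restrict_smul]
      exact Measure.restrict_mono le_rfl (graphMeasure_le hg)
    exact (Integrable.smul_measure hf (by finiteness)).mono_measure h2
  rwa [IntegrableOn, Measure.restrict_restrict_of_subset (image_subset_range _ _)] at h1

theorem IsGraphChart.frontier_inter_ball_subset (hch : IsGraphChart Ω e g U) (hΩ : IsOpen Ω)
    (hg : Continuous g) {r : ℝ} (hr : Metric.ball x r ⊆ U) :
    frontier Ω ∩ Metric.ball x r ⊆ graphMap e g '' Metric.ball (e x).fst r := by
  rintro z ⟨hz, hzr⟩
  refine ⟨(e z).fst, ?_, graphMap_of_level_eq_zero ((hch.mem_frontier_iff hΩ hg (hr hzr)).1 hz)⟩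
  have := (lipschitzWith_fst_chart (e := e)).dist_le_mul z x
  rw [NNReal.coe_one, one_mul] at this
  exact lt_of_le_of_lt this hzr

theorem HasLipschitzBoundary.finiteAtFilter (hS : HasLipschitzBoundary Ω) (hΩ : IsOpen Ω)
    (hx : x ∈ frontier Ω) : (μHE[2] : Measure E3).FiniteAtFilter (𝓝[frontier Ω] x) := by
  obtain ⟨e, g, U, K, hg, hU, hch⟩ := hS.exists_chart hx
  obtain ⟨r, hr, hrU⟩ := Metric.isOpen_iff.1 hch.isOpen x hU
  refine ⟨frontier Ω ∩ Metric.ball x r,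
    inter_mem self_mem_nhdsWithin (mem_nhdsWithin_of_mem_nhds (Metric.ball_mem_nhds x hr)), ?_⟩
  refine lt_of_le_of_lt (measure_mono (hch.frontier_inter_ball_subset hΩ hg.continuous hrU)) ?_
  have h1 : IntegrableOn (fun _ : E3 => (1 : ℝ)) (graphMap e g '' Metric.ball (e x).fst r) μHE[2] :=
    IsGraphChart.integrableOn_image hg (integrableOn_const measure_ball_lt_top.ne)
  simpa [integrableOn_const_iff] using h1

/-- Each chart has finite area because its density is at most 1 + K; compactness of the boundary
does the rest. -/
theorem HasLipschitzBoundary.measure_frontier_lt_top (hS : HasLipschitzBoundary Ω) (hΩ : IsOpen Ω)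
    (hb : IsBounded (frontier Ω)) : (μHE[2] : Measure E3) (frontier Ω) < ⊤ :=
  (Metric.isCompact_of_isClosed_isBounded isClosed_frontier hb).measure_lt_top_of_nhdsWithin
    fun _ hx => hS.finiteAtFilter hΩ hx

/-- Near x₀, projection to the parameter plane does not increase distances, so 1/|x − x₀| is
dominated by the planar singularity 1/|y − y₀|. Away from x₀ it is bounded on a set of finite area.
-/
theorem HasLipschitzBoundary.integrableOn_inv_norm_sub (hS : HasLipschitzBoundary Ω)
    (hΩ : IsOpen Ω) (hb : IsBounded (frontier Ω)) {x₀ : E3} (hx₀ : x₀ ∈ frontier Ω) :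
    IntegrableOn (fun x => 1 / ‖x - x₀‖) (frontier Ω) μHE[2] := by
  obtain ⟨e, g, U, K, hg, hU, hch⟩ := hS.exists_chart hx₀
  obtain ⟨r, hr, hrU⟩ := Metric.isOpen_iff.1 hch.isOpen x₀ hU
  have hmeas : Measurable fun x : E3 => 1 / ‖x - x₀‖ := by fun_prop
  have h1 : IntegrableOn (fun x => 1 / ‖x - x₀‖) (frontier Ω ∩ Metric.ball x₀ r) μHE[2] := by
    refine IntegrableOn.mono_set ?_ (hch.frontier_inter_ball_subset hΩ hg.continuous hrU)
    refine IsGraphChart.integrableOn_image hg ?_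
    refine Integrable.mono' (integrableOn_inv_norm_sub_ball (e x₀).fst r)
      (hmeas.comp (measurableEmbedding_graphMap hg.continuous).measurable).aestronglyMeasurable
      (ae_of_all _ fun y => ?_)
    rw [Real.norm_of_nonneg (by positivity)]
    -- Over the projection of x₀ both sides are 1/0 = 0.
    by_cases hy : y = (e x₀).fst
    · rw [hy, graphMap_of_level_eq_zero ((hch.mem_frontier_iff hΩ hg.continuous hU).1 hx₀)]
      simp
    · have h2 := (lipschitzWith_fst_chart (e := e)).dist_le_mul (graphMap e g y) x₀
      rw [NNReal.coe_one, one_mul, apply_graphMap, dist_eq_norm, dist_eq_norm] at h2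
      have h3 : 0 < ‖y - (e x₀).fst‖ := norm_pos_iff.2 (sub_ne_zero.2 hy)
      exact one_div_le_one_div_of_le h3 h2
  have h2 : IntegrableOn (fun x => 1 / ‖x - x₀‖) (frontier Ω \ Metric.ball x₀ r) μHE[2] := by
    refine IntegrableOn.of_bound (lt_of_le_of_lt (measure_mono sdiff_subset)
      (hS.measure_frontier_lt_top hΩ hb)) hmeas.aestronglyMeasurable (1 / r) ?_
    refine (ae_restrict_iff' (isClosed_frontier.measurableSet.diff measurableSet_ball)).2
      (ae_of_all _ fun x hx => ?_)
    rw [Real.norm_of_nonneg (by positivity)]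
    have : r ≤ ‖x - x₀‖ := by simpa [dist_eq_norm] using hx.2
    exact one_div_le_one_div_of_le hr this
  have := h1.union h2
  rwa [inter_union_sdiff] at this

/-- By Rademacher's theorem the slope exists off a null set of parameters, and the image of that set
on the graph has zero area. -/
theorem IsGraphChart.ae_outwardNormal_eq (hch : IsGraphChart Ω e g U) (hΩ : IsOpen Ω)
    (hg : LipschitzWith K g) : ∀ᵐ x ∂(μHE[2] : Measure E3).restrict (frontier Ω ∩ U),
      outwardNormal Ω x = graphUnitNormal e g (e x).fst := by
  have hnull : (μHE[2] : Measure E3) (graphMap e g '' {y | ¬ DifferentiableAt ℝ g y}) = 0 :=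
    euclideanHausdorffMeasure_graphMap_image_null hg hg.ae_differentiableAt
  refine (ae_restrict_iff' (isClosed_frontier.measurableSet.inter
    hch.isOpen.measurableSet)).2 ?_
  refine measure_mono_null (fun x hx => ?_) hnull
  simp only [mem_compl_iff, mem_ofPred_eq, not_forall] at hx
  obtain ⟨⟨hxf, hxU⟩, hne⟩ := hx
  have h0 := (hch.mem_frontier_iff hΩ hg.continuous hxU).1 hxf
  exact ⟨(e x).fst, fun hd => hne (hch.outwardNormal_eq hxU h0 hd), graphMap_of_level_eq_zero h0⟩

theorem HasLipschitzBoundary.aestronglyMeasurable_outwardNormal (hS : HasLipschitzBoundary Ω)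
    (hΩ : IsOpen Ω) :
    AEStronglyMeasurable (outwardNormal Ω) ((μHE[2] : Measure E3).restrict (frontier Ω)) := by
  have hloc : ∀ x ∈ frontier Ω, ∃ U, IsOpen U ∧ x ∈ U ∧ AEStronglyMeasurable (outwardNormal Ω)
      ((μHE[2] : Measure E3).restrict (frontier Ω ∩ U)) := by
    intro x hx
    obtain ⟨e, g, U, K, hg, hU, hch⟩ := hS.exists_chart hx
    refine ⟨U, hch.isOpen, hU, ?_⟩
    refine AEStronglyMeasurable.congr ?_ ((hch.ae_outwardNormal_eq hΩ hg).mono fun _ h => h.symm)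
    exact (measurable_graphUnitNormal.comp
      (continuous_fst_chart (e := e)).measurable).aestronglyMeasurable
  choose! U hUo hxU hU using hloc
  obtain ⟨t, htS, htc, ht⟩ := TopologicalSpace.countable_cover_nhdsWithin (f := U)
    (s := frontier Ω) fun x hx => mem_nhdsWithin_of_mem_nhds ((hUo x hx).mem_nhds (hxU x hx))
  have : frontier Ω = ⋃ x ∈ t, frontier Ω ∩ U x := by
    rw [← inter_iUnion₂, inter_eq_left.2 ht]
  rw [this, biUnion_eq_iUnion]
  have := htc.to_subtype
  exact aestronglyMeasurable_iUnion_iff.2 fun x => hU x (htS x.2)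

end

end NSBIM

namespace NSBIM

noncomputable section

variable {Ω U : Set E3} {e : E3 ≃ᵃⁱ[ℝ] WithLp 2 (E2 × ℝ)} {g : E2 → ℝ} {K : ℝ≥0} {x : E3}

/-! ### Divergence of Lipschitz fields -/

/-- The divergence of a vector field. -/
def divergence (F : E3 → E3) (x : E3) : ℝ := ∑ i, fderiv ℝ F x (EuclideanSpace.single i 1) i

theorem divergence_congr {F F' : E3 → E3} (h : F =ᶠ[𝓝 x] F') :
    divergence F x = divergence F' x := by
  simp only [divergence, h.fderiv_eq]

theorem divergence_zero_of_eventuallyEq {F : E3 → E3} (h : F =ᶠ[𝓝 x] 0) : divergence F x = 0 := by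
  rw [divergence_congr h]
  simp [divergence]

theorem inner_eq_sum (a b : E3) : ⟪a, b⟫ = ∑ i, a i * b i := by
  simp [PiLp.inner_apply, mul_comm]

theorem divergence_smul {η : E3 → ℝ} {F : E3 → E3} {a : E3} (hη : HasGradientAt η a x)
    (hF : DifferentiableAt ℝ F x) :
    divergence (fun z => η z • F z) x = η x * divergence F x + ⟪a, F x⟫ := by
  have h : HasFDerivAt (fun z => η z • F z) _ x := hη.hasFDerivAt.smul hF.hasFDerivAt
  rw [divergence, h.fderiv, divergence, Finset.mul_sum, inner_eq_sum, ← Finset.sum_add_distrib]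
  refine Finset.sum_congr rfl fun i _ => ?_
  simp [EuclideanSpace.inner_single_right]

theorem measurable_divergence (F : E3 → E3) : Measurable (divergence F) := by
  unfold divergence
  refine Finset.measurable_sum _ fun i _ => ?_
  exact (EuclideanSpace.proj (𝕜 := ℝ) i).continuous.measurable.comp
    (measurable_fderiv_apply_const ℝ F _)

/-- For points at distance at least 1 the bound of the function gives the estimate. For closer
points, either both values vanish or both points lie in a compact ball slightly larger than the
support, on which there is one Lipschitz constant. -/
theorem exists_lipschitzWith_of_hasCompactSupport {h : E3 → E3} (hl : LocallyLipschitz h)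
    (hc : HasCompactSupport h) : ∃ C, LipschitzWith C h := by
  obtain ⟨R, hR⟩ := hc.isCompact.isBounded.subset_closedBall 0
  obtain ⟨C, hC⟩ := (hl.locallyLipschitzOn
    (s := Metric.closedBall 0 (R + 1))).exists_lipschitzOnWith_of_compact
    (isCompact_closedBall 0 (R + 1))
  obtain ⟨M, hM⟩ := hl.continuous.bounded_above_of_compact_support hc
  have hM0 : 0 ≤ M := (norm_nonneg _).trans (hM 0)
  have hzero : ∀ x, x ∉ Metric.closedBall (0 : E3) R → h x = 0 := fun x hx =>
    image_eq_zero_of_notMem_tsupport fun h' => hx (hR h')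
  refine ⟨C + ⟨2 * M, by positivity⟩, LipschitzWith.of_dist_le_mul fun x y => ?_⟩
  have hd := dist_nonneg (x := x) (y := y)
  have hCd : 0 ≤ C * dist x y := by positivity
  have hMd : 0 ≤ 2 * M * dist x y := by positivity
  change dist (h x) (h y) ≤ (C + 2 * M) * dist x y
  rcases le_or_gt 1 (dist x y) with h1 | h1
  · have : dist (h x) (h y) ≤ 2 * M := by
      rw [dist_eq_norm]
      exact (norm_sub_le _ _).trans (by linarith [hM x, hM y])
    nlinarith
  · have main : ∀ x y : E3, dist x y < 1 → x ∈ Metric.closedBall (0 : E3) R →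
        dist (h x) (h y) ≤ C * dist x y := fun x y hxy hx => by
      rw [Metric.mem_closedBall] at hx
      refine hC.dist_le_mul x ?_ y ?_
      · rw [Metric.mem_closedBall]; linarith
      · rw [Metric.mem_closedBall]
        have := dist_triangle y x 0
        rw [dist_comm y x] at this; linarith
    by_cases hx : x ∈ Metric.closedBall (0 : E3) R
    · linarith [main x y h1 hx]
    · by_cases hy : y ∈ Metric.closedBall (0 : E3) R
      · have := main y x (by rwa [dist_comm]) hy
        rw [dist_comm (h x), dist_comm x] at *
        linarith
      · rw [hzero x hx, hzero y hy, dist_self]; linarith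

/-- Integration by parts of each component against the constant 1. Rademacher's theorem identifies
line derivatives with components of the derivative almost everywhere. -/
theorem integral_divergence_eq_zero {h : E3 → E3} {C : ℝ≥0} (hl : LipschitzWith C h)
    (hc : HasCompactSupport h) : ∫ x, divergence h x = 0 := by
  have hcomp : ∀ i : Fin 3, LipschitzWith C fun x => h x i := fun i =>
    LipschitzWith.of_dist_le_mul fun x y => by
      refine le_trans ?_ (hl.dist_le_mul x y)
      rw [dist_eq_norm, dist_eq_norm]
      exact PiLp.norm_apply_le (h x - h y) i
  have hcc : ∀ i : Fin 3, HasCompactSupport fun x => h x i := fun i =>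
    hc.comp_left (g := fun v : E3 => v i) rfl
  have hint : ∀ i : Fin 3,
      Integrable (fun x => fderiv ℝ h x (EuclideanSpace.single i 1) i) volume := by
    intro i
    have hm : Measurable fun x => fderiv ℝ h x (EuclideanSpace.single i 1) i :=
      (EuclideanSpace.proj (𝕜 := ℝ) i).continuous.measurable.comp
        (measurable_fderiv_apply_const ℝ h _)
    have hs : Function.support (fun x => fderiv ℝ h x (EuclideanSpace.single i 1) i) ⊆
        tsupport h := fun x hx => by
      by_contra hx'
      have : fderiv ℝ h x = 0 := by
        by_contra h0
        exact hx' (support_fderiv_subset ℝ h0)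
      simp [this] at hx
    rw [← integrableOn_iff_integrable_of_support_subset hs]
    refine IntegrableOn.of_bound hc.isCompact.measure_lt_top hm.aestronglyMeasurable C
      (ae_of_all _ fun x => ?_)
    refine (PiLp.norm_apply_le _ i).trans (((fderiv ℝ h x).le_opNorm _).trans ?_)
    simpa using norm_fderiv_le_of_lipschitz ℝ hl (x₀ := x)
  simp only [divergence]
  rw [integral_finsetSum _ fun i _ => hint i]
  refine Finset.sum_eq_zero fun i _ => ?_
  -- The formula reverses the direction when it moves the derivative, so starting from −eᵢ leaves
  -- the derivative of `h` along eᵢ.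
  have h1 := LipschitzWith.integral_lineDeriv_mul_eq (μ := (volume : Measure E3))
    (LipschitzWith.const (1 : ℝ) : LipschitzWith 0 fun _ : E3 => (1 : ℝ)) (hcomp i) (hcc i)
    (-EuclideanSpace.single i 1)
  have h2 : ∀ x : E3, lineDeriv ℝ (fun _ : E3 => (1 : ℝ)) x (-EuclideanSpace.single i 1) = 0 :=
    fun x => by simp [lineDeriv]
  simp only [h2, zero_mul, integral_zero, neg_neg, mul_one] at h1
  rw [h1]
  refine integral_congr_ae ?_
  filter_upwards [hl.ae_differentiableAt] with x hx
  have h3 : HasFDerivAt (fun x => h x i)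
      ((EuclideanSpace.proj (𝕜 := ℝ) i : E3 →L[ℝ] ℝ).comp (fderiv ℝ h x)) x :=
    (EuclideanSpace.proj (𝕜 := ℝ) i : E3 →L[ℝ] ℝ).hasFDerivAt.comp x hx.hasFDerivAt
  rw [(h3.hasLineDerivAt _).lineDeriv]
  rfl

/-! ### Coordinates adapted to a graph -/

theorem measurePreserving_affineIsometryEquiv {V W : Type*} [NormedAddCommGroup V]
    [InnerProductSpace ℝ V] [FiniteDimensional ℝ V] [MeasurableSpace V] [BorelSpace V]
    [NormedAddCommGroup W] [InnerProductSpace ℝ W] [FiniteDimensional ℝ W] [MeasurableSpace W]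
    [BorelSpace W] (a : V ≃ᵃⁱ[ℝ] W) : MeasurePreserving a := by
  have h2 := (measurePreserving_add_right (volume : Measure W) (a 0)).comp
    a.linearIsometryEquiv.measurePreserving
  have h3 : (a : V → W) = (fun x => x + a 0) ∘ a.linearIsometryEquiv := by
    funext v
    have := a.map_vadd 0 v
    simpa using this
  rw [h3]
  exact h2

/-- The point at depth `s` below the point of the graph of `g` over `y`. -/
def depthMap (e : E3 ≃ᵃⁱ[ℝ] WithLp 2 (E2 × ℝ)) (g : E2 → ℝ) (p : E2 × ℝ) : E3 :=
  e.symm (WithLp.toLp 2 (p.1, g p.1 - p.2))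

theorem apply_depthMap (p : E2 × ℝ) :
    e (depthMap e g p) = WithLp.toLp 2 (p.1, g p.1 - p.2) := by
  simp [depthMap]

theorem fst_depthMap (p : E2 × ℝ) : (e (depthMap e g p)).fst = p.1 := by
  simp [apply_depthMap]

theorem level_depthMap (p : E2 × ℝ) : level e g (depthMap e g p) = p.2 := by
  rw [level, apply_depthMap]; simp

theorem depthMap_zero (y : E2) : depthMap e g (y, 0) = graphMap e g y := by
  simp [depthMap, graphMap]

theorem continuous_depthMap (hg : Continuous g) : Continuous (depthMap e g) := by
  have h : Continuous fun p : E2 × ℝ => (p.1, g p.1 - p.2) := by fun_prop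
  exact e.symm.continuous.comp ((WithLp.homeomorphProd 2 E2 ℝ).symm.continuous.comp h)

/-- On each vertical fibre the map is t ↦ g y − t, which preserves length; Fubini needs only
measurability of g, not its differentiability. -/
theorem measurePreserving_depthMap (hg : Continuous g) :
    MeasurePreserving (depthMap e g) := by
  have h1 : MeasurePreserving (fun p : E2 × ℝ => (p.1, g p.1 - p.2))
      (volume.prod volume) (volume.prod volume) := by
    refine (MeasurePreserving.id volume).skew_product (g := fun y t => g y - t) ?_ ?_
    · exact Continuous.measurable (by fun_prop)
    · exact ae_of_all _ fun y => (Measure.measurePreserving_sub_left volume (g y)).map_eq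
  exact (measurePreserving_affineIsometryEquiv e.symm).comp
    ((WithLp.volume_preserving_toLp (U := E2) (V := ℝ)).comp h1)

theorem injective_depthMap : Function.Injective (depthMap e g) := by
  intro p q h
  have h1 : p.1 = q.1 := by rw [← fst_depthMap (e := e) (g := g) p, h, fst_depthMap]
  have h2 : p.2 = q.2 := by rw [← level_depthMap (e := e) (g := g) p, h, level_depthMap]
  exact Prod.ext h1 h2

theorem ae_differentiableAt_fst_chart (hg : LipschitzWith K g) :
    ∀ᵐ x : E3, DifferentiableAt ℝ g (e x).fst := by
  have hq : Measure.QuasiMeasurePreserving (fun x : E3 => (e x).fst) := by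
    have h1 := (WithLp.volume_preserving_ofLp (U := E2) (V := ℝ)).comp
      (measurePreserving_affineIsometryEquiv e)
    exact (Measure.quasiMeasurePreserving_fst (μ := (volume : Measure E2))
      (ν := (volume : Measure ℝ))).comp h1.quasiMeasurePreserving
  exact hq.ae hg.ae_differentiableAt

/-! ### A smooth step -/

/-- A smooth step function which vanishes up to `1` and is equal to `1` from `2` on. -/
def smoothStep (s : ℝ) : ℝ := Real.smoothTransition (s - 1)

theorem contDiff_smoothStep {n : ℕ∞} : ContDiff ℝ n smoothStep :=
  Real.smoothTransition.contDiff.comp (contDiff_id.sub contDiff_const)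

theorem smoothStep_of_le {s : ℝ} (h : s ≤ 1) : smoothStep s = 0 :=
  Real.smoothTransition.zero_of_nonpos (by linarith)

theorem smoothStep_of_ge {s : ℝ} (h : 2 ≤ s) : smoothStep s = 1 :=
  Real.smoothTransition.one_of_one_le (by linarith)

theorem smoothStep_nonneg (s : ℝ) : 0 ≤ smoothStep s := Real.smoothTransition.nonneg _

theorem smoothStep_le_one (s : ℝ) : smoothStep s ≤ 1 := Real.smoothTransition.le_one _

theorem hasDerivAt_smoothStep (s : ℝ) : HasDerivAt smoothStep (deriv smoothStep s) s :=
  ((contDiff_smoothStep (n := 1)).differentiable (by simp) s).hasDerivAt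

theorem continuous_deriv_smoothStep : Continuous (deriv smoothStep) :=
  (contDiff_smoothStep (n := 1)).continuous_deriv (by simp)

/-- The derivative vanishes on the open half-line; continuity extends this to the endpoint. -/
theorem deriv_smoothStep_of_le {s : ℝ} (h : s ≤ 1) : deriv smoothStep s = 0 := by
  have h1 : ∀ s : ℝ, s < 1 → deriv smoothStep s = 0 := fun s hs => by
    have : smoothStep =ᶠ[𝓝 s] fun _ => 0 := by
      filter_upwards [gt_mem_nhds hs] with t ht using smoothStep_of_le ht.le
    rw [this.deriv_eq, deriv_const]
  have hcl : IsClosed {s : ℝ | deriv smoothStep s = 0} :=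
    isClosed_eq continuous_deriv_smoothStep continuous_const
  have : closure (Iio (1 : ℝ)) ⊆ {s : ℝ | deriv smoothStep s = 0} :=
    hcl.closure_subset_iff.2 fun s hs => h1 s hs
  rw [closure_Iio] at this
  exact this h

theorem deriv_smoothStep_of_ge {s : ℝ} (h : 2 ≤ s) : deriv smoothStep s = 0 := by
  have h1 : ∀ s : ℝ, 2 < s → deriv smoothStep s = 0 := fun s hs => by
    have : smoothStep =ᶠ[𝓝 s] fun _ => 1 := by
      filter_upwards [lt_mem_nhds hs] with t ht using smoothStep_of_ge ht.le
    rw [this.deriv_eq, deriv_const]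
  have hcl : IsClosed {s : ℝ | deriv smoothStep s = 0} :=
    isClosed_eq continuous_deriv_smoothStep continuous_const
  have : closure (Ioi (2 : ℝ)) ⊆ {s : ℝ | deriv smoothStep s = 0} :=
    hcl.closure_subset_iff.2 fun s hs => h1 s hs
  rw [closure_Ioi] at this
  exact this h

theorem hasCompactSupport_deriv_smoothStep : HasCompactSupport (deriv smoothStep) := by
  refine HasCompactSupport.intro (isCompact_Icc (a := (1 : ℝ)) (b := 2)) fun s hs => ?_
  rw [Set.mem_Icc, not_and_or, not_le, not_le] at hs
  exact hs.elim (fun h => deriv_smoothStep_of_le h.le) fun h => deriv_smoothStep_of_ge h.le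

theorem exists_abs_deriv_smoothStep_le : ∃ C, 0 ≤ C ∧ ∀ s, |deriv smoothStep s| ≤ C := by
  obtain ⟨C, hC⟩ := continuous_deriv_smoothStep.bounded_above_of_compact_support
    hasCompactSupport_deriv_smoothStep
  exact ⟨C, (norm_nonneg _).trans (hC 0), hC⟩

theorem integral_deriv_smoothStep : ∫ s, deriv smoothStep s = 1 := by
  have h1 : Function.support (deriv smoothStep) ⊆ Ioc 0 3 := fun s hs => by
    by_contra h
    rw [Set.mem_Ioc, not_and_or, not_lt, not_le] at h
    exact hs (h.elim (fun h => deriv_smoothStep_of_le (by linarith))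
      fun h => deriv_smoothStep_of_ge (by linarith))
  rw [← intervalIntegral.integral_eq_integral_of_support_subset h1,
    intervalIntegral.integral_deriv_eq_sub
      (fun s _ => (hasDerivAt_smoothStep s).differentiableAt)
      (continuous_deriv_smoothStep.intervalIntegrable _ _),
    smoothStep_of_ge (by norm_num), smoothStep_of_le (by norm_num), sub_zero]

end

end NSBIM

namespace NSBIM

noncomputable section

variable {Ω U S : Set E3} {e : E3 ≃ᵃⁱ[ℝ] WithLp 2 (E2 × ℝ)} {g : E2 → ℝ} {K : ℝ≥0} {x : E3}
  {V : E3 → E3} {δ : ℝ}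

/-! ### The divergence theorem in a graph chart -/

/-- A vector field to which the divergence theorem in `Ω` applies: continuous up to the boundary
and continuously differentiable inside, with integrable divergence. -/
structure IsGaussField (Ω : Set E3) (V : E3 → E3) : Prop where
  continuousOn : ContinuousOn V (closure Ω)
  contDiffAt : ∀ x ∈ Ω, ContDiffAt ℝ 1 V x
  integrableOn : IntegrableOn (divergence V) Ω

theorem contDiff_smoothStep_div (δ : ℝ) : ContDiff ℝ 1 fun s => smoothStep (s / δ) :=
  contDiff_smoothStep.comp (contDiff_id.div_const δ)

/-- The step is zero up to 1, so the cut-off field vanishes wherever the depth is below δ, in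
particular in a full neighbourhood of any boundary or exterior point. No regularity of V is needed
there. -/
theorem smoothStep_level_smul_eventuallyEq_zero (hδ : 0 < δ) (hg : Continuous g)
    (hx : level e g x ≤ 0) : (fun z => smoothStep (level e g z / δ) • V z) =ᶠ[𝓝 x] 0 := by
  have : ∀ᶠ z in 𝓝 x, level e g z < δ :=
    (continuous_level hg).continuousAt.eventually (gt_mem_nhds (lt_of_le_of_lt hx hδ))
  filter_upwards [this] with z hz
  rw [smoothStep_of_le ((div_le_one hδ).2 hz.le), zero_smul]
  rfl

theorem IsGraphChart.level_nonpos (hch : IsGraphChart Ω e g U) (hxU : x ∈ U) (hx : x ∉ Ω) :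
    level e g x ≤ 0 := by
  rw [hch.mem_iff x hxU] at hx
  exact not_lt.1 hx

theorem exists_lipschitzOnWith_smul {ψ : E3 → ℝ} (hψc : ContinuousAt ψ x) (hVc : ContinuousAt V x)
    (hψ : ∃ C, ∃ t ∈ 𝓝 x, LipschitzOnWith C ψ t) (hV : ∃ C, ∃ t ∈ 𝓝 x, LipschitzOnWith C V t) :
    ∃ C, ∃ t ∈ 𝓝 x, LipschitzOnWith C (fun z => ψ z • V z) t := by
  obtain ⟨C₁, t₁, ht₁, h₁⟩ := hψ
  obtain ⟨C₂, t₂, ht₂, h₂⟩ := hV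
  have hψb : ∀ᶠ z in 𝓝 x, ‖ψ z‖ < ‖ψ x‖ + 1 :=
    hψc.norm.eventually (gt_mem_nhds (lt_add_one _))
  have hVb : ∀ᶠ z in 𝓝 x, ‖V z‖ < ‖V x‖ + 1 :=
    hVc.norm.eventually (gt_mem_nhds (lt_add_one _))
  refine ⟨⟨(‖ψ x‖ + 1) * C₂ + C₁ * (‖V x‖ + 1), by positivity⟩, _,
    inter_mem (inter_mem ht₁ ht₂) (inter_mem hψb hVb),
    LipschitzOnWith.of_dist_le_mul fun a ha b hb => ?_⟩
  have e₁ := h₁.dist_le_mul a ha.1.1 b hb.1.1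
  have e₂ := h₂.dist_le_mul a ha.1.2 b hb.1.2
  have e₃ : ‖ψ a‖ < ‖ψ x‖ + 1 := ha.2.1
  have e₄ : ‖V b‖ < ‖V x‖ + 1 := hb.2.2
  rw [dist_eq_norm] at e₁ e₂
  have hsplit : ψ a • V a - ψ b • V b = ψ a • (V a - V b) + (ψ a - ψ b) • V b := by
    rw [smul_sub, sub_smul]; abel
  rw [dist_eq_norm, hsplit]
  refine (norm_add_le _ _).trans ?_
  rw [norm_smul, norm_smul]
  calc _ ≤ (‖ψ x‖ + 1) * (C₂ * dist a b) + C₁ * dist a b * (‖V x‖ + 1) := by gcongr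
    _ = ((‖ψ x‖ + 1) * C₂ + C₁ * (‖V x‖ + 1)) * dist a b := by ring

/-- Off S the field is zero, and at points of S outside Ω the cutoff is zero nearby. At points of S
in Ω the field is C¹, but the level is only as regular as g, so the product is Lipschitz rather than
C¹. -/
theorem IsGraphChart.locallyLipschitz_smul (hch : IsGraphChart Ω e g U) (hg : LipschitzWith K g)
    (hV : ∀ x ∈ Ω, ContDiffAt ℝ 1 V x) (hS : IsClosed S) (hSU : S ⊆ U) (hVS : ∀ x ∉ S, V x = 0)
    (hδ : 0 < δ) : LocallyLipschitz fun z => smoothStep (level e g z / δ) • V z := by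
  have zero_case : ∀ x, (fun z => smoothStep (level e g z / δ) • V z) =ᶠ[𝓝 x] 0 →
      ∃ C, ∃ t ∈ 𝓝 x, LipschitzOnWith C (fun z => smoothStep (level e g z / δ) • V z) t := by
    intro x hx
    refine ⟨0, _, hx, fun a ha b hb => ?_⟩
    have ha' : smoothStep (level e g a / δ) • V a = 0 := ha
    have hb' : smoothStep (level e g b / δ) • V b = 0 := hb
    simp [ha', hb']
  intro x
  by_cases hxS : x ∈ S
  · by_cases hxΩ : x ∈ Ω
    · have hψ : LocallyLipschitz fun z => smoothStep (level e g z / δ) :=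
        (contDiff_smoothStep_div δ).locallyLipschitz.comp (lipschitzWith_level hg).locallyLipschitz
      exact exists_lipschitzOnWith_smul hψ.continuous.continuousAt (hV x hxΩ).continuousAt (hψ x)
        (hV x hxΩ).exists_lipschitzOnWith
    · exact zero_case x (smoothStep_level_smul_eventuallyEq_zero hδ hg.continuous
        (hch.level_nonpos (hSU hxS) hxΩ))
  · refine zero_case x ?_
    filter_upwards [hS.isOpen_compl.mem_nhds hxS] with z hz
    rw [hVS z hz, smul_zero]
    rfl

theorem IsGraphChart.divergence_smul_eq (hch : IsGraphChart Ω e g U) (hg : Continuous g)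
    (hV : ∀ x ∈ Ω, ContDiffAt ℝ 1 V x) (hS : IsClosed S) (hSU : S ⊆ U) (hVS : ∀ x ∉ S, V x = 0)
    (hδ : 0 < δ) (hd : DifferentiableAt ℝ g (e x).fst) :
    divergence (fun z => smoothStep (level e g z / δ) • V z) x =
      smoothStep (level e g x / δ) * divergence V x -
        deriv smoothStep (level e g x / δ) / δ *
          ⟪graphNormal e g (e x).fst, Ω.indicator V x⟫ := by
  by_cases hxS : x ∈ S
  · by_cases hxΩ : x ∈ Ω
    · have h1 : HasGradientAt (fun z => smoothStep (level e g z / δ))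
          ((deriv smoothStep (level e g x / δ) / δ) • -graphNormal e g (e x).fst) x := by
        have h2 : HasDerivAt (fun s => smoothStep (s / δ))
            (deriv smoothStep (level e g x / δ) / δ) (level e g x) := by
          have := (hasDerivAt_smoothStep (level e g x / δ)).comp (level e g x)
            ((hasDerivAt_id (level e g x)).div_const δ)
          exact this.congr_deriv (by ring)
        have h3 := h2.comp_hasFDerivAt x (hasGradientAt_level hd).hasFDerivAt
        rw [hasGradientAt_iff_hasFDerivAt, map_smul]
        exact h3
      rw [divergence_smul h1 ((hV x hxΩ).differentiableAt (by simp)), indicator_of_mem hxΩ,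
        real_inner_smul_left, inner_neg_left]
      ring
    · have hl := hch.level_nonpos (hSU hxS) hxΩ
      have hle : level e g x / δ ≤ 1 := (div_le_one hδ).2 (by linarith)
      rw [divergence_zero_of_eventuallyEq (smoothStep_level_smul_eventuallyEq_zero hδ hg hl),
        smoothStep_of_le hle, indicator_of_notMem hxΩ, inner_zero_right]
      ring
  · have hV0 : V =ᶠ[𝓝 x] 0 := by
      filter_upwards [hS.isOpen_compl.mem_nhds hxS] with z hz using hVS z hz
    have h0 : (fun z => smoothStep (level e g z / δ) • V z) =ᶠ[𝓝 x] 0 := by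
      filter_upwards [hV0] with z hz
      rw [hz]
      simp
    rw [divergence_zero_of_eventuallyEq h0, divergence_zero_of_eventuallyEq hV0]
    have : Ω.indicator V x = 0 := indicator_apply_eq_zero.2 fun _ => hVS x hxS
    rw [this, inner_zero_right]
    ring

theorem measurable_indicator_of_continuousOn (hΩ : IsOpen Ω) (hV : ContinuousOn V Ω) :
    Measurable (Ω.indicator V) := by
  classical
  rw [← Set.piecewise_eq_indicator]
  exact hV.measurable_piecewise continuousOn_const hΩ.measurableSet

/-- V is controlled only on the closure of Ω, so it is extended by zero; the extension is
discontinuous but bounded and measurable, which suffices for dominated convergence. -/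
theorem IsGaussField.exists_norm_indicator_le (hV : ContinuousOn V (closure Ω)) (hS : IsCompact S)
    (hVS : ∀ x ∉ S, V x = 0) : ∃ C, 0 ≤ C ∧ ∀ x, ‖Ω.indicator V x‖ ≤ C := by
  obtain ⟨C, hC⟩ := (hS.inter_right isClosed_closure).exists_bound_of_continuousOn
    (hV.mono (inter_subset_right (s := S)))
  refine ⟨max C 0, le_max_right _ _, fun x => ?_⟩
  by_cases hx : x ∈ Ω
  · rw [indicator_of_mem hx]
    by_cases hxS : x ∈ S
    · exact (hC x ⟨hxS, subset_closure hx⟩).trans (le_max_left _ _)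
    · rw [hVS x hxS, norm_zero]
      exact le_max_right _ _
  · rw [indicator_of_notMem hx, norm_zero]
    exact le_max_right _ _

theorem norm_graphNormal_le (hg : LipschitzWith K g) (y : E2) : ‖graphNormal e g y‖ ≤ 1 + K := by
  have h1 : ‖∇ g y‖ ≤ K := by
    rw [gradient, LinearIsometryEquiv.norm_map]
    exact norm_fderiv_le_of_lipschitz ℝ hg
  rw [norm_graphNormal]
  have := areaFactor_le (∇ g y) 0 (ε := K) (by simpa using h1)
  simpa [areaFactor] using this

/-- The flux density through the layers below the graph, in rescaled coordinates. -/
def layerFlux (e : E3 ≃ᵃⁱ[ℝ] WithLp 2 (E2 × ℝ)) (g : E2 → ℝ) (W : E3 → E3) (δ : ℝ)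
    (p : E2 × ℝ) : ℝ :=
  deriv smoothStep p.2 * ⟪graphNormal e g p.1, W (depthMap e g (p.1, δ * p.2))⟫

/-! ### Flux through thin layers below the graph -/

section layerFlux

variable {W : E3 → E3} {C₁ C₂ : ℝ}

theorem measurable_layerFlux (hg : Continuous g) (hW : Measurable W) :
    Measurable (layerFlux e g W δ) := by
  have h1 : Measurable fun p : E2 × ℝ => W (depthMap e g (p.1, δ * p.2)) :=
    hW.comp ((continuous_depthMap hg).measurable.comp (Continuous.measurable (by fun_prop)))
  exact (continuous_deriv_smoothStep.measurable.comp measurable_snd).mul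
    ((measurable_graphNormal.comp measurable_fst).inner h1)

/-- The bound and its compact support do not depend on δ: this is the dominating function for the
limit δ → 0. -/
theorem abs_layerFlux_le (hg : LipschitzWith K g) (hC₁ : 0 ≤ C₁)
    (h₁ : ∀ s, |deriv smoothStep s| ≤ C₁) (hW : ∀ x, ‖W x‖ ≤ C₂) (hWS : ∀ x ∉ S, W x = 0)
    (p : E2 × ℝ) : ‖layerFlux e g W δ p‖ ≤
      (((fun x : E3 => (e x).fst) '' S) ×ˢ Icc (1 : ℝ) 2).indicator
        (fun _ => C₁ * ((1 + K) * C₂)) p := by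
  by_cases hp : p ∈ ((fun x : E3 => (e x).fst) '' S) ×ˢ Icc (1 : ℝ) 2
  · rw [indicator_of_mem hp, layerFlux, norm_mul]
    gcongr
    · exact h₁ _
    · refine (norm_inner_le_norm _ _).trans ?_
      gcongr
      · exact norm_graphNormal_le hg _
      · exact hW _
  · rw [indicator_of_notMem hp, norm_le_zero_iff, layerFlux]
    rw [mem_prod, not_and_or] at hp
    rcases hp with hp | hp
    · rw [hWS (depthMap e g (p.1, δ * p.2)) fun h => hp ⟨_, h, fst_depthMap _⟩, inner_zero_right,
        mul_zero]
    · rw [Set.mem_Icc, not_and_or, not_le, not_le] at hp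
      rw [hp.elim (fun h => deriv_smoothStep_of_le h.le) fun h => deriv_smoothStep_of_ge h.le,
        zero_mul]

theorem integrable_layerBound (hS : IsCompact S) (C : ℝ) :
    Integrable ((((fun x : E3 => (e x).fst) '' S) ×ˢ Icc (1 : ℝ) 2).indicator
        (fun _ => C)) (volume : Measure (E2 × ℝ)) := by
  have hc : IsCompact (((fun x : E3 => (e x).fst) '' S) ×ˢ Icc (1 : ℝ) 2) :=
    (hS.image continuous_fst_chart).prod isCompact_Icc
  exact (integrable_indicator_iff hc.isClosed.measurableSet).2
    (integrableOn_const hc.measure_lt_top.ne)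

theorem integrable_layerFlux (hg : LipschitzWith K g) (hW : Measurable W) (hS : IsCompact S)
    (hWC : ∀ x, ‖W x‖ ≤ C₂) (hWS : ∀ x ∉ S, W x = 0) :
    Integrable (layerFlux e g W δ) := by
  obtain ⟨C₁, hC₁, h₁⟩ := exists_abs_deriv_smoothStep_le
  exact (integrable_layerBound hS _).mono' (measurable_layerFlux hg.continuous hW).aestronglyMeasurable
    (ae_of_all _ (abs_layerFlux_le hg hC₁ h₁ hWC hWS))

theorem integrable_level_flux (hg : LipschitzWith K g) (hW : Measurable W) (hS : IsCompact S)
    (hWC : ∀ x, ‖W x‖ ≤ C₂) (hWS : ∀ x ∉ S, W x = 0) (hδ : 0 < δ) :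
    Integrable fun x => deriv smoothStep (level e g x / δ) / δ *
      ⟪graphNormal e g (e x).fst, W x⟫ := by
  obtain ⟨C₁, hC₁, h₁⟩ := exists_abs_deriv_smoothStep_le
  have hsupp : Function.support (fun x => deriv smoothStep (level e g x / δ) / δ *
      ⟪graphNormal e g (e x).fst, W x⟫) ⊆ S := fun x hx => by
    by_contra h
    exact hx (by simp [hWS x h])
  rw [← integrableOn_iff_integrable_of_support_subset hsupp]
  have hm : Measurable fun x => deriv smoothStep (level e g x / δ) / δ *
      ⟪graphNormal e g (e x).fst, W x⟫ :=
    ((continuous_deriv_smoothStep.measurable.comp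
      ((continuous_level hg.continuous).measurable.div_const δ)).div_const δ).mul
      ((measurable_graphNormal.comp continuous_fst_chart.measurable).inner hW)
  refine IntegrableOn.of_bound hS.measure_lt_top hm.aestronglyMeasurable
    (C₁ / δ * ((1 + K) * C₂)) (ae_of_all _ fun x => ?_)
  rw [norm_mul, norm_div, Real.norm_of_nonneg hδ.le]
  gcongr
  · exact h₁ _
  · refine (norm_inner_le_norm _ _).trans ?_
    gcongr
    · exact norm_graphNormal_le hg _
    · exact hWC _

/-- In coordinates (y, depth), which preserve volume, substitute depth = δ s on each fibre. The
Jacobian δ cancels the 1/δ from differentiating the cutoff. -/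
theorem integral_level_flux (hg : LipschitzWith K g) (hW : Measurable W) (hS : IsCompact S)
    (hWC : ∀ x, ‖W x‖ ≤ C₂) (hWS : ∀ x ∉ S, W x = 0) (hδ : 0 < δ) :
    ∫ x, deriv smoothStep (level e g x / δ) / δ * ⟪graphNormal e g (e x).fst, W x⟫ =
      ∫ p, layerFlux e g W δ p := by
  have hemb : MeasurableEmbedding (depthMap e g) :=
    (continuous_depthMap hg.continuous).measurableEmbedding injective_depthMap
  have hmp := measurePreserving_depthMap (e := e) hg.continuous
  have hint := integrable_level_flux (e := e) hg hW hS hWC hWS hδ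
  rw [← hmp.integrable_comp_emb hemb] at hint
  rw [← hmp.integral_comp hemb]
  simp only [Function.comp_def, fst_depthMap, level_depthMap] at hint ⊢
  rw [Measure.volume_eq_prod] at hint ⊢
  have hint2 : Integrable (layerFlux e g W δ) (volume.prod volume) :=
    integrable_layerFlux hg hW hS hWC hWS
  rw [integral_prod _ hint, integral_prod _ hint2]
  refine integral_congr_ae (ae_of_all _ fun y => ?_)
  have h := Measure.integral_comp_mul_left (fun s => deriv smoothStep (s / δ) / δ *
    ⟪graphNormal e g y, W (depthMap e g (y, s))⟫) δ
  simp only at h ⊢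
  rw [abs_of_pos (inv_pos.2 hδ), smul_eq_mul, inv_mul_eq_div, eq_div_iff hδ.ne'] at h
  rw [← h, ← integral_mul_const]
  refine integral_congr_ae (ae_of_all _ fun r => ?_)
  simp only [layerFlux]
  rw [mul_div_cancel_left₀ _ hδ.ne']
  field_simp

end layerFlux

/-- The cut-off field is Lipschitz with compact support, so its total divergence is zero; by the
product rule its two parts balance. -/
theorem IsGraphChart.integral_divergence_layer (hch : IsGraphChart Ω e g U) (hΩ : IsOpen Ω)
    (hg : LipschitzWith K g) (hV : IsGaussField Ω V) (hS : IsCompact S) (hSU : S ⊆ U)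
    (hVS : ∀ x ∉ S, V x = 0) (hδ : 0 < δ) :
    ∫ x in Ω, smoothStep (level e g x / δ) * divergence V x =
      ∫ p, layerFlux e g (Ω.indicator V) δ p := by
  obtain ⟨C, hC0, hC⟩ := IsGaussField.exists_norm_indicator_le hV.continuousOn hS hVS
  have hWm := measurable_indicator_of_continuousOn hΩ (hV.continuousOn.mono subset_closure)
  have hWS : ∀ x ∉ S, Ω.indicator V x = 0 := fun x hx => indicator_apply_eq_zero.2 fun _ => hVS x hx
  obtain ⟨D, hD⟩ := exists_lipschitzWith_of_hasCompactSupport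
    (hch.locallyLipschitz_smul hg hV.contDiffAt hS.isClosed hSU hVS hδ)
    (HasCompactSupport.intro hS fun x hx => by rw [hVS x hx, smul_zero])
  have h0 := integral_divergence_eq_zero hD
    (HasCompactSupport.intro hS fun x hx => by rw [hVS x hx, smul_zero])
  have hae : divergence (fun z => smoothStep (level e g z / δ) • V z) =ᵐ[volume] fun x =>
      smoothStep (level e g x / δ) * divergence V x -
        deriv smoothStep (level e g x / δ) / δ *
          ⟪graphNormal e g (e x).fst, Ω.indicator V x⟫ := by
    filter_upwards [ae_differentiableAt_fst_chart (e := e) hg] with x hx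
    exact hch.divergence_smul_eq hg.continuous hV.contDiffAt hS.isClosed hSU hVS hδ hx
  have hout : ∀ x, x ∉ Ω → smoothStep (level e g x / δ) * divergence V x = 0 := by
    intro x hx
    by_cases hxS : x ∈ S
    · have hl := hch.level_nonpos (hSU hxS) hx
      rw [smoothStep_of_le ((div_le_one hδ).2 (by linarith)), zero_mul]
    · have hV0 : V =ᶠ[𝓝 x] 0 := by
        filter_upwards [hS.isClosed.isOpen_compl.mem_nhds hxS] with z hz using hVS z hz
      rw [divergence_zero_of_eventuallyEq hV0, mul_zero]
  have hint1 : Integrable fun x => smoothStep (level e g x / δ) * divergence V x := by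
    have h1 : IntegrableOn (fun x => smoothStep (level e g x / δ) * divergence V x) Ω := by
      refine hV.integrableOn.bdd_mul (c := 1) ?_ (ae_of_all _ fun x => ?_)
      · exact ((contDiff_smoothStep_div δ).continuous.comp
          (continuous_level hg.continuous)).aestronglyMeasurable
      · rw [Real.norm_of_nonneg (smoothStep_nonneg _)]
        exact smoothStep_le_one _
    rwa [integrableOn_iff_integrable_of_support_subset] at h1
    exact fun x hx => by_contra fun h => hx (hout x h)
  have hint2 := integrable_level_flux (e := e) hg hWm hS hC hWS hδ
  rw [integral_congr_ae hae, integral_sub hint1 hint2, sub_eq_zero] at h0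
  rw [setIntegral_eq_integral_of_forall_compl_eq_zero hout, h0,
    integral_level_flux hg hWm hS hC hWS hδ]

/-- Let δ → 0 in the layer identity. The step tends to 1 at each point of Ω in the support of V, and
the flux at depth δ s tends to the flux on the graph; its weight, the derivative of the step, has
integral 1. -/
theorem IsGraphChart.integral_divergence_eq (hch : IsGraphChart Ω e g U) (hΩ : IsOpen Ω)
    (hg : LipschitzWith K g) (hV : IsGaussField Ω V) (hS : IsCompact S) (hSU : S ⊆ U)
    (hVS : ∀ x ∉ S, V x = 0) :
    ∫ x in Ω, divergence V x = ∫ y, ⟪graphNormal e g y, V (graphMap e g y)⟫ := by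
  obtain ⟨C, hC0, hC⟩ := IsGaussField.exists_norm_indicator_le hV.continuousOn hS hVS
  obtain ⟨C₁, hC₁, h₁⟩ := exists_abs_deriv_smoothStep_le
  have hWm := measurable_indicator_of_continuousOn hΩ (hV.continuousOn.mono subset_closure)
  have hWS : ∀ x ∉ S, Ω.indicator V x = 0 := fun x hx => indicator_apply_eq_zero.2 fun _ => hVS x hx
  have hpos : ∀ᶠ δ : ℝ in 𝓝[>] 0, 0 < δ := self_mem_nhdsWithin
  have lim1 : Tendsto (fun δ : ℝ => ∫ x in Ω, smoothStep (level e g x / δ) * divergence V x)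
      (𝓝[>] 0) (𝓝 (∫ x in Ω, divergence V x)) := by
    refine tendsto_integral_filter_of_dominated_convergence (fun x => ‖divergence V x‖)
      (Eventually.of_forall fun δ => ?_) (Eventually.of_forall fun δ => ae_of_all _ fun x => ?_)
      hV.integrableOn.norm ((ae_restrict_iff' hΩ.measurableSet).2 (ae_of_all _ fun x hx => ?_))
    · exact (((contDiff_smoothStep_div δ).continuous.comp
        (continuous_level hg.continuous)).measurable.mul
          (measurable_divergence V)).aestronglyMeasurable
    · rw [norm_mul, Real.norm_of_nonneg (smoothStep_nonneg _)]
      exact mul_le_of_le_one_left (norm_nonneg _) (smoothStep_le_one _)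
    · by_cases hxS : x ∈ S
      · have hl : 0 < level e g x := (hch.mem_iff x (hSU hxS)).1 hx
        refine tendsto_const_nhds.congr' ?_
        have : ∀ᶠ δ : ℝ in 𝓝[>] 0, δ < level e g x / 2 :=
          nhdsWithin_le_nhds (gt_mem_nhds (half_pos hl))
        filter_upwards [hpos, this] with δ hδ hδl
        rw [smoothStep_of_ge ((le_div_iff₀ hδ).2 (by linarith)), one_mul]
      · have hV0 : V =ᶠ[𝓝 x] 0 := by
          filter_upwards [hS.isClosed.isOpen_compl.mem_nhds hxS] with z hz using hVS z hz
        rw [divergence_zero_of_eventuallyEq hV0]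
        simp
  have lim2 : Tendsto (fun δ : ℝ => ∫ p, layerFlux e g (Ω.indicator V) δ p) (𝓝[>] 0)
      (𝓝 (∫ p : E2 × ℝ, ⟪graphNormal e g p.1, V (graphMap e g p.1)⟫ * deriv smoothStep p.2)) := by
    refine tendsto_integral_filter_of_dominated_convergence _
      (Eventually.of_forall fun δ => (measurable_layerFlux hg.continuous hWm).aestronglyMeasurable)
      (Eventually.of_forall fun δ => ae_of_all _ (abs_layerFlux_le hg hC₁ h₁ hC hWS))
      (integrable_layerBound hS _) (ae_of_all _ fun p => ?_)
    -- Where the weight does not vanish the depth is strictly positive, so in the chart the point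
    -- approaches the graph from inside Ω, where V is continuous up to the boundary.
    rcases le_or_gt p.2 1 with hr | hr
    · simp [layerFlux, deriv_smoothStep_of_le hr]
    have hlim : Tendsto (fun δ : ℝ => depthMap e g (p.1, δ * p.2)) (𝓝[>] 0)
        (𝓝 (graphMap e g p.1)) := by
      have hc : Continuous fun δ : ℝ => depthMap e g (p.1, δ * p.2) :=
        (continuous_depthMap hg.continuous).comp (by fun_prop)
      have := hc.tendsto 0
      rw [zero_mul, depthMap_zero] at this
      exact this.mono_left nhdsWithin_le_nhds
    have hW : Tendsto (fun δ : ℝ => Ω.indicator V (depthMap e g (p.1, δ * p.2))) (𝓝[>] 0)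
        (𝓝 (V (graphMap e g p.1))) := by
      by_cases hyU : graphMap e g p.1 ∈ U
      · have hin : ∀ᶠ δ : ℝ in 𝓝[>] 0, depthMap e g (p.1, δ * p.2) ∈ Ω := by
          filter_upwards [hlim.eventually (hch.isOpen.mem_nhds hyU), hpos] with δ hδU hδ
          rw [hch.mem_iff _ hδU, level_depthMap]
          positivity
        have hcl : graphMap e g p.1 ∈ closure Ω := mem_closure_of_tendsto hlim hin
        have h1 := (hV.continuousOn _ hcl).tendsto.comp
          (tendsto_nhdsWithin_iff.2 ⟨hlim, hin.mono fun δ h => subset_closure h⟩)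
        refine h1.congr' ?_
        filter_upwards [hin] with δ hδ
        rw [indicator_of_mem hδ]
        rfl
      -- The graph extends beyond the chart, where its position relative to Ω is unknown; there V is
      -- zero.
      · have hyS : graphMap e g p.1 ∉ S := fun h => hyU (hSU h)
        rw [hVS _ hyS]
        refine tendsto_const_nhds.congr' ?_
        filter_upwards [hlim.eventually (hS.isClosed.isOpen_compl.mem_nhds hyS)] with δ hδ
        rw [hWS _ hδ]
    rw [mul_comm]
    exact (tendsto_const_nhds.inner hW).const_mul _
  rw [Measure.volume_eq_prod, integral_prod_mul (fun y => ⟪graphNormal e g y, V (graphMap e g y)⟫),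
    integral_deriv_smoothStep, mul_one] at lim2
  refine tendsto_nhds_unique lim1 (lim2.congr' ?_)
  filter_upwards [hpos] with δ hδ
  exact (hch.integral_divergence_layer hΩ hg hV hS hSU hVS hδ).symm

/-- The divergence theorem for fields supported in a graph chart. -/
theorem IsGraphChart.gauss_green (hch : IsGraphChart Ω e g U) (hΩ : IsOpen Ω)
    (hg : LipschitzWith K g) (hV : IsGaussField Ω V) (hS : IsCompact S) (hSU : S ⊆ U)
    (hVS : ∀ x ∉ S, V x = 0) :
    ∫ x in Ω, divergence V x = ∫ x in frontier Ω, ⟪V x, outwardNormal Ω x⟫ ∂μHE[2] := by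
  have h1 : ∫ x in frontier Ω, ⟪V x, outwardNormal Ω x⟫ ∂μHE[2] =
      ∫ x in frontier Ω ∩ U, ⟪V x, outwardNormal Ω x⟫ ∂μHE[2] :=
    setIntegral_eq_of_subset_of_forall_sdiff_eq_zero isClosed_frontier.measurableSet
      inter_subset_left fun x hx => by
        rw [hVS x fun h => hx.2 ⟨hx.1, hSU h⟩, inner_zero_left]
  have h2 : ∫ x in range (graphMap e g), ⟪V x, graphUnitNormal e g (e x).fst⟫ ∂μHE[2] =
      ∫ x in range (graphMap e g) ∩ U, ⟪V x, graphUnitNormal e g (e x).fst⟫ ∂μHE[2] :=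
    setIntegral_eq_of_subset_of_forall_sdiff_eq_zero
      (isClosedEmbedding_graphMap hg.continuous).isClosed_range.measurableSet
      inter_subset_left fun x hx => by
        rw [hVS x fun h => hx.2 ⟨hx.1, hSU h⟩, inner_zero_left]
  have h3 : ∫ x in frontier Ω ∩ U, ⟪V x, outwardNormal Ω x⟫ ∂μHE[2] =
      ∫ x in frontier Ω ∩ U, ⟪V x, graphUnitNormal e g (e x).fst⟫ ∂μHE[2] :=
    integral_congr_ae ((hch.ae_outwardNormal_eq hΩ hg).mono fun x hx => by simp only [hx])
  -- V vanishes off S ⊆ U, so both surface integrals can be restricted to U, where the boundary and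
  -- the graph coincide. The area factor then turns the unit normal into (−∇g, 1).
  rw [h1, h3, hch.frontier_inter hΩ hg.continuous, ← h2, integral_range_graphMap hg,
    hch.integral_divergence_eq hΩ hg hV hS hSU hVS]
  refine integral_congr_ae (ae_of_all _ fun y => ?_)
  simp only [apply_graphMap]
  rw [← areaFactor_smul_graphUnitNormal, real_inner_smul_left, real_inner_comm]
  rfl

end

end NSBIM

namespace NSBIM

noncomputable section

variable {Ω U S : Set E3} {x : E3} {V : E3 → E3}

/-! ### The divergence theorem in a bounded Lipschitz domain -/

theorem isCompact_closure_of_isBounded (hb : IsBounded Ω) : IsCompact (closure Ω) :=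
  Metric.isCompact_of_isClosed_isBounded isClosed_closure hb.closure

theorem isBounded_frontier_of_isBounded (hb : IsBounded Ω) : IsBounded (frontier Ω) :=
  hb.closure.subset frontier_subset_closure

theorem integrableOn_frontier_of_bound (hS : HasLipschitzBoundary Ω) (hΩ : IsOpen Ω)
    (hb : IsBounded (frontier Ω)) (hV : ContinuousOn V (frontier Ω)) :
    IntegrableOn (fun x => ⟪V x, outwardNormal Ω x⟫) (frontier Ω) μHE[2] := by
  obtain ⟨C, hC⟩ := (Metric.isCompact_of_isClosed_isBounded isClosed_frontier
    hb).exists_bound_of_continuousOn hV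
  refine IntegrableOn.of_bound (hS.measure_frontier_lt_top hΩ hb) ?_ C
    ((ae_restrict_iff' isClosed_frontier.measurableSet).2 (ae_of_all _ fun x hx => ?_))
  · exact (hV.aestronglyMeasurable isClosed_frontier.measurableSet).inner
      (hS.aestronglyMeasurable_outwardNormal hΩ)
  · refine (norm_inner_le_norm _ _).trans ?_
    calc _ ≤ ‖V x‖ * 1 := by gcongr; exact norm_outwardNormal_le Ω x
      _ ≤ C := by rw [mul_one]; exact hC x hx

theorem integrableOn_of_isBounded {f : E3 → ℝ} (hb : IsBounded Ω)
    (hf : ContinuousOn f (closure Ω)) : IntegrableOn f Ω :=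
  (hf.integrableOn_compact (isCompact_closure_of_isBounded hb)).mono_set subset_closure

theorem hasGradientAt_of_contDiff {η : E3 → ℝ} (hη : ContDiff ℝ 1 η) (x : E3) :
    HasGradientAt η (∇ η x) x :=
  (hη.differentiable (by simp) x).hasGradientAt

theorem continuous_gradient_of_contDiff {η : E3 → ℝ} (hη : ContDiff ℝ 1 η) :
    Continuous (gradient η) :=
  (toDual ℝ E3).symm.continuous.comp (hη.continuous_fderiv (by simp))

theorem IsGaussField.smul (hΩ : IsOpen Ω) (hb : IsBounded Ω) (hV : IsGaussField Ω V)
    {η : E3 → ℝ} (hη : ContDiff ℝ 1 η) : IsGaussField Ω fun x => η x • V x where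
  continuousOn := hη.continuous.continuousOn.smul hV.continuousOn
  contDiffAt x hx := hη.contDiffAt.smul (hV.contDiffAt x hx)
  integrableOn := by
    obtain ⟨C, hC⟩ := (isCompact_closure_of_isBounded hb).exists_bound_of_continuousOn
      hη.continuous.continuousOn
    have h1 : IntegrableOn (fun x => η x * divergence V x) Ω :=
      hV.integrableOn.bdd_mul (c := C) hη.continuous.aestronglyMeasurable
        ((ae_restrict_iff' hΩ.measurableSet).2 (ae_of_all _ fun x hx => hC x (subset_closure hx)))
    have h2 : IntegrableOn (fun x => ⟪∇ η x, V x⟫) Ω :=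
      integrableOn_of_isBounded hb
        ((continuous_gradient_of_contDiff hη).continuousOn.inner hV.continuousOn)
    refine (h1.add h2).congr_fun (fun x hx => ?_) hΩ.measurableSet
    rw [divergence_smul (hasGradientAt_of_contDiff hη x)
      ((hV.contDiffAt x hx).differentiableAt (by simp))]
    rfl

/-- The divergence theorem for a field `V`. -/
def GaussGreen (Ω : Set E3) (V : E3 → E3) : Prop :=
  ∫ x in Ω, divergence V x = ∫ x in frontier Ω, ⟪V x, outwardNormal Ω x⟫ ∂μHE[2]

theorem gaussGreen_of_eqOn_zero (hΩ : IsOpen Ω) (h : ∀ x ∈ closure Ω, V x = 0) :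
    GaussGreen Ω V := by
  have h1 : ∫ x in Ω, divergence V x = 0 :=
    setIntegral_eq_zero_of_forall_eq_zero fun x hx => divergence_zero_of_eventuallyEq (by
      filter_upwards [hΩ.mem_nhds hx] with z hz using h z (subset_closure hz))
  have h2 : ∫ x in frontier Ω, ⟪V x, outwardNormal Ω x⟫ ∂μHE[2] = 0 :=
    setIntegral_eq_zero_of_forall_eq_zero fun x hx => by
      rw [h x (frontier_subset_closure hx), inner_zero_left]
  rw [GaussGreen, h1, h2]

theorem divergence_add {F G : E3 → E3} (hF : DifferentiableAt ℝ F x)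
    (hG : DifferentiableAt ℝ G x) :
    divergence (fun z => F z + G z) x = divergence F x + divergence G x := by
  have h : HasFDerivAt (fun z => F z + G z) _ x := hF.hasFDerivAt.add hG.hasFDerivAt
  simp only [divergence, h.fderiv, ← Finset.sum_add_distrib]
  rfl

theorem GaussGreen.add (hS : HasLipschitzBoundary Ω) (hΩ : IsOpen Ω) (hb : IsBounded Ω)
    {F G : E3 → E3} (hF : IsGaussField Ω F) (hG : IsGaussField Ω G) (gF : GaussGreen Ω F)
    (gG : GaussGreen Ω G) : GaussGreen Ω fun x => F x + G x := by
  have hbf := isBounded_frontier_of_isBounded hb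
  have h1 : ∫ x in Ω, divergence (fun z => F z + G z) x =
      ∫ x in Ω, (divergence F x + divergence G x) :=
    setIntegral_congr_fun hΩ.measurableSet fun x hx =>
      divergence_add ((hF.contDiffAt x hx).differentiableAt (by simp))
        ((hG.contDiffAt x hx).differentiableAt (by simp))
  rw [GaussGreen] at gF gG ⊢
  simp only [inner_add_left]
  rw [h1, integral_add hF.integrableOn hG.integrableOn, gF, gG, integral_add]
  · exact integrableOn_frontier_of_bound hS hΩ hbf
      (hF.continuousOn.mono frontier_subset_closure)
  · exact integrableOn_frontier_of_bound hS hΩ hbf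
      (hG.continuousOn.mono frontier_subset_closure)

/-- A field supported inside Ω extends by zero to a Lipschitz field on the whole space, and its flux
through the boundary is zero. -/
theorem gaussGreen_of_isCompact_subset (hΩ : IsOpen Ω) (hV : IsGaussField Ω V)
    (hSc : IsCompact S) (hSΩ : S ⊆ Ω) (hVS : ∀ x ∉ S, V x = 0) : GaussGreen Ω V := by
  have hnhds : ∀ x ∉ S, V =ᶠ[𝓝 x] 0 := fun x hx => by
    filter_upwards [hSc.isClosed.isOpen_compl.mem_nhds hx] with z hz using hVS z hz
  have hcs : HasCompactSupport V := HasCompactSupport.intro hSc hVS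
  have hl : LocallyLipschitz V := by
    intro x
    by_cases hx : x ∈ S
    · exact (hV.contDiffAt x (hSΩ hx)).exists_lipschitzOnWith
    · refine ⟨0, _, hnhds x hx, fun a ha b hb => ?_⟩
      have ha' : V a = 0 := ha
      have hb' : V b = 0 := hb
      simp [ha', hb']
  obtain ⟨D, hD⟩ := exists_lipschitzWith_of_hasCompactSupport hl hcs
  have h1 : ∫ x in Ω, divergence V x = 0 := by
    rw [setIntegral_eq_integral_of_forall_compl_eq_zero, integral_divergence_eq_zero hD hcs]
    exact fun x hx => divergence_zero_of_eventuallyEq (hnhds x fun h => hx (hSΩ h))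
  have h2 : ∫ x in frontier Ω, ⟪V x, outwardNormal Ω x⟫ ∂μHE[2] = 0 :=
    setIntegral_eq_zero_of_forall_eq_zero fun x hx => by
      rw [hΩ.frontier_eq] at hx
      rw [hVS x fun h => hx.2 (hSΩ h), inner_zero_left]
  rw [GaussGreen, h1, h2]

theorem exists_bump {p : E3} (hU : IsOpen U) (hp : p ∈ U) :
    ∃ (b : E3 → ℝ) (W S : Set E3), ContDiff ℝ 1 b ∧ IsOpen W ∧ p ∈ W ∧ (∀ x ∈ W, b x = 1) ∧
      IsCompact S ∧ S ⊆ U ∧ ∀ x ∉ S, b x = 0 := by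
  obtain ⟨r, hr, hrU⟩ := Metric.isOpen_iff.1 hU p hp
  let b : ContDiffBump p := ⟨r / 4, r / 2, by positivity, by linarith⟩
  refine ⟨b, Metric.ball p (r / 4), Metric.closedBall p (r / 2), b.contDiff, Metric.isOpen_ball,
    Metric.mem_ball_self (by positivity), fun x hx => ?_, isCompact_closedBall _ _, ?_,
    fun x hx => ?_⟩
  · exact b.one_of_mem_closedBall (Metric.ball_subset_closedBall hx)
  · exact (Metric.closedBall_subset_ball (by linarith)).trans hrU
  · refine b.zero_of_le_dist ?_
    rw [Metric.mem_closedBall, not_le] at hx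
    exact hx.le

theorem HasLipschitzBoundary.exists_local_gaussGreen (hS : HasLipschitzBoundary Ω)
    (hΩ : IsOpen Ω) (hb : IsBounded Ω) {p : E3} (hp : p ∈ closure Ω) :
    ∃ (b : E3 → ℝ) (W : Set E3), ContDiff ℝ 1 b ∧ IsOpen W ∧ p ∈ W ∧ (∀ x ∈ W, b x = 1) ∧
      ∀ V, IsGaussField Ω V → GaussGreen Ω fun x => b x • V x := by
  by_cases hpΩ : p ∈ Ω
  · obtain ⟨b, W, S, hb1, hW, hpW, hbW, hSc, hSU, hbS⟩ := exists_bump hΩ hpΩ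
    refine ⟨b, W, hb1, hW, hpW, hbW, fun V hV => ?_⟩
    exact gaussGreen_of_isCompact_subset hΩ (hV.smul hΩ hb hb1) hSc hSU fun x hx => by
      rw [hbS x hx, zero_smul]
  · obtain ⟨e, g, U, K, hg, hU, hch⟩ := hS.exists_chart (p := p) (by
      rw [hΩ.frontier_eq]; exact ⟨hp, hpΩ⟩)
    obtain ⟨b, W, S, hb1, hW, hpW, hbW, hSc, hSU, hbS⟩ := exists_bump hch.isOpen hU
    refine ⟨b, W, hb1, hW, hpW, hbW, fun V hV => ?_⟩
    exact hch.gauss_green hΩ hg (hV.smul hΩ hb hb1) hSc hSU fun x hx => by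
      rw [hbS x hx, zero_smul]

/-- The divergence theorem in a bounded Lipschitz domain. -/
theorem HasLipschitzBoundary.gaussGreen (hS : HasLipschitzBoundary Ω) (hΩ : IsOpen Ω)
    (hb : IsBounded Ω) (hV : IsGaussField Ω V) : GaussGreen Ω V := by
  have hloc := fun p (hp : p ∈ closure Ω) => hS.exists_local_gaussGreen hΩ hb hp
  choose! b W hb1 hW hpW hbW hgg using hloc
  obtain ⟨t, ht, hcov⟩ := (isCompact_closure_of_isBounded hb).elim_nhds_subcover W
    fun p hp => (hW p hp).mem_nhds (hpW p hp)
  -- Induction on the number of sets needed to cover the support replaces a partition of unity: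
  -- split V = bV + (1 − b)V, where bV is local and (1 − b)V vanishes on `W p`, so the remaining
  -- sets suffice for it.
  have main : ∀ s : Finset E3, (∀ p ∈ s, p ∈ closure Ω) → ∀ V, IsGaussField Ω V →
      (∀ x ∈ closure Ω, x ∉ ⋃ p ∈ s, W p → V x = 0) → GaussGreen Ω V := by
    intro s
    induction s using Finset.induction_on with
    | empty =>
      intro _ V _ h0
      exact gaussGreen_of_eqOn_zero hΩ fun x hx => h0 x hx (by simp)
    | insert p s _ ih =>
      intro hs V hV h0
      have hp := hs p (Finset.mem_insert_self p s)
      have h1b : ContDiff ℝ 1 fun x => 1 - b p x := contDiff_const.sub (hb1 p hp)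
      have hrest := ih (fun q hq => hs q (Finset.mem_insert_of_mem hq)) _ (hV.smul hΩ hb h1b)
        fun x hx hxs => by
          by_cases hxp : x ∈ W p
          · rw [hbW p hp x hxp, sub_self, zero_smul]
          · rw [h0 x hx, smul_zero]
            rw [Finset.set_biUnion_insert, mem_union, not_or]
            exact ⟨hxp, hxs⟩
      have := GaussGreen.add hS hΩ hb (hV.smul hΩ hb (hb1 p hp)) (hV.smul hΩ hb h1b)
        (hgg p hp V hV) hrest
      simpa only [← add_smul, add_sub_cancel, one_smul] using this
  exact main t ht V hV fun x hx hxt => absurd (hcov hx) hxt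

end

end NSBIM

namespace NSBIM

noncomputable section

variable {Ω : Set E3} {x x₀ : E3} {u : E3 → ℝ}

/-! ### Harmonic functions and the free-space Green's function -/

theorem divergence_gradient (hu : ContDiffAt ℝ 2 u x) :
    divergence (gradient u) x = Laplacian.laplacian u x := by
  have hd : DifferentiableAt ℝ (fderiv ℝ u) x :=
    (hu.fderiv_right (m := 1) (by norm_num)).differentiableAt (by simp)
  let D : StrongDual ℝ E3 →L[ℝ] E3 := LinearMap.toContinuousLinearMap
    { toFun := (toDual ℝ E3).symm, map_add' := map_add _, map_smul' := fun a l => by simp }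
  have h : HasFDerivAt (gradient u) (D.comp (fderiv ℝ (fderiv ℝ u) x)) x :=
    D.hasFDerivAt.comp x hd.hasFDerivAt
  rw [laplacian_eq_iteratedFDeriv_orthonormalBasis u (EuclideanSpace.basisFun (Fin 3) ℝ)]
  simp only [divergence, h.fderiv, iteratedFDeriv_two_apply]
  refine Finset.sum_congr rfl fun i _ => ?_
  have key : ∀ l : StrongDual ℝ E3, ((toDual ℝ E3).symm l) i = l (EuclideanSpace.single i 1) := by
    intro l
    rw [← toDual_symm_apply (𝕜 := ℝ) (y := l), EuclideanSpace.inner_single_right]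
    simp
  simpa [D] using key (fderiv ℝ (fderiv ℝ u) x (EuclideanSpace.single i 1))

theorem divergence_gradient_of_harmonicAt (hu : HarmonicAt u x) :
    divergence (gradient u) x = 0 := by
  rw [divergence_gradient hu.1]
  exact hu.2.eq_of_nhds

theorem hasGradientAt_norm_sub (h : x ≠ x₀) :
    HasGradientAt (fun z => ‖z - x₀‖) (‖x - x₀‖⁻¹ • (x - x₀)) x := by
  have hn : ‖x - x₀‖ ^ 2 ≠ 0 := pow_ne_zero _ (norm_ne_zero_iff.2 (sub_ne_zero.2 h))
  have h1 : HasFDerivAt (fun z : E3 => ‖z - x₀‖ ^ 2) (2 • (innerSL ℝ (x - x₀))) x := by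
    have := ((hasFDerivAt_id x).sub_const x₀).norm_sq
    simpa using this
  have h2 := h1.sqrt hn
  simp only [Real.sqrt_sq (norm_nonneg _)] at h2
  rw [hasGradientAt_iff_hasFDerivAt]
  refine h2.congr_fderiv ?_
  ext v
  simp
  ring

theorem hasGradientAt_comp_norm_sub (h : x ≠ x₀) {f : ℝ → ℝ} {f' : ℝ}
    (hf : HasDerivAt f f' ‖x - x₀‖) :
    HasGradientAt (fun z => f ‖z - x₀‖) ((f' * ‖x - x₀‖⁻¹) • (x - x₀)) x := by
  have := hf.comp_hasFDerivAt x (hasGradientAt_norm_sub h).hasFDerivAt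
  rw [hasGradientAt_iff_hasFDerivAt, mul_smul, map_smul]
  exact this

theorem hasGradientAt_green (h : x ≠ x₀) :
    HasGradientAt (green x₀) (-(‖x - x₀‖ ^ 3)⁻¹ • (x - x₀)) x := by
  have hn : ‖x - x₀‖ ≠ 0 := norm_ne_zero_iff.2 (sub_ne_zero.2 h)
  have h1 := hasGradientAt_comp_norm_sub h (hasDerivAt_inv hn)
  have h2 : green x₀ = fun z => ‖z - x₀‖⁻¹ := by funext z; simp [green]
  rw [h2]
  convert h1 using 2
  field_simp

theorem gradient_green (h : x ≠ x₀) : ∇ (green x₀) x = -(‖x - x₀‖ ^ 3)⁻¹ • (x - x₀) :=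
  (hasGradientAt_green h).gradient

theorem norm_gradient_green (h : x ≠ x₀) : ‖∇ (green x₀) x‖ = 1 / ‖x - x₀‖ ^ 2 := by
  have hn : ‖x - x₀‖ ≠ 0 := norm_ne_zero_iff.2 (sub_ne_zero.2 h)
  rw [gradient_green h, norm_smul, norm_neg, norm_inv, norm_pow, norm_norm]
  field_simp

theorem contDiffAt_green (h : x ≠ x₀) {n : ℕ∞} : ContDiffAt ℝ n (green x₀) x := by
  have h1 : ContDiffAt ℝ n (fun z : E3 => ‖z - x₀‖) x :=
    (contDiffAt_id.sub contDiffAt_const).norm ℝ (sub_ne_zero.2 h)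
  exact contDiffAt_const.div h1 (norm_ne_zero_iff.2 (sub_ne_zero.2 h))

/-- ∇G = −r⁻³(x − x₀), and in three dimensions −3r⁻³ from the position vector cancels 3r⁻⁴ · r from
the radial factor. -/
theorem divergence_gradient_green (h : x ≠ x₀) : divergence (gradient (green x₀)) x = 0 := by
  have hn : ‖x - x₀‖ ≠ 0 := norm_ne_zero_iff.2 (sub_ne_zero.2 h)
  have h1 : gradient (green x₀) =ᶠ[𝓝 x] fun z => (-(‖z - x₀‖ ^ 3)⁻¹) • (z - x₀) := by
    filter_upwards [isOpen_ne.mem_nhds h] with z hz using gradient_green hz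
  have h2 : HasDerivAt (fun s : ℝ => -(s ^ 3)⁻¹) (3 * (‖x - x₀‖ ^ 4)⁻¹) ‖x - x₀‖ := by
    have := ((hasDerivAt_pow 3 ‖x - x₀‖).inv (pow_ne_zero 3 hn)).neg
    refine this.congr_deriv ?_
    field_simp
    norm_num
    ring
  have h3 : HasFDerivAt (fun z : E3 => z - x₀) (ContinuousLinearMap.id ℝ E3) x :=
    (hasFDerivAt_id x).sub_const x₀
  have h4 : divergence (fun z : E3 => z - x₀) x = 3 := by
    simp only [divergence, h3.fderiv]
    simp
  rw [divergence_congr h1, divergence_smul (hasGradientAt_comp_norm_sub h h2)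
    h3.differentiableAt, h4, real_inner_smul_left, real_inner_self_eq_norm_sq]
  field_simp
  ring

theorem harmonicAt_green (h : x ≠ x₀) : HarmonicAt (green x₀) x := by
  refine ⟨contDiffAt_green h, ?_⟩
  filter_upwards [isOpen_ne.mem_nhds h] with z hz
  rw [← divergence_gradient (contDiffAt_green hz), divergence_gradient_green hz]
  rfl

/-! ### Green's second identity with a singular kernel -/

theorem gradientWithin_eq_of_mem (hΩ : IsOpen Ω) (hx : x ∈ Ω) :
    gradientWithin u (closure Ω) x = ∇ u x := by
  rw [gradientWithin, gradient, fderivWithin_of_mem_nhds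
    (mem_of_superset (hΩ.mem_nhds hx) subset_closure)]

theorem IsPotential.continuousOn (hu : IsPotential Ω u) : ContinuousOn u (closure Ω) :=
  hu.2.continuousOn

theorem IsPotential.continuousOn_gradientWithin (hu : IsPotential Ω u)
    (hS : HasLipschitzBoundary Ω) (hΩ : IsOpen Ω) :
    ContinuousOn (gradientWithin u (closure Ω)) (closure Ω) :=
  (toDual ℝ E3).symm.continuous.comp_continuousOn
    (hu.2.continuousOn_fderivWithin (hS.uniqueDiffOn hΩ) (by simp))

/-- The field `u ∇G - G ∇u`. -/
def greenField (Ω : Set E3) (x₀ : E3) (u : E3 → ℝ) (x : E3) : E3 :=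
  u x • ∇ (green x₀) x - green x₀ x • gradientWithin u (closure Ω) x

theorem continuousWithinAt_greenField (hu : IsPotential Ω u) (hS : HasLipschitzBoundary Ω)
    (hΩ : IsOpen Ω) (hx : x ∈ closure Ω) (h : x ≠ x₀) :
    ContinuousWithinAt (greenField Ω x₀ u) (closure Ω) x := by
  have h1 : ContinuousAt (gradient (green x₀)) x :=
    (toDual ℝ E3).symm.continuous.continuousAt.comp
      ((contDiffAt_green (n := 2) h).fderiv_right (m := 1) (by norm_num)).continuousAt
  exact ((hu.continuousOn x hx).smul h1.continuousWithinAt).sub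
    ((contDiffAt_green (n := 1) h).continuousAt.continuousWithinAt.smul
      (hu.continuousOn_gradientWithin hS hΩ x hx))

theorem greenField_eventuallyEq (hΩ : IsOpen Ω) (hx : x ∈ Ω) :
    greenField Ω x₀ u =ᶠ[𝓝 x]
      fun z => u z • ∇ (green x₀) z + (-green x₀ z) • ∇ u z := by
  filter_upwards [hΩ.mem_nhds hx] with z hz
  rw [greenField, gradientWithin_eq_of_mem hΩ hz, neg_smul, sub_eq_add_neg]

theorem contDiffAt_gradient (hu : ContDiffAt ℝ 2 u x) : ContDiffAt ℝ 1 (gradient u) x :=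
  (toDual ℝ E3).symm.toContinuousLinearEquiv.contDiff.contDiffAt.comp x
    (hu.fderiv_right (m := 1) (by norm_num))

theorem contDiffAt_greenField (hu : IsPotential Ω u) (hΩ : IsOpen Ω) (hx : x ∈ Ω) (h : x ≠ x₀) :
    ContDiffAt ℝ 1 (greenField Ω x₀ u) x := by
  have hu2 := (hu.1 x hx).1
  refine ContDiffAt.congr_of_eventuallyEq ?_ (greenField_eventuallyEq hΩ hx)
  exact ((hu2.of_le (by norm_num)).smul (contDiffAt_gradient (contDiffAt_green (n := 2) h))).add
    ((contDiffAt_green (n := 1) h).neg.smul (contDiffAt_gradient hu2))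

/-- Both u and G are harmonic, and the cross terms ∇u·∇G cancel. -/
theorem divergence_greenField (hu : IsPotential Ω u) (hΩ : IsOpen Ω) (hx : x ∈ Ω) (h : x ≠ x₀) :
    divergence (greenField Ω x₀ u) x = 0 := by
  have hu2 := (hu.1 x hx).1
  have g1 : HasGradientAt u (∇ u x) x := (hu2.differentiableAt (by simp)).hasGradientAt
  have g2 : HasGradientAt (fun z => -green x₀ z) (-∇ (green x₀) x) x := by
    have := (hasGradientAt_green h).hasFDerivAt.neg
    rw [hasGradientAt_iff_hasFDerivAt, map_neg, gradient_green h]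
    exact this
  have d1 := (contDiffAt_gradient (contDiffAt_green (n := 2) h)).differentiableAt (by simp)
  have d2 := (contDiffAt_gradient hu2).differentiableAt (by simp)
  have s1 : DifferentiableAt ℝ (fun z => u z • ∇ (green x₀) z) x := g1.differentiableAt.smul d1
  have s2 : DifferentiableAt ℝ (fun z => (-green x₀ z) • ∇ u z) x := g2.differentiableAt.smul d2
  rw [divergence_congr (greenField_eventuallyEq hΩ hx), divergence_add s1 s2,
    divergence_smul g1 d1, divergence_smul g2 d2, divergence_gradient_green h,
    divergence_gradient_of_harmonicAt (hu.1 x hx), inner_neg_left, real_inner_comm]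
  ring

/-- Near x₀ this is differentiability within the closure; at distance at least r the bound M of u is
at most (M/r)‖x − x₀‖. -/
theorem exists_abs_le_mul_norm_sub (hu : IsPotential Ω u) (hb : IsBounded Ω)
    (hx₀ : x₀ ∈ closure Ω) (h0 : u x₀ = 0) :
    ∃ C, 0 ≤ C ∧ ∀ x ∈ closure Ω, |u x| ≤ C * ‖x - x₀‖ := by
  have hd : DifferentiableWithinAt ℝ u (closure Ω) x₀ := (hu.2 x₀ hx₀).differentiableWithinAt (by simp)
  obtain ⟨C₁, hC₁⟩ := hd.isBigO_sub.bound
  obtain ⟨r, hr, hball⟩ := Metric.mem_nhdsWithin_iff.1 hC₁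
  obtain ⟨M, hM⟩ := (isCompact_closure_of_isBounded hb).exists_bound_of_continuousOn hu.continuousOn
  have hM0 : 0 ≤ M := (norm_nonneg _).trans (hM x₀ hx₀)
  refine ⟨max C₁ (M / r), le_max_of_le_right (by positivity), fun x hx => ?_⟩
  by_cases hxr : x ∈ Metric.ball x₀ r
  · have := hball ⟨hxr, hx⟩
    simp only [mem_ofPred_eq, h0, sub_zero] at this
    exact this.trans (by gcongr; exact le_max_left _ _)
  · have hxr' : r ≤ ‖x - x₀‖ := by simpa [dist_eq_norm] using hxr
    calc |u x| ≤ M := hM x hx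
      _ = M / r * r := by field_simp
      _ ≤ _ := by gcongr; exact le_max_right _ _

/-- A smooth cutoff that removes the ball of radius `ε` about `x₀`. -/
def ballCutoff (x₀ : E3) (ε : ℝ) (x : E3) : ℝ := smoothStep (‖x - x₀‖ ^ 2 / ε ^ 2)

variable {ε : ℝ}

theorem contDiff_ballCutoff : ContDiff ℝ 1 (ballCutoff x₀ ε) :=
  contDiff_smoothStep.comp (((contDiff_id.sub contDiff_const).norm_sq ℝ).div_const _)

theorem gradient_ballCutoff (x : E3) : ∇ (ballCutoff x₀ ε) x =
    (deriv smoothStep (‖x - x₀‖ ^ 2 / ε ^ 2) * (2 / ε ^ 2)) • (x - x₀) := by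
  have h1 : HasFDerivAt (fun z : E3 => ‖z - x₀‖ ^ 2) (2 • (innerSL ℝ (x - x₀))) x := by
    have := ((hasFDerivAt_id x).sub_const x₀).norm_sq
    simpa using this
  have h2 : HasFDerivAt (ballCutoff x₀ ε) _ x :=
    (hasDerivAt_smoothStep _).comp_hasFDerivAt x (h1.mul_const (ε ^ 2)⁻¹)
  refine HasGradientAt.gradient ?_
  rw [hasGradientAt_iff_hasFDerivAt]
  refine h2.congr_fderiv ?_
  ext v
  simp [div_eq_mul_inv]
  ring

theorem ballCutoff_eventuallyEq_zero (hε : 0 < ε) : ballCutoff x₀ ε =ᶠ[𝓝 x₀] 0 := by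
  filter_upwards [Metric.ball_mem_nhds x₀ hε] with z hz
  rw [mem_ball_iff_norm] at hz
  refine smoothStep_of_le ((div_le_one (by positivity)).2 ?_)
  gcongr

/-- The gradient is of size |x − x₀|/ε² and vanishes for |x − x₀| ≥ 2ε. -/
theorem exists_norm_gradient_ballCutoff_le : ∃ C, 0 ≤ C ∧ ∀ (x₀ : E3) (ε : ℝ), 0 < ε → ∀ x : E3,
    ‖∇ (ballCutoff x₀ ε) x‖ ≤ C / ε := by
  obtain ⟨C, hC0, hC⟩ := exists_abs_deriv_smoothStep_le
  refine ⟨4 * C, by positivity, fun x₀ ε hε x => ?_⟩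
  rw [gradient_ballCutoff, norm_smul, norm_mul, Real.norm_of_nonneg (by positivity : 0 ≤ 2 / ε ^ 2)]
  rcases le_or_gt ‖x - x₀‖ (2 * ε) with h | h
  · calc _ ≤ C * (2 / ε ^ 2) * (2 * ε) := by gcongr; exact hC _
      _ = 4 * C / ε := by field_simp; ring
  · rw [deriv_smoothStep_of_ge, norm_zero, zero_mul, zero_mul]
    · positivity
    · rw [le_div_iff₀ (by positivity)]
      nlinarith

theorem gradient_ballCutoff_eq_zero (hε : 0 < ε) (h : ‖x - x₀‖ ≤ ε ∨ 2 * ε ≤ ‖x - x₀‖) :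
    ∇ (ballCutoff x₀ ε) x = 0 := by
  rw [gradient_ballCutoff]
  rcases h with h | h
  · rw [deriv_smoothStep_of_le, zero_mul, zero_smul]
    rw [div_le_one (by positivity)]
    gcongr
  · rw [deriv_smoothStep_of_ge, zero_mul, zero_smul]
    rw [le_div_iff₀ (by positivity)]
    nlinarith

theorem tendsto_ballCutoff (h : x ≠ x₀) :
    Tendsto (fun ε => ballCutoff x₀ ε x) (𝓝[>] 0) (𝓝 1) := by
  have hn : 0 < ‖x - x₀‖ := norm_pos_iff.2 (sub_ne_zero.2 h)
  refine tendsto_const_nhds.congr' ?_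
  have h1 : ∀ᶠ ε : ℝ in 𝓝[>] 0, ε < ‖x - x₀‖ / 2 :=
    nhdsWithin_le_nhds (gt_mem_nhds (half_pos hn))
  filter_upwards [h1, self_mem_nhdsWithin] with ε hε hε0
  have hε0' : (0 : ℝ) < ε := hε0
  refine (smoothStep_of_ge ?_).symm
  rw [le_div_iff₀ (by positivity)]
  nlinarith

theorem continuousOn_gradient_ballCutoff_inner (hu : IsPotential Ω u)
    (hS : HasLipschitzBoundary Ω) (hΩ : IsOpen Ω) (hε : 0 < ε) :
    ContinuousOn (fun x => ⟪∇ (ballCutoff x₀ ε) x, greenField Ω x₀ u x⟫) (closure Ω) := by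
  intro x hx
  by_cases h : x = x₀
  · have : (fun x => ⟪∇ (ballCutoff x₀ ε) x, greenField Ω x₀ u x⟫) =ᶠ[𝓝 x] fun _ => 0 := by
      rw [h]
      filter_upwards [Metric.ball_mem_nhds x₀ hε] with z hz
      rw [mem_ball_iff_norm] at hz
      rw [gradient_ballCutoff_eq_zero hε (Or.inl hz.le), inner_zero_left]
    exact (continuousAt_const.congr this.symm).continuousWithinAt
  · exact (continuous_gradient_of_contDiff contDiff_ballCutoff).continuousWithinAt.inner
      (continuousWithinAt_greenField hu hS hΩ hx h)

/-- The cutoff erases the pole, so the product is continuous up to the boundary; as the Green field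
is divergence-free in Ω, only the gradient of the cutoff contributes to the divergence. -/
theorem isGaussField_ballCutoff_smul (hu : IsPotential Ω u) (hS : HasLipschitzBoundary Ω)
    (hΩ : IsOpen Ω) (hb : IsBounded Ω) (hx₀ : x₀ ∉ Ω) (hε : 0 < ε) :
    IsGaussField Ω (fun x => ballCutoff x₀ ε x • greenField Ω x₀ u x) ∧
      ∀ x ∈ Ω, divergence (fun x => ballCutoff x₀ ε x • greenField Ω x₀ u x) x =
        ⟪∇ (ballCutoff x₀ ε) x, greenField Ω x₀ u x⟫ := by
  have hne : ∀ x ∈ Ω, x ≠ x₀ := fun x hx h => hx₀ (h ▸ hx)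
  have hdiv : ∀ x ∈ Ω, divergence (fun x => ballCutoff x₀ ε x • greenField Ω x₀ u x) x =
        ⟪∇ (ballCutoff x₀ ε) x, greenField Ω x₀ u x⟫ := fun x hx => by
    rw [divergence_smul (hasGradientAt_of_contDiff contDiff_ballCutoff x)
      ((contDiffAt_greenField hu hΩ hx (hne x hx)).differentiableAt (by simp)),
      divergence_greenField hu hΩ hx (hne x hx), mul_zero, zero_add]
  refine ⟨⟨fun x hx => ?_, fun x hx => ?_, ?_⟩, hdiv⟩
  · by_cases h : x = x₀
    · have : (fun x => ballCutoff x₀ ε x • greenField Ω x₀ u x) =ᶠ[𝓝 x] fun _ => 0 := by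
        rw [h]
        filter_upwards [ballCutoff_eventuallyEq_zero hε] with z hz
        rw [hz]
        simp
      exact (continuousAt_const.congr this.symm).continuousWithinAt
    · exact contDiff_ballCutoff.continuous.continuousWithinAt.smul
        (continuousWithinAt_greenField hu hS hΩ hx h)
  · exact contDiff_ballCutoff.contDiffAt.smul (contDiffAt_greenField hu hΩ hx (hne x hx))
  · exact (integrableOn_of_isBounded hb (continuousOn_gradient_ballCutoff_inner hu hS hΩ
      hε)).congr_fun (fun x hx => (hdiv x hx).symm) hΩ.measurableSet

/-- Reason for the absence of a solid angle: where the integrand is nonzero, both factors are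
O(1/ε), and the volume is O(ε³). Without u(x₀) = 0 the field would only be O(1/ε²) there and the
estimate would not give zero. -/
theorem tendsto_integral_gradient_ballCutoff (hu : IsPotential Ω u) (hS : HasLipschitzBoundary Ω)
    (hΩ : IsOpen Ω) (hb : IsBounded Ω) (hx₀ : x₀ ∈ closure Ω) (h0 : u x₀ = 0) :
    Tendsto (fun ε => ∫ x in Ω, ⟪∇ (ballCutoff x₀ ε) x, greenField Ω x₀ u x⟫) (𝓝[>] 0) (𝓝 0) := by
  obtain ⟨C₁, hC₁, h₁⟩ := exists_abs_le_mul_norm_sub hu hb hx₀ h0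
  obtain ⟨C₂, h₂⟩ := (isCompact_closure_of_isBounded hb).exists_bound_of_continuousOn
    (hu.continuousOn_gradientWithin hS hΩ)
  have hC₂ : 0 ≤ C₂ := (norm_nonneg _).trans (h₂ x₀ hx₀)
  obtain ⟨C₃, hC₃, h₃⟩ := exists_norm_gradient_ballCutoff_le
  set m : ℝ := (volume : Measure E3).real (Metric.ball 0 1)
  have hfield : ∀ x ∈ closure Ω, x ≠ x₀ → ‖greenField Ω x₀ u x‖ ≤ (C₁ + C₂) / ‖x - x₀‖ := by
    intro x hx hne
    have hn : 0 < ‖x - x₀‖ := norm_pos_iff.2 (sub_ne_zero.2 hne)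
    refine (norm_sub_le _ _).trans ?_
    rw [norm_smul, norm_smul, norm_gradient_green hne, green, norm_div, norm_one, norm_norm]
    calc _ ≤ C₁ * ‖x - x₀‖ * (1 / ‖x - x₀‖ ^ 2) + 1 / ‖x - x₀‖ * C₂ := by
          gcongr
          · exact h₁ x hx
          · exact h₂ x hx
      _ = _ := by field_simp
  have hbound : ∀ ε > 0, ‖∫ x in Ω, ⟪∇ (ballCutoff x₀ ε) x, greenField Ω x₀ u x⟫‖ ≤
      C₃ * (C₁ + C₂) * 8 * m * ε := by
    intro ε hε
    have hsub : ∫ x in Ω, ⟪∇ (ballCutoff x₀ ε) x, greenField Ω x₀ u x⟫ =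
        ∫ x in Ω ∩ Metric.ball x₀ (2 * ε), ⟪∇ (ballCutoff x₀ ε) x, greenField Ω x₀ u x⟫ := by
      refine setIntegral_eq_of_subset_of_forall_sdiff_eq_zero hΩ.measurableSet inter_subset_left
        fun x hx => ?_
      have : 2 * ε ≤ ‖x - x₀‖ := by
        by_contra! hlt
        exact hx.2 ⟨hx.1, mem_ball_iff_norm.2 hlt⟩
      rw [gradient_ballCutoff_eq_zero hε (Or.inr this), inner_zero_left]
    have hfin : volume (Ω ∩ Metric.ball x₀ (2 * ε)) < ⊤ :=
      (measure_mono inter_subset_right).trans_lt measure_ball_lt_top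
    have hpt : ∀ x ∈ Ω ∩ Metric.ball x₀ (2 * ε),
        ‖⟪∇ (ballCutoff x₀ ε) x, greenField Ω x₀ u x⟫‖ ≤ C₃ / ε * ((C₁ + C₂) / ε) := by
      intro x hx
      rcases le_or_gt ‖x - x₀‖ ε with h | h
      · rw [gradient_ballCutoff_eq_zero hε (Or.inl h), inner_zero_left, norm_zero]
        positivity
      · have hne : x ≠ x₀ := fun hx => by
          rw [hx, sub_self, norm_zero] at h
          linarith
        refine (norm_inner_le_norm _ _).trans ?_
        gcongr
        · exact h₃ x₀ ε hε x
        · refine (hfield x (subset_closure hx.1) hne).trans ?_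
          gcongr
    rw [hsub]
    refine (norm_setIntegral_le_of_norm_le_const hfin hpt).trans ?_
    have hvol : (volume : Measure E3).real (Ω ∩ Metric.ball x₀ (2 * ε)) ≤ (2 * ε) ^ 3 * m := by
      refine (measureReal_mono inter_subset_right measure_ball_lt_top.ne).trans (le_of_eq ?_)
      rw [measureReal_def, Measure.addHaar_ball _ _ (by positivity : 0 ≤ 2 * ε), ENNReal.toReal_mul,
        ENNReal.toReal_ofReal (by positivity)]
      simp [m, measureReal_def]
    calc _ ≤ C₃ / ε * ((C₁ + C₂) / ε) * ((2 * ε) ^ 3 * m) := by gcongr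
      _ = _ := by field_simp; ring
  have hlim : Tendsto (fun ε : ℝ => C₃ * (C₁ + C₂) * 8 * m * ε) (𝓝[>] 0) (𝓝 0) := by
    have : Continuous fun ε : ℝ => C₃ * (C₁ + C₂) * 8 * m * ε := by fun_prop
    simpa using (this.tendsto 0).mono_left (nhdsWithin_le_nhds (s := Ioi (0 : ℝ)))
  refine squeeze_zero_norm' ?_ hlim
  filter_upwards [self_mem_nhdsWithin] with ε hε using hbound ε hε

/-- |u| ≤ C|x − x₀| against |∇G| = |x − x₀|⁻², and a bounded gradient against G, both leave the
integrable singularity 1/|x − x₀|. -/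
theorem integrableOn_green_layers (hu : IsPotential Ω u) (hS : HasLipschitzBoundary Ω)
    (hΩ : IsOpen Ω) (hb : IsBounded Ω) (hx₀ : x₀ ∈ frontier Ω) (h0 : u x₀ = 0) :
    IntegrableOn (fun x => u x * ⟪∇ (green x₀) x, outwardNormal Ω x⟫) (frontier Ω) μHE[2] ∧
    IntegrableOn (fun x => ⟪gradientWithin u (closure Ω) x, outwardNormal Ω x⟫ * green x₀ x)
      (frontier Ω) μHE[2] := by
  have hcl : x₀ ∈ closure Ω := frontier_subset_closure hx₀
  obtain ⟨C₁, hC₁, h₁⟩ := exists_abs_le_mul_norm_sub hu hb hcl h0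
  obtain ⟨C₂, h₂⟩ := (isCompact_closure_of_isBounded hb).exists_bound_of_continuousOn
    (hu.continuousOn_gradientWithin hS hΩ)
  have hC₂ : 0 ≤ C₂ := (norm_nonneg _).trans (h₂ x₀ hcl)
  have hinv := hS.integrableOn_inv_norm_sub hΩ (isBounded_frontier_of_isBounded hb) hx₀
  have hn := hS.aestronglyMeasurable_outwardNormal hΩ
  have hfm : MeasurableSet (frontier Ω) := isClosed_frontier.measurableSet
  have hgrad : Measurable (gradient (green x₀)) :=
    (toDual ℝ E3).symm.continuous.measurable.comp (measurable_fderiv ℝ _)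
  have hgreen : Measurable (green x₀) := by unfold green; fun_prop
  constructor
  · refine Integrable.mono' (hinv.const_mul C₁) ?_
      ((ae_restrict_iff' hfm).2 (ae_of_all _ fun x hx => ?_))
    · exact ((hu.continuousOn.mono frontier_subset_closure).aestronglyMeasurable hfm).mul
        (hgrad.aestronglyMeasurable.inner hn)
    · by_cases hne : x = x₀
      · rw [hne, h0, zero_mul, norm_zero]; positivity
      · have hn : 0 < ‖x - x₀‖ := norm_pos_iff.2 (sub_ne_zero.2 hne)
        rw [norm_mul]
        calc _ ≤ C₁ * ‖x - x₀‖ * (1 / ‖x - x₀‖ ^ 2 * 1) := by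
              gcongr
              · exact h₁ x (frontier_subset_closure hx)
              · refine (norm_inner_le_norm _ _).trans ?_
                rw [norm_gradient_green hne]
                gcongr
                exact norm_outwardNormal_le Ω x
          _ = _ := by field_simp
  · refine Integrable.mono' (hinv.const_mul C₂) ?_
      ((ae_restrict_iff' hfm).2 (ae_of_all _ fun x hx => ?_))
    · exact ((((hu.continuousOn_gradientWithin hS hΩ).mono
        frontier_subset_closure).aestronglyMeasurable hfm).inner hn).mul
          hgreen.aestronglyMeasurable
    · rw [norm_mul, green, Real.norm_of_nonneg (by positivity : 0 ≤ 1 / ‖x - x₀‖)]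
      gcongr
      refine (norm_inner_le_norm _ _).trans ?_
      calc _ ≤ C₂ * 1 := by
            gcongr
            · exact h₂ x (frontier_subset_closure hx)
            · exact norm_outwardNormal_le Ω x
        _ = C₂ := mul_one _

/-- Green's second identity for a potential vanishing at the pole of the Green's function. -/
theorem integral_green_layers (hu : IsPotential Ω u) (hS : HasLipschitzBoundary Ω)
    (hΩ : IsOpen Ω) (hb : IsBounded Ω) (hx₀ : x₀ ∈ frontier Ω) (h0 : u x₀ = 0) :
    ∫ x in frontier Ω, u x * ⟪∇ (green x₀) x, outwardNormal Ω x⟫ ∂μHE[2] =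
      ∫ x in frontier Ω, ⟪gradientWithin u (closure Ω) x, outwardNormal Ω x⟫ * green x₀ x
        ∂μHE[2] := by
  obtain ⟨i1, i2⟩ := integrableOn_green_layers hu hS hΩ hb hx₀ h0
  have hx₀Ω : x₀ ∉ Ω := by
    rw [hΩ.frontier_eq] at hx₀
    exact hx₀.2
  have hinner : (fun x => ⟪greenField Ω x₀ u x, outwardNormal Ω x⟫) =
      fun x => u x * ⟪∇ (green x₀) x, outwardNormal Ω x⟫ -
        ⟪gradientWithin u (closure Ω) x, outwardNormal Ω x⟫ * green x₀ x := by
    funext x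
    rw [greenField, inner_sub_left, real_inner_smul_left, real_inner_smul_left]
    ring
  have hint : IntegrableOn (fun x => ⟪greenField Ω x₀ u x, outwardNormal Ω x⟫) (frontier Ω)
      μHE[2] := by
    rw [hinner]
    exact i1.sub i2
  have hlim : Tendsto (fun ε => ∫ x in frontier Ω,
      ⟪ballCutoff x₀ ε x • greenField Ω x₀ u x, outwardNormal Ω x⟫ ∂μHE[2]) (𝓝[>] 0)
      (𝓝 (∫ x in frontier Ω, ⟪greenField Ω x₀ u x, outwardNormal Ω x⟫ ∂μHE[2])) := by
    refine tendsto_integral_filter_of_dominated_convergence _ (Eventually.of_forall fun ε => ?_)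
      (Eventually.of_forall fun ε => ae_of_all _ fun x => ?_) hint.norm (ae_of_all _ fun x => ?_)
    · simp only [real_inner_smul_left]
      exact contDiff_ballCutoff.continuous.aestronglyMeasurable.mul hint.aestronglyMeasurable
    · rw [real_inner_smul_left, norm_mul, ballCutoff, Real.norm_of_nonneg (smoothStep_nonneg _)]
      exact mul_le_of_le_one_left (norm_nonneg _) (smoothStep_le_one _)
    · simp only [real_inner_smul_left]
      by_cases hne : x = x₀
      -- At the pole u(x₀) = 0 kills the first term and the convention 1/0 = 0 kills the second, so
      -- convergence holds at every point.
      · have : greenField Ω x₀ u x = 0 := by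
          rw [hne, greenField, h0, green]
          simp
        simp [this]
      · simpa using (tendsto_ballCutoff hne).mul_const ⟪greenField Ω x₀ u x, outwardNormal Ω x⟫
  have hzero := tendsto_integral_gradient_ballCutoff hu hS hΩ hb (frontier_subset_closure hx₀) h0
  have heq : ∫ x in frontier Ω, ⟪greenField Ω x₀ u x, outwardNormal Ω x⟫ ∂μHE[2] = 0 := by
    refine tendsto_nhds_unique (hlim.congr' ?_) hzero
    filter_upwards [self_mem_nhdsWithin] with ε hε
    obtain ⟨hV, hdiv⟩ := isGaussField_ballCutoff_smul hu hS hΩ hb hx₀Ω hε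
    rw [← hS.gaussGreen hΩ hb hV]
    exact setIntegral_congr_fun hΩ.measurableSet hdiv
  rwa [hinner, integral_sub i1 i2, sub_eq_zero] at heq

end

end NSBIM

namespace NSBIM

noncomputable section

variable {Ω Ω' : Set E3} {x x₀ n₀ : E3} {u φ f : E3 → ℝ} {R : ℝ}

/-! ### The integrands in terms of one potential -/

/-- The potential `φ - φ(x₀) - (∂φ/∂n)₀ f`, which vanishes at `x₀`. -/
def reducedPotential (Ω : Set E3) (x₀ n₀ : E3) (φ f : E3 → ℝ) (x : E3) : ℝ :=
  φ x - φ x₀ - normalDeriv Ω φ x₀ n₀ * f x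

theorem IsPotential.reducedPotential (hφ : IsPotential Ω φ) (hf : IsPotential Ω f) (x₀ n₀ : E3) :
    IsPotential Ω (reducedPotential Ω x₀ n₀ φ f) := by
  constructor
  · exact (hφ.1.sub (harmonicOnNhd_const (φ x₀))).sub
      (hf.1.const_smul (c := normalDeriv Ω φ x₀ n₀))
  · exact (hφ.2.sub contDiffOn_const).sub (contDiffOn_const.mul hf.2)

theorem reducedPotential_self (hf : f x₀ = 0) : reducedPotential Ω x₀ n₀ φ f x₀ = 0 := by
  simp [reducedPotential, hf]

theorem gradientWithin_reducedPotential {s : Set E3} (hφ : DifferentiableWithinAt ℝ φ s x)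
    (hf : DifferentiableWithinAt ℝ f s x) (hs : UniqueDiffWithinAt ℝ s x) :
    gradientWithin (reducedPotential Ω x₀ n₀ φ f) s x =
      gradientWithin φ s x - normalDeriv Ω φ x₀ n₀ • gradientWithin f s x := by
  have h : HasFDerivWithinAt (reducedPotential Ω x₀ n₀ φ f)
      (fderivWithin ℝ φ s x - normalDeriv Ω φ x₀ n₀ • fderivWithin ℝ f s x) s x :=
    (hφ.hasFDerivWithinAt.sub_const (φ x₀)).sub (hf.hasFDerivWithinAt.const_mul _)
  rw [gradientWithin, h.fderivWithin hs, map_sub, map_smul]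
  rfl

/-- Linearity of the gradient within the closure, legitimate because derivatives there are unique.
-/
theorem singleLayerIntegrand_eq (hS : HasLipschitzBoundary Ω) (hΩ : IsOpen Ω)
    (hφ : IsPotential Ω φ) (hf : IsPotential Ω f) (ν : E3 → E3) (hx : x ∈ closure Ω) :
    singleLayerIntegrand Ω x₀ n₀ φ f ν x =
      ⟪gradientWithin (reducedPotential Ω x₀ n₀ φ f) (closure Ω) x, ν x⟫ * green x₀ x := by
  rw [gradientWithin_reducedPotential ((hφ.2 x hx).differentiableWithinAt (by simp))
    ((hf.2 x hx).differentiableWithinAt (by simp)) (hS.uniqueDiffOn hΩ x hx), inner_sub_left,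
    real_inner_smul_left]
  rfl

theorem doubleLayerIntegrand_eq (ν : E3 → E3) :
    doubleLayerIntegrand Ω x₀ n₀ φ f ν =
      fun x => reducedPotential Ω x₀ n₀ φ f x * ⟪∇ (green x₀) x, ν x⟫ := rfl

/-- The integral equation for internal domains. -/
theorem integral_layerIntegrands_interior (hΩ : IsOpen Ω) (hS : HasLipschitzBoundary Ω)
    (hx₀ : x₀ ∈ frontier Ω) (hb : IsBounded Ω) (hφ : IsPotential Ω φ)
    (hf : IsAdmissible Ω x₀ n₀ f) :
    IntegrableOn (doubleLayerIntegrand Ω x₀ n₀ φ f (outwardNormal Ω)) (frontier Ω) μHE[2] ∧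
      IntegrableOn (singleLayerIntegrand Ω x₀ n₀ φ f (outwardNormal Ω)) (frontier Ω) μHE[2] ∧
      ∫ x in frontier Ω, doubleLayerIntegrand Ω x₀ n₀ φ f (outwardNormal Ω) x ∂μHE[2] =
        ∫ x in frontier Ω, singleLayerIntegrand Ω x₀ n₀ φ f (outwardNormal Ω) x ∂μHE[2] := by
  have hu := hφ.reducedPotential hf.1 x₀ n₀
  have h0 : reducedPotential Ω x₀ n₀ φ f x₀ = 0 := reducedPotential_self hf.2.1
  have hfm : MeasurableSet (frontier Ω) := isClosed_frontier.measurableSet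
  have heq : EqOn (fun x => ⟪gradientWithin (reducedPotential Ω x₀ n₀ φ f) (closure Ω) x,
      outwardNormal Ω x⟫ * green x₀ x) (singleLayerIntegrand Ω x₀ n₀ φ f (outwardNormal Ω))
      (frontier Ω) := fun x hx =>
    (singleLayerIntegrand_eq hS hΩ hφ hf.1 _ (frontier_subset_closure hx)).symm
  obtain ⟨i1, i2⟩ := integrableOn_green_layers hu hS hΩ hb hx₀ h0
  refine ⟨i1, i2.congr_fun heq hfm, ?_⟩
  rw [← setIntegral_congr_fun hfm heq]
  exact integral_green_layers hu hS hΩ hb hx₀ h0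

/-! ### Sets that agree near a point -/

theorem mem_closure_congr (h : Ω =ᶠ[𝓝 x] Ω') : x ∈ closure Ω ↔ x ∈ closure Ω' := by
  rw [mem_closure_iff_frequently, mem_closure_iff_frequently]
  exact frequently_congr h.mem_iff

theorem closure_congr (h : Ω =ᶠ[𝓝 x] Ω') : closure Ω =ᶠ[𝓝 x] closure Ω' :=
  (eventually_eventuallyEq_nhds.2 h).mono fun _ hy => propext (mem_closure_congr hy)

theorem mem_frontier_congr (h : Ω =ᶠ[𝓝 x] Ω') : x ∈ frontier Ω ↔ x ∈ frontier Ω' := by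
  rw [frontier_eq_closure_inter_closure, frontier_eq_closure_inter_closure, mem_inter_iff,
    mem_inter_iff, mem_closure_congr h, mem_closure_congr h.compl]

theorem IsSubgraphNear.congr {P : (E2 → ℝ) → Prop} (hs : IsSubgraphNear P Ω x)
    (h : Ω =ᶠ[𝓝 x] Ω') : IsSubgraphNear P Ω' x := by
  obtain ⟨e, g, U, hg, hU, hx, hiff⟩ := hs
  obtain ⟨W, hW, hWo, hxW⟩ := mem_nhds_iff.1 h
  refine ⟨e, g, U ∩ W, hg, hU.inter hWo, ⟨hx, hxW⟩, fun z hz => ?_⟩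
  have : (z ∈ Ω) = (z ∈ Ω') := hW hz.2
  rw [← this]
  exact hiff z hz.1

/-! ### Balls -/

/-- A Lipschitz function whose graph is a cap of the sphere of radius `R`. -/
def capFunction (R : ℝ) (y : E2) : ℝ := √(R ^ 2 - min ‖y‖ (R / 2) ^ 2)

/-- Let m be the truncated radius and h the height. From h² + m² = R² one gets |h − h'|(h + h') = |m
− m'|(m + m'), and the truncation gives m ≤ R/2 ≤ h, hence constant 1. -/
theorem lipschitzWith_capFunction (hR : 0 < R) : LipschitzWith 1 (capFunction R) := by
  have hmin : ∀ y : E2, 0 ≤ min ‖y‖ (R / 2) ∧ min ‖y‖ (R / 2) ≤ R / 2 := fun y =>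
    ⟨le_min (norm_nonneg _) (by positivity), min_le_right _ _⟩
  have hsq : ∀ y, capFunction R y ^ 2 = R ^ 2 - min ‖y‖ (R / 2) ^ 2 := fun y =>
    Real.sq_sqrt (by nlinarith [hmin y])
  have hge : ∀ y, R / 2 ≤ capFunction R y := fun y =>
    Real.le_sqrt_of_sq_le (by nlinarith [hmin y])
  refine LipschitzWith.of_dist_le_mul fun y z => ?_
  rw [NNReal.coe_one, one_mul, Real.dist_eq]
  have hmm : |min ‖y‖ (R / 2) - min ‖z‖ (R / 2)| ≤ dist y z := by
    have h1 := abs_min_sub_min_le_max ‖y‖ (R / 2) ‖z‖ (R / 2)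
    rw [sub_self, abs_zero, max_eq_left (abs_nonneg _)] at h1
    rw [dist_eq_norm]
    exact h1.trans (abs_norm_sub_norm_le y z)
  refine le_trans ?_ hmm
  have hprod : |capFunction R y - capFunction R z| * (capFunction R y + capFunction R z) =
      |min ‖y‖ (R / 2) - min ‖z‖ (R / 2)| * (min ‖y‖ (R / 2) + min ‖z‖ (R / 2)) := by
    rw [← abs_of_nonneg (by linarith [hge y, hge z] : 0 ≤ capFunction R y + capFunction R z),
      ← abs_of_nonneg (by linarith [hmin y, hmin z] : 0 ≤ min ‖y‖ (R / 2) + min ‖z‖ (R / 2)),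
      ← abs_mul, ← abs_mul, ← abs_neg]
    congr 1
    nlinarith [hsq y, hsq z]
  have hpos : 0 < capFunction R y + capFunction R z := by linarith [hge y, hge z]
  refine le_of_mul_le_mul_right ?_ hpos
  rw [hprod]
  exact mul_le_mul_of_nonneg_left (by linarith [hmin y, hmin z, hge y, hge z]) (abs_nonneg _)

/-- Take any isometry onto E2 × ℝ sending c to 0, then reflect the image of p to the vertical axis,
which is possible because the norms agree. -/
theorem exists_chart_axis {c p : E3} (hR : 0 < R) (hp : ‖p - c‖ = R) :
    ∃ e : E3 ≃ᵃⁱ[ℝ] WithLp 2 (E2 × ℝ), e c = 0 ∧ e p = WithLp.toLp 2 (0, R) := by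
  have hfin : Module.finrank ℝ E3 = Module.finrank ℝ (WithLp 2 (E2 × ℝ)) := by
    rw [(WithLp.linearEquiv 2 ℝ (E2 × ℝ)).finrank_eq, Module.finrank_prod]
    simp
  let L : E3 ≃ₗᵢ[ℝ] WithLp 2 (E2 × ℝ) := (stdOrthonormalBasis ℝ E3).equiv
    (stdOrthonormalBasis ℝ (WithLp 2 (E2 × ℝ))) (finCongr hfin)
  have hnorm : ‖L (p - c)‖ = ‖WithLp.toLp 2 ((0 : E2), R)‖ := by
    rw [L.norm_map, hp, WithLp.prod_norm_eq_of_L2]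
    simp [Real.sqrt_sq_eq_abs, abs_of_pos hR]
  let ρ := (ℝ ∙ (L (p - c) - WithLp.toLp 2 ((0 : E2), R)))ᗮ.reflection
  have hρ : ρ (L (p - c)) = WithLp.toLp 2 ((0 : E2), R) := Submodule.reflection_sub hnorm
  refine ⟨(AffineIsometryEquiv.vaddConst ℝ c).symm.trans (L.trans ρ).toAffineIsometryEquiv, ?_, ?_⟩
  · simp
  · simpa using hρ

theorem isSubgraphNear_ball {c p : E3} (hR : 0 < R) (hp : ‖p - c‖ = R) :
    IsSubgraphNear (fun g => ∃ K : ℝ≥0, LipschitzWith K g) (Metric.ball c R) p := by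
  obtain ⟨e, hec, hep⟩ := exists_chart_axis hR hp
  refine ⟨e, capFunction R, {x | ‖(e x).fst‖ < R / 2} ∩ {x | 0 < (e x).snd},
    ⟨1, lipschitzWith_capFunction hR⟩, ?_, ?_, ?_⟩
  · exact (isOpen_lt continuous_fst_chart.norm continuous_const).inter
      (isOpen_lt continuous_const continuous_snd_chart)
  · simp [hep, hR]
  · rintro x ⟨hx1, hx2⟩
    have hx1' : ‖(e x).fst‖ < R / 2 := hx1
    have hx2' : 0 < (e x).snd := hx2
    have hd : ‖x - c‖ ^ 2 = ‖(e x).fst‖ ^ 2 + (e x).snd ^ 2 := by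
      rw [← dist_eq_norm, ← e.dist_map, hec, dist_zero_right, WithLp.prod_norm_sq_eq_of_L2]
      simp
    rw [mem_ball_iff_norm, capFunction, min_eq_left hx1'.le, Real.lt_sqrt hx2'.le,
      ← sq_lt_sq₀ (norm_nonneg _) hR.le, hd]
    constructor <;> intro h <;> linarith

theorem hasLipschitzBoundary_ball (c : E3) (hR : 0 < R) : HasLipschitzBoundary (Metric.ball c R) := by
  intro p hp
  rw [frontier_ball c hR.ne', mem_sphere_iff_norm] at hp
  exact isSubgraphNear_ball hR hp

/-- Expanding gives ‖y − c‖² = R² + 2R⟪n, y − x⟫ + ‖y − x‖². Within distance 2Rε of x the quadratic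
term is dominated by 2Rε‖y − x‖. -/
theorem isOutwardUnitNormal_ball {c : E3} (hR : 0 < R) (hx : x ∈ Metric.sphere c R) :
    IsOutwardUnitNormal (Metric.ball c R) x (R⁻¹ • (x - c)) := by
  rw [mem_sphere_iff_norm] at hx
  refine ⟨by rw [norm_smul, hx, norm_inv, Real.norm_of_nonneg hR.le, inv_mul_cancel₀ hR.ne'], ?_⟩
  intro ε hε
  filter_upwards [Metric.ball_mem_nhds x (by positivity : 0 < 2 * R * ε)] with y hy
  rw [mem_ball_iff_norm] at hy
  have hexp : ‖y - c‖ ^ 2 = R ^ 2 + 2 * R * ⟪R⁻¹ • (x - c), y - x⟫ + ‖y - x‖ ^ 2 := by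
    have : y - c = (x - c) + (y - x) := by abel
    rw [this, norm_add_sq_real, hx, real_inner_smul_left]
    field_simp
  rw [mem_ball_iff_norm, ← sq_lt_sq₀ (norm_nonneg _) hR.le, hexp]
  have hn := norm_nonneg (y - x)
  constructor
  · intro h
    nlinarith
  · intro h
    nlinarith

theorem outwardNormal_ball {c : E3} (hR : 0 < R) (hx : x ∈ Metric.sphere c R) :
    outwardNormal (Metric.ball c R) x = R⁻¹ • (x - c) :=
  outwardNormal_eq (isOutwardUnitNormal_ball hR hx)

/-- The area of a sphere. -/
theorem measureReal_sphere (c : E3) (hR : 0 < R) :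
    (μHE[2] : Measure E3).real (Metric.sphere c R) = 4 * Real.pi * R ^ 2 := by
  -- The field z − c has divergence 3 and flux density R on the sphere, so R times the area equals 3
  -- times the known volume of the ball.
  have hdiv : ∀ z : E3, divergence (fun z : E3 => z - c) z = 3 := by
    intro z
    have h3 : HasFDerivAt (fun z : E3 => z - c) (ContinuousLinearMap.id ℝ E3) z :=
      (hasFDerivAt_id z).sub_const c
    simp only [divergence, h3.fderiv]
    simp
  have hV : IsGaussField (Metric.ball c R) fun z => z - c := by
    refine ⟨by fun_prop, fun _ _ => by fun_prop, ?_⟩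
    rw [show divergence (fun z : E3 => z - c) = fun _ => 3 from funext hdiv]
    exact integrableOn_const measure_ball_lt_top.ne
  have h := (hasLipschitzBoundary_ball c hR).gaussGreen Metric.isOpen_ball Metric.isBounded_ball hV
  rw [GaussGreen, frontier_ball c hR.ne'] at h
  have h2 : ∫ z in Metric.sphere c R, ⟪z - c, outwardNormal (Metric.ball c R) z⟫ ∂μHE[2] =
      ∫ z in Metric.sphere c R, R ∂μHE[2] := by
    refine setIntegral_congr_fun Metric.isClosed_sphere.measurableSet fun z hz => ?_
    rw [outwardNormal_ball hR hz]
    rw [mem_sphere_iff_norm] at hz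
    rw [real_inner_smul_right, real_inner_self_eq_norm_sq, hz]
    field_simp
  simp only [hdiv] at h
  rw [h2, setIntegral_const, setIntegral_const, measureReal_def (μ := (volume : Measure E3)),
    EuclideanSpace.volume_ball_fin_three, ENNReal.toReal_mul, ENNReal.toReal_pow,
    ENNReal.toReal_ofReal hR.le, ENNReal.toReal_ofReal (by positivity), smul_eq_mul, smul_eq_mul] at h
  have : R * ((μHE[2] : Measure E3).real (Metric.sphere c R) - 4 * Real.pi * R ^ 2) = 0 := by
    linear_combination -h
  rcases mul_eq_zero.1 this with h | h
  · exact absurd h hR.ne'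
  · linarith

theorem measure_sphere_lt_top (c : E3) (hR : 0 < R) :
    (μHE[2] : Measure E3) (Metric.sphere c R) < ⊤ := by
  have := (hasLipschitzBoundary_ball c hR).measure_frontier_lt_top Metric.isOpen_ball
    (isBounded_frontier_of_isBounded Metric.isBounded_ball)
  rwa [frontier_ball c hR.ne'] at this

end

end NSBIM

namespace NSBIM

noncomputable section

variable {Ω : Set E3} {x x₀ n₀ : E3} {u φ f : E3 → ℝ} {r R c : ℝ}

/-! ### Truncation of an external domain -/

theorem inter_ball_eventuallyEq_left (hx : x ∈ Metric.ball x₀ R) :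
    (Ω ∩ Metric.ball x₀ R : Set E3) =ᶠ[𝓝 x] Ω := by
  filter_upwards [Metric.isOpen_ball.mem_nhds hx] with z hz
  exact propext (and_iff_left hz)

theorem inter_ball_eventuallyEq_right (hΩ : IsOpen Ω) (hx : x ∈ Ω) :
    (Ω ∩ Metric.ball x₀ R : Set E3) =ᶠ[𝓝 x] Metric.ball x₀ R := by
  filter_upwards [hΩ.mem_nhds hx] with z hz
  exact propext (and_iff_right hz)

theorem mem_ball_of_mem_frontier (hΩ : IsOpen Ω) (hr : Ωᶜ ⊆ Metric.ball x₀ r)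
    (hx : x ∈ frontier Ω) : x ∈ Metric.ball x₀ r := by
  rw [hΩ.frontier_eq] at hx
  exact hr hx.2

theorem mem_of_mem_sphere (hr : Ωᶜ ⊆ Metric.ball x₀ R) (hx : x ∈ Metric.sphere x₀ R) : x ∈ Ω := by
  by_contra h
  have := hr h
  rw [mem_sphere_iff_norm] at hx
  rw [mem_ball_iff_norm] at this
  exact this.ne hx

/-- Inside the ball the truncated set looks like Ω; a point outside it lies in the open set Ω, so
near that point the truncated set looks like the ball. The Lipschitz condition and the normals
transfer for the same reason. -/
theorem frontier_inter_ball (hΩ : IsOpen Ω) (hR : 0 < R) (hr : Ωᶜ ⊆ Metric.ball x₀ R) :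
    frontier (Ω ∩ Metric.ball x₀ R) = frontier Ω ∪ Metric.sphere x₀ R := by
  ext x
  by_cases hx : x ∈ Metric.ball x₀ R
  · have : x ∉ Metric.sphere x₀ R := fun h =>
      (mem_ball_iff_norm.1 hx).ne (mem_sphere_iff_norm.1 h)
    rw [mem_frontier_congr (inter_ball_eventuallyEq_left hx), mem_union, or_iff_left this]
  · have h : x ∉ frontier Ω := fun h => hx (mem_ball_of_mem_frontier hΩ hr h)
    have hxΩ : x ∈ Ω := by
      by_contra h'
      exact hx (hr h')
    rw [mem_frontier_congr (inter_ball_eventuallyEq_right hΩ hxΩ), frontier_ball _ hR.ne', mem_union,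
      or_iff_right h]

theorem hasLipschitzBoundary_inter_ball (hS : HasLipschitzBoundary Ω) (hΩ : IsOpen Ω) (hR : 0 < R)
    (hr : Ωᶜ ⊆ Metric.ball x₀ R) : HasLipschitzBoundary (Ω ∩ Metric.ball x₀ R) := by
  intro p hp
  rw [frontier_inter_ball hΩ hR hr] at hp
  rcases hp with hp | hp
  · exact (hS p hp).congr (inter_ball_eventuallyEq_left (mem_ball_of_mem_frontier hΩ hr hp)).symm
  · refine (hasLipschitzBoundary_ball x₀ hR p ?_).congr
      (inter_ball_eventuallyEq_right hΩ (mem_of_mem_sphere hr hp)).symm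
    rwa [frontier_ball _ hR.ne']

theorem IsPotential.mono {Ω' : Set E3} (hu : IsPotential Ω u) (h : Ω' ⊆ Ω) : IsPotential Ω' u :=
  ⟨fun x hx => hu.1 x (h hx), hu.2.mono (closure_mono h)⟩

theorem gradientWithin_inter_ball_of_mem_ball (hx : x ∈ Metric.ball x₀ R) :
    gradientWithin u (closure (Ω ∩ Metric.ball x₀ R)) x = gradientWithin u (closure Ω) x := by
  rw [gradientWithin, gradientWithin,
    fderivWithin_congr_set (closure_congr (inter_ball_eventuallyEq_left hx))]

/-- At a point of Ω the function is differentiable in the full sense, so truncating the set does not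
change the gradient. -/
theorem gradientWithin_inter_ball_of_mem (hu : IsPotential Ω u) (hΩ : IsOpen Ω)
    (hS : HasLipschitzBoundary (Ω ∩ Metric.ball x₀ R)) (hx : x ∈ Ω)
    (hxR : x ∈ closure (Ω ∩ Metric.ball x₀ R)) :
    gradientWithin u (closure (Ω ∩ Metric.ball x₀ R)) x = gradientWithin u (closure Ω) x := by
  have hd : DifferentiableAt ℝ u x := (hu.1 x hx).1.differentiableAt (by simp)
  rw [gradientWithin_eq_of_mem hΩ hx, gradientWithin, gradient,
    hd.fderivWithin (hS.uniqueDiffOn (hΩ.inter Metric.isOpen_ball) x hxR)]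

/-- The bounded identity on Ω ∩ B(x₀, R), with its boundary split into the disjoint pieces S and the
sphere. -/
theorem integral_green_layers_truncated (hΩ : IsOpen Ω) (hS : HasLipschitzBoundary Ω)
    (hx₀ : x₀ ∈ frontier Ω) (hr : Ωᶜ ⊆ Metric.ball x₀ R) (hu : IsPotential Ω u) (h0 : u x₀ = 0) :
    let D : (E3 → E3) → E3 → ℝ := fun ν x => u x * ⟪∇ (green x₀) x, ν x⟫
    let N : (E3 → E3) → E3 → ℝ := fun ν x => ⟪gradientWithin u (closure Ω) x, ν x⟫ * green x₀ x
    let ν := outwardNormal Ω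
    let νR := outwardNormal (Metric.ball x₀ R)
    IntegrableOn (D ν) (frontier Ω) μHE[2] ∧ IntegrableOn (N ν) (frontier Ω) μHE[2] ∧
      IntegrableOn (D νR) (Metric.sphere x₀ R) μHE[2] ∧
      IntegrableOn (N νR) (Metric.sphere x₀ R) μHE[2] ∧
      (∫ x in frontier Ω, D ν x ∂μHE[2]) + ∫ x in Metric.sphere x₀ R, D νR x ∂μHE[2] =
        (∫ x in frontier Ω, N ν x ∂μHE[2]) + ∫ x in Metric.sphere x₀ R, N νR x ∂μHE[2] := by
  intro D N ν νR
  have hR : 0 < R := Metric.pos_of_mem_ball (mem_ball_of_mem_frontier hΩ hr hx₀)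
  have hSR := hasLipschitzBoundary_inter_ball hS hΩ hR hr
  have hfr := frontier_inter_ball hΩ hR hr
  have hΩR : IsOpen (Ω ∩ Metric.ball x₀ R) := hΩ.inter Metric.isOpen_ball
  have hbR : IsBounded (Ω ∩ Metric.ball x₀ R) := Metric.isBounded_ball.subset inter_subset_right
  have huR : IsPotential (Ω ∩ Metric.ball x₀ R) u := hu.mono inter_subset_left
  have hxR : x₀ ∈ frontier (Ω ∩ Metric.ball x₀ R) := hfr ▸ Or.inl hx₀
  obtain ⟨i1, i2⟩ := integrableOn_green_layers huR hSR hΩR hbR hxR h0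
  have heq := integral_green_layers huR hSR hΩR hbR hxR h0
  have hm1 : MeasurableSet (frontier Ω) := isClosed_frontier.measurableSet
  have hm2 : MeasurableSet (Metric.sphere x₀ R) := Metric.isClosed_sphere.measurableSet
  have hn1 : ∀ x ∈ frontier Ω, outwardNormal (Ω ∩ Metric.ball x₀ R) x = ν x := fun x hx =>
    outwardNormal_congr (inter_ball_eventuallyEq_left (mem_ball_of_mem_frontier hΩ hr hx))
  have hn2 : ∀ x ∈ Metric.sphere x₀ R, outwardNormal (Ω ∩ Metric.ball x₀ R) x = νR x := fun x hx =>
    outwardNormal_congr (inter_ball_eventuallyEq_right hΩ (mem_of_mem_sphere hr hx))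
  have hg1 : ∀ x ∈ frontier Ω, gradientWithin u (closure (Ω ∩ Metric.ball x₀ R)) x =
      gradientWithin u (closure Ω) x := fun x hx =>
    gradientWithin_inter_ball_of_mem_ball (mem_ball_of_mem_frontier hΩ hr hx)
  have hg2 : ∀ x ∈ Metric.sphere x₀ R, gradientWithin u (closure (Ω ∩ Metric.ball x₀ R)) x =
      gradientWithin u (closure Ω) x := fun x hx =>
    gradientWithin_inter_ball_of_mem hu hΩ hSR (mem_of_mem_sphere hr hx)
      (frontier_subset_closure (hfr ▸ Or.inr hx))
  have hD1 : EqOn (fun x => u x * ⟪∇ (green x₀) x, outwardNormal (Ω ∩ Metric.ball x₀ R) x⟫) (D ν)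
      (frontier Ω) := fun x hx => by simp only [D, hn1 x hx]
  have hD2 : EqOn (fun x => u x * ⟪∇ (green x₀) x, outwardNormal (Ω ∩ Metric.ball x₀ R) x⟫) (D νR)
      (Metric.sphere x₀ R) := fun x hx => by simp only [D, hn2 x hx]
  have hN1 : EqOn (fun x => ⟪gradientWithin u (closure (Ω ∩ Metric.ball x₀ R)) x,
      outwardNormal (Ω ∩ Metric.ball x₀ R) x⟫ * green x₀ x) (N ν) (frontier Ω) := fun x hx => by
    simp only [N, hn1 x hx, hg1 x hx]
  have hN2 : EqOn (fun x => ⟪gradientWithin u (closure (Ω ∩ Metric.ball x₀ R)) x,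
      outwardNormal (Ω ∩ Metric.ball x₀ R) x⟫ * green x₀ x) (N νR) (Metric.sphere x₀ R) :=
    fun x hx => by simp only [N, hn2 x hx, hg2 x hx]
  have hdisj : Disjoint (frontier Ω) (Metric.sphere x₀ R) :=
    disjoint_left.2 fun x h1 h2 =>
      (mem_ball_iff_norm.1 (mem_ball_of_mem_frontier hΩ hr h1)).ne (mem_sphere_iff_norm.1 h2)
  rw [hfr] at i1 i2 heq
  rw [setIntegral_union hdisj hm2 i1.left_of_union i1.right_of_union,
    setIntegral_union hdisj hm2 i2.left_of_union i2.right_of_union,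
    setIntegral_congr_fun hm1 hD1, setIntegral_congr_fun hm2 hD2,
    setIntegral_congr_fun hm1 hN1, setIntegral_congr_fun hm2 hN2] at heq
  exact ⟨i1.left_of_union.congr_fun hD1 hm1, i2.left_of_union.congr_fun hN1 hm1,
    i1.right_of_union.congr_fun hD2 hm2, i2.right_of_union.congr_fun hN2 hm2, heq⟩

/-! ### Large spheres -/

theorem eventually_forall_mem_sphere {p : E3 → Prop} (h : ∀ᶠ x in cobounded E3, p x) (x₀ : E3) :
    ∀ᶠ R : ℝ in atTop, ∀ x ∈ Metric.sphere x₀ R, p x := by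
  obtain ⟨r, -, hr⟩ := (Metric.hasBasis_cobounded_compl_closedBall x₀).eventually_iff.1 h
  filter_upwards [eventually_gt_atTop r] with R hR x hx
  refine hr ?_
  rw [mem_compl_iff, Metric.mem_closedBall, not_le, Metric.mem_sphere.1 hx]
  exact hR

/-- The comparison function L/R² integrates to exactly 4πL over the sphere, and an error ε/R²
contributes at most 4πε. -/
theorem tendsto_integral_sphere {w : ℝ → E3 → ℝ} {L : ℝ}
    (hw : ∀ᶠ R in atTop, IntegrableOn (w R) (Metric.sphere x₀ R) μHE[2])
    (h : ∀ ε > 0, ∀ᶠ R in atTop, ∀ x ∈ Metric.sphere x₀ R, |w R x - L / R ^ 2| ≤ ε / R ^ 2) :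
    Tendsto (fun R => ∫ x in Metric.sphere x₀ R, w R x ∂μHE[2]) atTop
      (𝓝 (4 * Real.pi * L)) := by
  have hpi := Real.pi_pos
  rw [Metric.tendsto_nhds]
  intro ε hε
  filter_upwards [hw, h (ε / (8 * Real.pi)) (by positivity), eventually_gt_atTop 0] with R hwR hR hR0
  have hfin := measure_sphere_lt_top x₀ hR0
  have hconst : ∫ _ in Metric.sphere x₀ R, L / R ^ 2 ∂μHE[2] = 4 * Real.pi * L := by
    rw [setIntegral_const, measureReal_sphere x₀ hR0, smul_eq_mul]
    field_simp
  rw [dist_eq_norm, ← hconst, ← integral_sub hwR (integrableOn_const hfin.ne)]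
  refine (norm_setIntegral_le_of_norm_le_const hfin hR).trans_lt ?_
  rw [measureReal_sphere x₀ hR0]
  calc _ = ε / 2 := by field_simp; ring
    _ < ε := half_lt_self hε

theorem isBigO_one_div_norm_sub (x₀ : E3) :
    (fun x : E3 => 1 / ‖x‖) =O[cobounded E3] fun x => 1 / ‖x - x₀‖ := by
  refine Asymptotics.IsBigO.of_bound 2 ?_
  have h := tendsto_norm_cobounded_atTop (E := E3)
  filter_upwards [h.eventually_ge_atTop ‖x₀‖, h.eventually_gt_atTop 0,
    (tendsto_norm_cobounded_atTop.comp (tendsto_sub_const_cobounded x₀)).eventually_gt_atTop 0]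
    with x h1 h2 h3
  have h4 : 0 < ‖x - x₀‖ := h3
  rw [norm_div, norm_div, norm_norm, norm_norm, norm_one, mul_one_div, div_le_div_iff₀ h2 h4]
  linarith [norm_sub_le x x₀]

theorem tendsto_one_div_norm_cobounded :
    Tendsto (fun x : E3 => 1 / ‖x‖) (cobounded E3) (𝓝 0) := by
  simpa [Function.comp_def] using
    tendsto_inv_atTop_zero.comp (tendsto_norm_cobounded_atTop (E := E3))

theorem DecaysAtInfinity.tendsto (h : DecaysAtInfinity Ω u) :
    Tendsto u (cobounded E3) (𝓝 0) :=
  h.1.trans_tendsto tendsto_one_div_norm_cobounded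

/-- Multiplied by G = 1/R on the sphere, this is o(1/R²), just enough to make the single layer at
infinity vanish. -/
theorem DecaysAtInfinity.isLittleO (h : DecaysAtInfinity Ω u) (x₀ : E3) :
    gradientWithin u (closure Ω) =o[cobounded E3] fun x => 1 / ‖x - x₀‖ := by
  refine (h.2.trans_isLittleO ?_).trans_isBigO (isBigO_one_div_norm_sub x₀)
  have h1 : (fun x : E3 => 1 / ‖x‖) =o[cobounded E3] fun _ => (1 : ℝ) :=
    (Asymptotics.isLittleO_one_iff ℝ).2 tendsto_one_div_norm_cobounded
  refine (h1.mul_isBigO (Asymptotics.isBigO_refl (fun x : E3 => 1 / ‖x‖) _)).congr ?_ ?_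
  · intro x
    rw [div_mul_div_comm, one_mul, sq]
  · simp

theorem inner_gradient_green_outwardNormal_ball (hR : 0 < R) (hx : x ∈ Metric.sphere x₀ R) :
    ⟪∇ (green x₀) x, outwardNormal (Metric.ball x₀ R) x⟫ = -(1 / R ^ 2) := by
  have hn := mem_sphere_iff_norm.1 hx
  have hne : x ≠ x₀ := fun h => by
    rw [h, sub_self, norm_zero] at hn
    exact hR.ne hn
  rw [gradient_green hne, outwardNormal_ball hR hx, real_inner_smul_left, real_inner_smul_right,
    real_inner_self_eq_norm_sq, hn]
  field_simp

/-- The integral equation for external domains. -/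
theorem integral_layerIntegrands_exterior (hΩ : IsOpen Ω) (hS : HasLipschitzBoundary Ω)
    (hx₀ : x₀ ∈ frontier Ω) (hb : IsBounded Ωᶜ) (hφ : IsPotential Ω φ)
    (hφd : DecaysAtInfinity Ω φ) (hf : IsAdmissible Ω x₀ n₀ f)
    (hfd : DecaysAtInfinity Ω fun x => f x - c) :
    IntegrableOn (doubleLayerIntegrand Ω x₀ n₀ φ f (outwardNormal Ω)) (frontier Ω) μHE[2] ∧
      IntegrableOn (singleLayerIntegrand Ω x₀ n₀ φ f (outwardNormal Ω)) (frontier Ω) μHE[2] ∧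
      Tendsto (fun R : ℝ => ∫ x in Metric.sphere x₀ R,
          doubleLayerIntegrand Ω x₀ n₀ φ f (outwardNormal (Metric.ball x₀ R)) x ∂μHE[2])
        atTop (𝓝 (4 * Real.pi * (φ x₀ + normalDeriv Ω φ x₀ n₀ * c))) ∧
      Tendsto (fun R : ℝ => ∫ x in Metric.sphere x₀ R,
          singleLayerIntegrand Ω x₀ n₀ φ f (outwardNormal (Metric.ball x₀ R)) x ∂μHE[2])
        atTop (𝓝 0) ∧
      (∫ x in frontier Ω, doubleLayerIntegrand Ω x₀ n₀ φ f (outwardNormal Ω) x ∂μHE[2]) +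
          4 * Real.pi * (φ x₀ + normalDeriv Ω φ x₀ n₀ * c) =
        ∫ x in frontier Ω, singleLayerIntegrand Ω x₀ n₀ φ f (outwardNormal Ω) x ∂μHE[2] := by
  set d := normalDeriv Ω φ x₀ n₀ with hd
  have hu := hφ.reducedPotential hf.1 x₀ n₀
  have h0 : reducedPotential Ω x₀ n₀ φ f x₀ = 0 := reducedPotential_self hf.2.1
  have hm1 : MeasurableSet (frontier Ω) := isClosed_frontier.measurableSet
  obtain ⟨r, hr⟩ := hb.subset_ball x₀
  have hrR : ∀ R, r ≤ R → Ωᶜ ⊆ Metric.ball x₀ R := fun R h =>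
    hr.trans (Metric.ball_subset_ball h)
  have key := fun R (h : r ≤ R) =>
    integral_green_layers_truncated hΩ hS hx₀ (hrR R h) hu h0
  have hN1 : EqOn (fun x => ⟪gradientWithin (reducedPotential Ω x₀ n₀ φ f) (closure Ω) x,
      outwardNormal Ω x⟫ * green x₀ x) (singleLayerIntegrand Ω x₀ n₀ φ f (outwardNormal Ω))
      (frontier Ω) := fun x hx =>
    (singleLayerIntegrand_eq hS hΩ hφ hf.1 _ (frontier_subset_closure hx)).symm
  have hN2 : ∀ R, r ≤ R → EqOn (fun x => ⟪gradientWithin (reducedPotential Ω x₀ n₀ φ f)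
      (closure Ω) x, outwardNormal (Metric.ball x₀ R) x⟫ * green x₀ x)
      (singleLayerIntegrand Ω x₀ n₀ φ f (outwardNormal (Metric.ball x₀ R)))
      (Metric.sphere x₀ R) := fun R h x hx =>
    (singleLayerIntegrand_eq hS hΩ hφ hf.1 _
      (subset_closure (mem_of_mem_sphere (hrR R h) hx))).symm
  have hulim : Tendsto (reducedPotential Ω x₀ n₀ φ f) (cobounded E3) (𝓝 (-(φ x₀ + d * c))) := by
    have h := (hφd.tendsto.sub_const (φ x₀)).sub ((hfd.tendsto.add_const c).const_mul d)
    refine (h.congr fun x => ?_).trans_eq ?_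
    · simp [reducedPotential, hd]
    · congr 1
      ring
  have hgf : gradientWithin (fun x => f x - c) (closure Ω) = gradientWithin f (closure Ω) := by
    funext x
    rw [gradientWithin, gradientWithin, fderivWithin_sub_const]
  have hglim : (gradientWithin (reducedPotential Ω x₀ n₀ φ f) (closure Ω)) =o[cobounded E3]
      fun x => 1 / ‖x - x₀‖ := by
    have h2 := hfd.isLittleO x₀
    rw [hgf] at h2
    refine ((hφd.isLittleO x₀).sub (h2.const_smul_left d)).congr' ?_ EventuallyEq.rfl
    have hmem : ∀ᶠ x in cobounded E3, x ∈ Ω := by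
      have := isBounded_def.1 hb
      rwa [compl_compl] at this
    filter_upwards [hmem] with x hx
    have hx' := subset_closure hx
    exact (gradientWithin_reducedPotential ((hφ.2 x hx').differentiableWithinAt (by simp))
      ((hf.1.2 x hx').differentiableWithinAt (by simp)) (hS.uniqueDiffOn hΩ x hx')).symm
  have hA : Tendsto (fun R : ℝ => ∫ x in Metric.sphere x₀ R,
      doubleLayerIntegrand Ω x₀ n₀ φ f (outwardNormal (Metric.ball x₀ R)) x ∂μHE[2])
      atTop (𝓝 (4 * Real.pi * (φ x₀ + d * c))) := by
    refine tendsto_integral_sphere ?_ fun ε hε => ?_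
    · filter_upwards [eventually_ge_atTop r] with R hR using (key R hR).2.2.1
    · filter_upwards [eventually_forall_mem_sphere (Metric.tendsto_nhds.1 hulim ε hε) x₀,
        eventually_gt_atTop 0] with R hR hR0 x hx
      have h1 := (hR x hx).le
      rw [Real.dist_eq] at h1
      rw [doubleLayerIntegrand_eq]
      beta_reduce
      rw [inner_gradient_green_outwardNormal_ball hR0 hx,
        -- The sign of ∂G/∂n = −1/R² cancels the sign of the limit −(φ(x₀) + dc) of the reduced
        -- potential.
        show reducedPotential Ω x₀ n₀ φ f x * -(1 / R ^ 2) - (φ x₀ + d * c) / R ^ 2 =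
          -((reducedPotential Ω x₀ n₀ φ f x - -(φ x₀ + d * c)) / R ^ 2) by ring, abs_neg, abs_div,
        abs_of_pos (by positivity : 0 < R ^ 2)]
      gcongr
  have hB : Tendsto (fun R : ℝ => ∫ x in Metric.sphere x₀ R,
      singleLayerIntegrand Ω x₀ n₀ φ f (outwardNormal (Metric.ball x₀ R)) x ∂μHE[2])
      atTop (𝓝 0) := by
    have h := tendsto_integral_sphere (x₀ := x₀) (L := 0)
      (w := fun R => singleLayerIntegrand Ω x₀ n₀ φ f (outwardNormal (Metric.ball x₀ R))) ?_ ?_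
    · simpa using h
    · filter_upwards [eventually_ge_atTop r] with R hR
      exact (key R hR).2.2.2.1.congr_fun (hN2 R hR) Metric.isClosed_sphere.measurableSet
    · intro ε hε
      filter_upwards [eventually_forall_mem_sphere (hglim.def hε) x₀, eventually_gt_atTop 0,
        eventually_ge_atTop r] with R hR hR0 hRr x hx
      have h1 := hR x hx
      rw [norm_div, norm_one, norm_norm, mem_sphere_iff_norm.1 hx] at h1
      rw [← hN2 R hRr hx, zero_div, sub_zero, abs_mul, green, mem_sphere_iff_norm.1 hx,
        abs_of_pos (by positivity : 0 < 1 / R)]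
      calc _ ≤ ε * (1 / R) * 1 * (1 / R) := by
            gcongr
            refine (abs_real_inner_le_norm _ _).trans ?_
            gcongr
            exact norm_outwardNormal_le _ x
        _ = ε / R ^ 2 := by ring
  obtain ⟨i1, i2, -, -, -⟩ := key r le_rfl
  refine ⟨i1, i2.congr_fun hN1 hm1, hA, hB, ?_⟩
  have hlim := (hA.const_add (∫ x in frontier Ω,
    doubleLayerIntegrand Ω x₀ n₀ φ f (outwardNormal Ω) x ∂μHE[2])).sub hB
  rw [sub_zero] at hlim
  -- For every R ≥ r the truncated identity says that this expression equals the single-layer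
  -- integral over S, which does not depend on R.
  refine tendsto_nhds_unique hlim (tendsto_const_nhds.congr' ?_)
  filter_upwards [eventually_ge_atTop r] with R hR
  have heq := (key R hR).2.2.2.2
  rw [setIntegral_congr_fun hm1 hN1,
    setIntegral_congr_fun Metric.isClosed_sphere.measurableSet (hN2 R hR)] at heq
  exact (sub_eq_iff_eq_add.2 heq).symm

end

end NSBIM

namespace NSBIM

noncomputable section

variable {Ω U : Set E3} {x x₀ n₀ : E3} {u φ f : E3 → ℝ}
  {e : E3 ≃ᵃⁱ[ℝ] WithLp 2 (E2 × ℝ)} {g : E2 → ℝ}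

/-! ### Regularity of the normal on a `C²` boundary -/

theorem contDiff_gradient_of_contDiff_two (hg : ContDiff ℝ 2 g) : ContDiff ℝ 1 (gradient g) :=
  (toDual ℝ E2).symm.toContinuousLinearEquiv.contDiff.comp (hg.fderiv_right (m := 1) (by norm_num))

theorem contDiff_areaFactor : ContDiff ℝ 1 areaFactor :=
  (contDiff_const.add (contDiff_norm_sq ℝ)).sqrt fun x => by positivity

theorem contDiff_graphUnitNormal (hg : ContDiff ℝ 2 g) : ContDiff ℝ 1 (graphUnitNormal e g) := by
  have h1 := contDiff_gradient_of_contDiff_two hg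
  have h2 : ContDiff ℝ 1 (graphNormal e g) :=
    e.linearIsometryEquiv.symm.toContinuousLinearEquiv.contDiff.comp
      ((WithLp.prodContinuousLinearEquiv 2 ℝ E2 ℝ).symm.contDiff.comp
        (h1.neg.prodMk contDiff_const))
  exact ((contDiff_areaFactor.comp h1).inv fun y => (areaFactor_pos _).ne').smul h2

theorem contDiff_chart : ContDiff ℝ 2 fun x : E3 => e x := by
  have h : (fun x : E3 => e x) = fun x => e.linearIsometryEquiv x + e 0 := by
    funext x
    simpa using e.map_vadd 0 x
  rw [h]
  exact e.linearIsometryEquiv.toContinuousLinearEquiv.contDiff.add contDiff_const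

theorem contDiff_fst_chart : ContDiff ℝ 2 fun x : E3 => (e x).fst :=
  (WithLp.fstL 2 ℝ E2 ℝ).contDiff.comp contDiff_chart

theorem contDiff_level (hg : ContDiff ℝ 2 g) : ContDiff ℝ 2 (level e g) :=
  (hg.comp contDiff_fst_chart).sub ((WithLp.sndL 2 ℝ E2 ℝ).contDiff.comp contDiff_chart)

/-- The derivative varies by at most C‖x − x₀‖ on the ball of radius ‖x − x₀‖; the mean value
inequality supplies the second factor. -/
theorem isBigO_taylor_of_contDiff_two {ψ : E3 → ℝ} (hψ : ContDiff ℝ 2 ψ) (x₀ : E3) :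
    (fun x => ψ x - ψ x₀ - fderiv ℝ ψ x₀ (x - x₀)) =O[𝓝 x₀] fun x => ‖x - x₀‖ ^ 2 := by
  have hd : DifferentiableAt ℝ (fderiv ℝ ψ) x₀ :=
    ((hψ.fderiv_right (m := 1) (by norm_num)).differentiable (by simp)) x₀
  obtain ⟨C, hC⟩ := hd.isBigO_sub.bound
  obtain ⟨r, hr, hball⟩ := Metric.mem_nhds_iff.1 hC
  refine Asymptotics.IsBigO.of_bound C ?_
  filter_upwards [Metric.ball_mem_nhds x₀ hr] with x hx
  have hC0 : 0 ≤ C * ‖x - x₀‖ := (norm_nonneg _).trans (hball hx)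
  have hsub : Metric.closedBall x₀ ‖x - x₀‖ ⊆ Metric.ball x₀ r :=
    Metric.closedBall_subset_ball (mem_ball_iff_norm.1 hx)
  have hbound : ∀ z ∈ Metric.closedBall x₀ ‖x - x₀‖,
      ‖fderiv ℝ ψ z - fderiv ℝ ψ x₀‖ ≤ C * ‖x - x₀‖ := by
    intro z hz
    refine (hball (hsub hz)).trans ?_
    -- The constant taken from the `IsBigO` bound may be negative, but then nonnegativity of the
    -- bound forces x = x₀.
    by_cases hx0 : 0 ≤ C
    · exact mul_le_mul_of_nonneg_left (mem_closedBall_iff_norm.1 hz) hx0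
    · have h0 : ‖x - x₀‖ = 0 := by
        by_contra h
        have := norm_nonneg (x - x₀)
        nlinarith [lt_of_le_of_ne this (Ne.symm h)]
      have h1 := mem_closedBall_iff_norm.1 hz
      rw [h0] at h1 ⊢
      rw [le_antisymm h1 (norm_nonneg _)]
  have h := (convex_closedBall x₀ ‖x - x₀‖).norm_image_sub_le_of_norm_fderiv_le' (𝕜 := ℝ)
    (fun z _ => hψ.differentiable (by simp) z) hbound
    (Metric.mem_closedBall_self (norm_nonneg _)) (mem_closedBall_iff_norm.2 le_rfl)
  rw [norm_pow, norm_norm]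
  exact h.trans_eq (by ring)

/-- The normal is a C¹ function of the slope and position. Split ⟪x − x₀, n(x)⟫ into ⟪x − x₀, n(x) −
n(x₀)⟫ and ⟪x − x₀, n(x₀)⟫; the latter is a multiple of the Taylor remainder of the level, which
vanishes along S. -/
theorem HasC2BoundaryNear.isBigO_outwardNormal (h2 : HasC2BoundaryNear Ω x₀) (hΩ : IsOpen Ω)
    (hx₀ : x₀ ∈ frontier Ω) :
    (fun x => outwardNormal Ω x - outwardNormal Ω x₀) =O[𝓝[frontier Ω] x₀] (fun x => ‖x - x₀‖) ∧
    (fun x => ⟪x - x₀, outwardNormal Ω x⟫) =O[𝓝[frontier Ω] x₀] fun x => ‖x - x₀‖ ^ 2 := by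
  obtain ⟨e, g, U, hg, hU, hch⟩ := h2.exists_chart
  have hgd : Differentiable ℝ g := hg.differentiable (by simp)
  have h0 : level e g x₀ = 0 := (hch.mem_frontier_iff hΩ hg.continuous hU).1 hx₀
  have hev : ∀ᶠ x in 𝓝[frontier Ω] x₀,
      outwardNormal Ω x = graphUnitNormal e g (e x).fst ∧ level e g x = 0 := by
    filter_upwards [self_mem_nhdsWithin, nhdsWithin_le_nhds (hch.isOpen.mem_nhds hU)] with x hx hxU
    have hl := (hch.mem_frontier_iff hΩ hg.continuous hxU).1 hx
    exact ⟨hch.outwardNormal_eq hxU hl (hgd _), hl⟩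
  have hn₀ : outwardNormal Ω x₀ = graphUnitNormal e g (e x₀).fst :=
    hch.outwardNormal_eq hU h0 (hgd _)
  have hdiff : DifferentiableAt ℝ (fun x => graphUnitNormal e g (e x).fst) x₀ :=
    (((contDiff_graphUnitNormal hg).comp (contDiff_fst_chart.of_le (by norm_num))).differentiable
      (by simp)) x₀
  have hN : (fun x => outwardNormal Ω x - outwardNormal Ω x₀) =O[𝓝[frontier Ω] x₀]
      fun x => ‖x - x₀‖ := by
    refine (hdiff.isBigO_sub.norm_right.mono nhdsWithin_le_nhds).congr' ?_ EventuallyEq.rfl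
    filter_upwards [hev] with x hx
    rw [hx.1, hn₀]
  refine ⟨hN, ?_⟩
  have hself : (fun x => x - x₀) =O[𝓝[frontier Ω] x₀] fun x => ‖x - x₀‖ :=
    (Asymptotics.isBigO_refl _ _).norm_right
  have hT : (fun x => ⟪x - x₀, outwardNormal Ω x₀⟫) =O[𝓝[frontier Ω] x₀]
      fun x => ‖x - x₀‖ ^ 2 := by
    have h := ((isBigO_taylor_of_contDiff_two (contDiff_level (e := e) hg) x₀).mono
      (nhdsWithin_le_nhds (s := frontier Ω))).const_mul_left (areaFactor (∇ g (e x₀).fst))⁻¹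
    refine h.congr' ?_ EventuallyEq.rfl
    filter_upwards [hev] with x hx
    rw [hx.2, h0, (hasGradientAt_level (hgd _)).hasFDerivAt.fderiv, toDual_apply_apply,
      inner_neg_left, hn₀, graphUnitNormal, real_inner_smul_right, real_inner_comm]
    ring
  have hI : (fun x => ⟪x - x₀, outwardNormal Ω x - outwardNormal Ω x₀⟫) =O[𝓝[frontier Ω] x₀]
      fun x => ‖x - x₀‖ ^ 2 := by
    have h := hself.norm_left.mul hN.norm_left
    refine (Asymptotics.IsBigO.of_norm_le fun x => ?_).trans (h.congr_right fun x => (sq _).symm)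
    exact norm_inner_le_norm _ _
  refine (hI.add hT).congr_left fun x => ?_
  rw [← inner_add_right, sub_add_cancel]

/-! ### Non-singularity -/

theorem isBigO_gradientWithin_sub (hS : HasLipschitzBoundary Ω) (hΩ : IsOpen Ω)
    (hx₀ : x₀ ∈ closure Ω) (hu : ContDiffWithinAt ℝ 2 u (closure Ω) x₀) :
    (fun x => gradientWithin u (closure Ω) x - gradientWithin u (closure Ω) x₀)
      =O[𝓝[closure Ω] x₀] fun x => ‖x - x₀‖ := by
  have hd : DifferentiableWithinAt ℝ (fderivWithin ℝ u (closure Ω)) (closure Ω) x₀ :=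
    (hu.fderivWithin_right (m := 1) (hS.uniqueDiffOn hΩ) (by norm_num) hx₀).differentiableWithinAt
      (by simp)
  have h : DifferentiableWithinAt ℝ (gradientWithin u (closure Ω)) (closure Ω) x₀ :=
    (toDual ℝ E3).symm.toContinuousLinearEquiv.differentiableAt.comp_differentiableWithinAt x₀ hd
  exact h.isBigO_sub.norm_right

theorem exists_bound_of_isBigO_one {s : Set E3} {w : E3 → ℝ}
    (h : w =O[𝓝[s \ {x₀}] x₀] fun _ => (1 : ℝ))
    (h' : ∀ δ > 0, ∃ C, ∀ x ∈ s, δ ≤ ‖x - x₀‖ → |w x| ≤ C) :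
    ∃ C, ∀ x ∈ s \ {x₀}, |w x| ≤ C := by
  obtain ⟨C₁, h₁⟩ := h.bound
  obtain ⟨δ, hδ, hball⟩ := Metric.mem_nhdsWithin_iff.1 h₁
  obtain ⟨C₂, h₂⟩ := h' δ hδ
  refine ⟨max C₁ C₂, fun x hx => ?_⟩
  by_cases hxδ : x ∈ Metric.ball x₀ δ
  · have := hball ⟨hxδ, hx⟩
    simp only [mem_ofPred_eq, norm_one, mul_one] at this
    exact this.trans (le_max_left _ _)
  · rw [mem_ball_iff_norm, not_lt] at hxδ
    exact (h₂ x hx.1 hxδ).trans (le_max_right _ _)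

/-- The orders 1 from u and 2 from (x − x₀)·n(x) exactly balance |x − x₀|⁻³. -/
theorem isBigO_doubleLayer (hΩ : IsOpen Ω) (h2 : HasC2BoundaryNear Ω x₀) (hx₀ : x₀ ∈ frontier Ω)
    (hu : IsPotential Ω u) (h0 : u x₀ = 0) :
    (fun x => u x * ⟪∇ (green x₀) x, outwardNormal Ω x⟫) =O[𝓝[frontier Ω \ {x₀}] x₀]
      fun _ => (1 : ℝ) := by
  have hd : DifferentiableWithinAt ℝ u (closure Ω) x₀ :=
    (hu.2 x₀ (frontier_subset_closure hx₀)).differentiableWithinAt (by simp)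
  have h1 : u =O[𝓝[frontier Ω \ {x₀}] x₀] fun x => ‖x - x₀‖ := by
    refine (hd.isBigO_sub.norm_right.mono (nhdsWithin_mono _ ?_)).congr_left fun x => ?_
    · exact sdiff_subset.trans frontier_subset_closure
    · rw [h0, sub_zero]
  have h3 := (h2.isBigO_outwardNormal hΩ hx₀).2.mono
    (nhdsWithin_mono x₀ (sdiff_subset (s := frontier Ω) (t := {x₀})))
  have h4 := (h1.mul h3).mul
    (Asymptotics.isBigO_refl (fun x : E3 => -(‖x - x₀‖ ^ 3)⁻¹) (𝓝[frontier Ω \ {x₀}] x₀))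
  refine (h4.congr' ?_ EventuallyEq.rfl).trans (Asymptotics.IsBigO.of_bound 1 ?_)
  · filter_upwards [self_mem_nhdsWithin] with x hx
    rw [gradient_green hx.2, real_inner_smul_left]
    ring
  · filter_upwards [self_mem_nhdsWithin] with x hx
    have hn : ‖x - x₀‖ ≠ 0 := norm_ne_zero_iff.2 (sub_ne_zero.2 hx.2)
    rw [show ‖x - x₀‖ * ‖x - x₀‖ ^ 2 * -(‖x - x₀‖ ^ 3)⁻¹ = -1 by field_simp]
    simp

/-- Since ∂u/∂n = 0 at x₀, and both ∇u and the normal vary by O(|x − x₀|), ∂u/∂n is O(|x − x₀|) and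
balances G. -/
theorem isBigO_singleLayer (hΩ : IsOpen Ω) (hS : HasLipschitzBoundary Ω)
    (h2 : HasC2BoundaryNear Ω x₀) (hx₀ : x₀ ∈ frontier Ω)
    (hu : ContDiffWithinAt ℝ 2 u (closure Ω) x₀)
    (h0 : ⟪gradientWithin u (closure Ω) x₀, outwardNormal Ω x₀⟫ = 0) :
    (fun x => ⟪gradientWithin u (closure Ω) x, outwardNormal Ω x⟫ * green x₀ x)
      =O[𝓝[frontier Ω \ {x₀}] x₀] fun _ => (1 : ℝ) := by
  set l := 𝓝[frontier Ω \ {x₀}] x₀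
  set V := gradientWithin u (closure Ω)
  have h1 : (fun x => V x - V x₀) =O[l] fun x => ‖x - x₀‖ :=
    (isBigO_gradientWithin_sub hS hΩ (frontier_subset_closure hx₀) hu).mono
      (nhdsWithin_mono _ (sdiff_subset.trans frontier_subset_closure))
  have h3 : (fun x => outwardNormal Ω x - outwardNormal Ω x₀) =O[l] fun x => ‖x - x₀‖ :=
    (h2.isBigO_outwardNormal hΩ hx₀).1.mono (nhdsWithin_mono _ sdiff_subset)
  have h4 : (fun x => ⟪V x - V x₀, outwardNormal Ω x⟫) =O[l] fun x => ‖x - x₀‖ := by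
    refine (Asymptotics.IsBigO.of_norm_le (g := fun x => ‖V x - V x₀‖) fun x => ?_).trans
      h1.norm_left
    exact (norm_inner_le_norm _ _).trans
      (mul_le_of_le_one_right (norm_nonneg _) (norm_outwardNormal_le Ω x))
  have h5 : (fun x => ⟪V x₀, outwardNormal Ω x - outwardNormal Ω x₀⟫) =O[l]
      fun x => ‖x - x₀‖ := by
    refine (Asymptotics.IsBigO.of_bound ‖V x₀‖ (Eventually.of_forall fun x => ?_)).trans h3
    exact norm_inner_le_norm _ _
  have h6 := (h4.add h5).mul (Asymptotics.isBigO_refl (green x₀) l)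
  refine (h6.congr_left fun x => ?_).trans (Asymptotics.IsBigO.of_bound 1 ?_)
  · rw [inner_sub_left, inner_sub_right, h0]
    ring
  · filter_upwards [self_mem_nhdsWithin] with x hx
    have hn : ‖x - x₀‖ ≠ 0 := norm_ne_zero_iff.2 (sub_ne_zero.2 hx.2)
    rw [green, mul_one_div_cancel hn]
    simp

/-- Both integrands are bounded near a point where everything is of class `C²`. -/
theorem exists_bound_layerIntegrands (hΩ : IsOpen Ω) (hS : HasLipschitzBoundary Ω)
    (hx₀ : x₀ ∈ frontier Ω) (hn₀ : IsOutwardUnitNormal Ω x₀ n₀) (hb : IsBounded (frontier Ω))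
    (h2 : HasC2BoundaryNear Ω x₀) (hφ : IsPotential Ω φ) (hf : IsAdmissible Ω x₀ n₀ f)
    (hφ2 : ContDiffWithinAt ℝ 2 φ (closure Ω) x₀) (hf2 : ContDiffWithinAt ℝ 2 f (closure Ω) x₀) :
    ∃ C : ℝ, ∀ x ∈ frontier Ω \ {x₀},
      |doubleLayerIntegrand Ω x₀ n₀ φ f (outwardNormal Ω) x| ≤ C ∧
      |singleLayerIntegrand Ω x₀ n₀ φ f (outwardNormal Ω) x| ≤ C := by
  set u := reducedPotential Ω x₀ n₀ φ f with hu_def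
  have hu : IsPotential Ω u := hφ.reducedPotential hf.1 x₀ n₀
  have hcl := frontier_subset_closure hx₀
  have hu2 : ContDiffWithinAt ℝ 2 u (closure Ω) x₀ :=
    (hφ2.sub contDiffWithinAt_const).sub (contDiffWithinAt_const.mul hf2)
  -- The normalisation ∂f/∂n = 1 at x₀ enters here: subtracting (∂φ/∂n)₀ f removes the normal
  -- derivative of φ at x₀.
  have hgrad : ⟪gradientWithin u (closure Ω) x₀, outwardNormal Ω x₀⟫ = 0 := by
    rw [NSBIM.outwardNormal_eq hn₀, hu_def,
      gradientWithin_reducedPotential ((hφ.2 x₀ hcl).differentiableWithinAt (by simp))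
      ((hf.1.2 x₀ hcl).differentiableWithinAt (by simp)) (hS.uniqueDiffOn hΩ x₀ hcl),
      inner_sub_left, real_inner_smul_left]
    have h1 := hf.2.2
    rw [normalDeriv] at h1
    rw [h1, normalDeriv]
    ring
  have hcpt : IsCompact (frontier Ω) := Metric.isCompact_of_isClosed_isBounded isClosed_frontier hb
  obtain ⟨M₁, hM₁⟩ := hcpt.exists_bound_of_continuousOn
    (hu.continuousOn.mono frontier_subset_closure)
  obtain ⟨M₂, hM₂⟩ := hcpt.exists_bound_of_continuousOn
    ((hu.continuousOn_gradientWithin hS hΩ).mono frontier_subset_closure)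
  have hM₁0 : 0 ≤ M₁ := (norm_nonneg _).trans (hM₁ x₀ hx₀)
  have hM₂0 : 0 ≤ M₂ := (norm_nonneg _).trans (hM₂ x₀ hx₀)
  obtain ⟨C₁, hC₁⟩ := exists_bound_of_isBigO_one
    (isBigO_doubleLayer hΩ h2 hx₀ hu (reducedPotential_self hf.2.1)) fun δ hδ => by
      refine ⟨M₁ * (1 / δ ^ 2 * 1), fun x hx hxδ => ?_⟩
      have hne : x ≠ x₀ := fun h => by
        rw [h, sub_self, norm_zero] at hxδ
        exact hxδ.not_gt hδ
      rw [abs_mul]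
      gcongr
      · exact hM₁ x hx
      · refine (abs_real_inner_le_norm _ _).trans ?_
        rw [norm_gradient_green hne]
        gcongr
        exact norm_outwardNormal_le Ω x
  obtain ⟨C₂, hC₂⟩ := exists_bound_of_isBigO_one
    (isBigO_singleLayer hΩ hS h2 hx₀ hu2 hgrad) fun δ hδ => by
      refine ⟨M₂ * 1 * (1 / δ), fun x hx hxδ => ?_⟩
      rw [abs_mul, green, abs_of_nonneg (by positivity : 0 ≤ 1 / ‖x - x₀‖)]
      gcongr
      refine (abs_real_inner_le_norm _ _).trans ?_
      gcongr
      · exact hM₂ x hx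
      · exact norm_outwardNormal_le Ω x
  refine ⟨max C₁ C₂, fun x hx => ⟨(hC₁ x hx).trans (le_max_left _ _), ?_⟩⟩
  rw [singleLayerIntegrand_eq hS hΩ hφ hf.1 _ (frontier_subset_closure hx.1)]
  exact (hC₂ x hx).trans (le_max_right _ _)

end

end NSBIM

namespace NSBIM

noncomputable section

variable {Ω : Set E3} {x x₀ n₀ xD : E3} {u : E3 → ℝ}

/-! ### Explicit admissible functions -/

theorem gradientWithin_eq_gradient (hS : HasLipschitzBoundary Ω) (hΩ : IsOpen Ω)
    (hx : x ∈ closure Ω) {v : E3} (h : HasGradientAt u v x) : gradientWithin u (closure Ω) x = v := by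
  rw [← h.gradient, gradientWithin, gradient,
    h.differentiableAt.fderivWithin (hS.uniqueDiffOn hΩ x hx)]

theorem hasGradientAt_linearChoice (x : E3) : HasGradientAt (linearChoice x₀ n₀) n₀ x := by
  rw [hasGradientAt_iff_hasFDerivAt]
  exact (toDual ℝ E3 n₀).hasFDerivAt.comp x ((hasFDerivAt_id x).sub_const x₀)

theorem isAdmissible_linearChoice (hS : HasLipschitzBoundary Ω) (hΩ : IsOpen Ω)
    (hx₀ : x₀ ∈ closure Ω) (hn₀ : ‖n₀‖ = 1) : IsAdmissible Ω x₀ n₀ (linearChoice x₀ n₀) := by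
  have hc : ContDiff ℝ 2 (linearChoice x₀ n₀) :=
    contDiff_const.inner ℝ (contDiff_id.sub contDiff_const)
  refine ⟨⟨fun x _ => ⟨hc.contDiffAt, Eventually.of_forall fun z => ?_⟩,
    (hc.of_le (by norm_num)).contDiffOn⟩, by simp [linearChoice], ?_⟩
  · have hg : gradient (linearChoice x₀ n₀) = fun _ => n₀ :=
      funext fun z => (hasGradientAt_linearChoice z).gradient
    rw [← divergence_gradient hc.contDiffAt, hg]
    simp [divergence]
  · rw [normalDeriv, gradientWithin_eq_gradient hS hΩ hx₀ (hasGradientAt_linearChoice x₀),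
      real_inner_self_eq_norm_sq, hn₀, one_pow]

theorem inverseChoice_eq : inverseChoice x₀ n₀ xD =
    fun x => inverseCoeff x₀ n₀ xD * (1 - ‖x₀ - xD‖ * green xD x) := by
  funext x
  rw [inverseChoice, green, mul_one_div]

theorem hasGradientAt_inverseChoice (h : x ≠ xD) : HasGradientAt (inverseChoice x₀ n₀ xD)
    ((inverseCoeff x₀ n₀ xD * ‖x₀ - xD‖ * (‖x - xD‖ ^ 3)⁻¹) • (x - xD)) x := by
  have h1 := (((hasGradientAt_green h).hasFDerivAt.const_mul ‖x₀ - xD‖).const_sub 1).const_mul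
    (inverseCoeff x₀ n₀ xD)
  rw [inverseChoice_eq, hasGradientAt_iff_hasFDerivAt]
  refine h1.congr_fderiv ?_
  simp only [map_smul]
  module

theorem isPotential_inverseChoice (hD : xD ∉ closure Ω) :
    IsPotential Ω (inverseChoice x₀ n₀ xD) := by
  have hne : ∀ x ∈ closure Ω, x ≠ xD := fun x hx h => hD (h ▸ hx)
  rw [inverseChoice_eq]
  constructor
  · exact ((harmonicOnNhd_const (1 : ℝ)).sub (HarmonicOnNhd.const_smul (c := ‖x₀ - xD‖)
      fun x hx => harmonicAt_green (hne x (subset_closure hx)))).const_smul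
        (c := inverseCoeff x₀ n₀ xD)
  · exact contDiffOn_const.mul (contDiffOn_const.sub (contDiffOn_const.mul fun x hx =>
      (contDiffAt_green (n := 1) (hne x hx)).contDiffWithinAt))

/-- The normal derivative at x₀ is the coefficient times n₀·(x₀ − x_D)/|x₀ − x_D|², and the
coefficient is the reciprocal of that ratio. -/
theorem isAdmissible_inverseChoice (hS : HasLipschitzBoundary Ω) (hΩ : IsOpen Ω)
    (hx₀ : x₀ ∈ closure Ω) (hD : xD ∉ closure Ω) (hne : ⟪n₀, x₀ - xD⟫ ≠ 0) :
    IsAdmissible Ω x₀ n₀ (inverseChoice x₀ n₀ xD) := by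
  have hx : x₀ ≠ xD := fun h => hD (h ▸ hx₀)
  have hn : ‖x₀ - xD‖ ≠ 0 := norm_ne_zero_iff.2 (sub_ne_zero.2 hx)
  refine ⟨isPotential_inverseChoice hD, ?_, ?_⟩
  · rw [inverseChoice, div_self hn, sub_self, mul_zero]
  · rw [normalDeriv, gradientWithin_eq_gradient hS hΩ hx₀ (hasGradientAt_inverseChoice hx),
      real_inner_smul_left, real_inner_comm, inverseCoeff]
    field_simp

theorem isBigO_green_cobounded (y : E3) : green y =O[cobounded E3] fun x => 1 / ‖x‖ := by
  refine Asymptotics.IsBigO.of_bound 2 ?_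
  have h := tendsto_norm_cobounded_atTop (E := E3)
  filter_upwards [h.eventually_ge_atTop (2 * ‖y‖), h.eventually_gt_atTop 0] with x h1 h2
  have h3 := norm_sub_norm_le x y
  have h4 : 0 < ‖x - y‖ := by linarith
  rw [green, norm_div, norm_div, norm_norm, norm_norm, norm_one, mul_one_div,
    div_le_div_iff₀ h4 h2]
  linarith

/-- The difference is a constant multiple of the Green's function with pole x_D, and its gradient
has the size of that function squared. -/
theorem decaysAtInfinity_inverseChoice (hΩ : IsOpen Ω) (hb : IsBounded Ωᶜ)
    (hD : xD ∉ closure Ω) :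
    DecaysAtInfinity Ω fun x => inverseChoice x₀ n₀ xD x - inverseCoeff x₀ n₀ xD := by
  have hg := isBigO_green_cobounded xD
  constructor
  · refine (hg.const_mul_left (-(inverseCoeff x₀ n₀ xD * ‖x₀ - xD‖))).congr_left fun x => ?_
    rw [inverseChoice_eq]
    ring
  · refine Asymptotics.IsBigO.trans (Asymptotics.IsBigO.of_bound
      ‖inverseCoeff x₀ n₀ xD * ‖x₀ - xD‖‖ ?_) ((hg.pow 2).congr_right fun x => ?_)
    · have hmem : ∀ᶠ x in cobounded E3, x ∈ Ω := by
        have := isBounded_def.1 hb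
        rwa [compl_compl] at this
      filter_upwards [hmem] with x hx
      have hne : x ≠ xD := fun h => hD (h ▸ subset_closure hx)
      have hn : ‖x - xD‖ ≠ 0 := norm_ne_zero_iff.2 (sub_ne_zero.2 hne)
      rw [gradientWithin, fderivWithin_sub_const, ← gradientWithin, gradientWithin_eq_of_mem hΩ hx,
        (hasGradientAt_inverseChoice hne).gradient, norm_smul, norm_mul, mul_assoc]
      refine le_of_eq (congrArg _ ?_)
      rw [green, norm_inv, norm_pow, norm_pow, norm_div, norm_one, norm_norm]
      field_simp
    · rw [div_pow, one_pow]

end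

end NSBIM

/-! ### The integral equation, its non-singularity and the choices of f -/

theorem mainTheorem1 (Ω : Set E3) (hΩ : IsOpen Ω) (hS : HasLipschitzBoundary Ω)
    (x₀ n₀ : E3) (hx₀ : x₀ ∈ frontier Ω) (hn₀ : IsOutwardUnitNormal Ω x₀ n₀) :
    -- internal domains
    (IsBounded Ω → ∀ φ f : E3 → ℝ, IsPotential Ω φ → IsAdmissible Ω x₀ n₀ f →
      IntegrableOn (doubleLayerIntegrand Ω x₀ n₀ φ f (outwardNormal Ω)) (frontier Ω) μHE[2] ∧
      IntegrableOn (singleLayerIntegrand Ω x₀ n₀ φ f (outwardNormal Ω)) (frontier Ω) μHE[2] ∧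
      ∫ x in frontier Ω, doubleLayerIntegrand Ω x₀ n₀ φ f (outwardNormal Ω) x ∂μHE[2] =
        ∫ x in frontier Ω, singleLayerIntegrand Ω x₀ n₀ φ f (outwardNormal Ω) x ∂μHE[2]) ∧
    -- external domains, where the sphere at infinity contributes to the double-layer side
    (IsBounded Ωᶜ → ∀ (φ f : E3 → ℝ) (c : ℝ), IsPotential Ω φ → DecaysAtInfinity Ω φ →
      IsAdmissible Ω x₀ n₀ f → DecaysAtInfinity Ω (fun x => f x - c) →
      IntegrableOn (doubleLayerIntegrand Ω x₀ n₀ φ f (outwardNormal Ω)) (frontier Ω) μHE[2] ∧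
      IntegrableOn (singleLayerIntegrand Ω x₀ n₀ φ f (outwardNormal Ω)) (frontier Ω) μHE[2] ∧
      Tendsto (fun R : ℝ => ∫ x in Metric.sphere x₀ R,
          doubleLayerIntegrand Ω x₀ n₀ φ f (outwardNormal (Metric.ball x₀ R)) x ∂μHE[2])
        atTop (𝓝 (4 * Real.pi * (φ x₀ + normalDeriv Ω φ x₀ n₀ * c))) ∧
      Tendsto (fun R : ℝ => ∫ x in Metric.sphere x₀ R,
          singleLayerIntegrand Ω x₀ n₀ φ f (outwardNormal (Metric.ball x₀ R)) x ∂μHE[2])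
        atTop (𝓝 0) ∧
      (∫ x in frontier Ω, doubleLayerIntegrand Ω x₀ n₀ φ f (outwardNormal Ω) x ∂μHE[2]) +
          4 * Real.pi * (φ x₀ + normalDeriv Ω φ x₀ n₀ * c) =
        ∫ x in frontier Ω, singleLayerIntegrand Ω x₀ n₀ φ f (outwardNormal Ω) x ∂μHE[2]) ∧
    -- both integrands are non-singular
    (IsBounded (frontier Ω) → HasC2BoundaryNear Ω x₀ →
      ∀ φ f : E3 → ℝ, IsPotential Ω φ → IsAdmissible Ω x₀ n₀ f →
      ContDiffWithinAt ℝ 2 φ (closure Ω) x₀ → ContDiffWithinAt ℝ 2 f (closure Ω) x₀ →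
      ∃ C : ℝ, ∀ x ∈ frontier Ω \ {x₀},
        |doubleLayerIntegrand Ω x₀ n₀ φ f (outwardNormal Ω) x| ≤ C ∧
        |singleLayerIntegrand Ω x₀ n₀ φ f (outwardNormal Ω) x| ≤ C) ∧
    -- the two explicit choices of `f`
    IsAdmissible Ω x₀ n₀ (linearChoice x₀ n₀) ∧
    (∀ xD : E3, xD ∉ closure Ω → ⟪n₀, x₀ - xD⟫ ≠ 0 →
      IsAdmissible Ω x₀ n₀ (inverseChoice x₀ n₀ xD) ∧
      (IsBounded Ωᶜ → DecaysAtInfinity Ω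
        (fun x => inverseChoice x₀ n₀ xD x - inverseCoeff x₀ n₀ xD))) := by
  have hcl : x₀ ∈ closure Ω := frontier_subset_closure hx₀
  exact ⟨fun hb φ f hφ hf => integral_layerIntegrands_interior hΩ hS hx₀ hb hφ hf,
    fun hb φ f c hφ hφd hf hfd => integral_layerIntegrands_exterior hΩ hS hx₀ hb hφ hφd hf hfd,
    fun hb h2 φ f hφ hf hφ2 hf2 =>
      exists_bound_layerIntegrands hΩ hS hx₀ hn₀ hb h2 hφ hf hφ2 hf2,
    isAdmissible_linearChoice hS hΩ hcl hn₀.1,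
    fun xD hD hne => ⟨isAdmissible_inverseChoice hS hΩ hcl hD hne,
      fun hb => decaysAtInfinity_inverseChoice hΩ hb hD⟩⟩
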